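/- All graphs are finite and simple. A graph $G$ contains a graph $H$ as a weak immersion if there is a map $\phi$ that sends each vertex of $H$ to a vertex of $G$ and each edge of $H$ to a path in $G$ such that $\phi(u)\neq\phi(v)$ for distinct vertices $u,v$ of $H$, the path $\phi(e)$ has endpoints $\phi(u)$ and $\phi(v)$ for each edge $e=uv$ of $H$, and the paths $\phi(e)$ and $\phi(f)$ are edge-disjoint for distinct edges $e,f$ of $H$. Theorem. (i) Let $G$ be a graph with chromatic number $k$ and $n$ vertices. If $n<1.4k-0.6$, then $G$ contains the complete graph $K_k$ as a weak immersion. (ii) For every $\varepsilon>0$ there is an integer $K=K(\varepsilon)$ such that for every $k\ge K$, every graph $G$ with chromatic number $k$ and $n$ vertices, where $n<(1.64-\varepsilon)k$, contains $K_k$ as a weak immersion. -/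

import Mathlib

universe u

namespace SimpleGraph

/-- A weak immersion of `H` in `G`: an injective map of vertices to vertices, and a map of edges
of `H` to paths of `G`, such that an edge `uv` goes to a path with endpoints `branch u` and
`branch v`, and distinct edges go to edge-disjoint paths. -/
structure WeakImmersion {W V : Type*} (H : SimpleGraph W) (G : SimpleGraph V) where
  /-- the image of a vertex of `H` -/
  branch : W → V
  /-- one endpoint of the path assigned to an edge -/
  source : H.edgeSet → V
  /-- the other endpoint of the path assigned to an edge -/
  target : H.edgeSet → V
  /-- the path assigned to an edge -/
  path : ∀ e : H.edgeSet, G.Path (source e) (target e)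
  branch_injective : Function.Injective branch
  /-- as unordered pairs, the two endpoints are the images of the two ends of the edge -/
  endpoints : ∀ e : H.edgeSet, s(source e, target e) = Sym2.map branch (e : Sym2 W)
  edge_disjoint : ∀ e f : H.edgeSet, e ≠ f →
    List.Disjoint (path e : G.Walk (source e) (target e)).edges
      (path f : G.Walk (source f) (target f)).edges

/-- `G` contains `H` as a weak immersion. -/
def ContainsWeakImmersion {V W : Type*} (G : SimpleGraph V) (H : SimpleGraph W) : Prop :=
  Nonempty (WeakImmersion H G)

end SimpleGraph

/-! Pass to a critical vertex set `X` with chromatic number `k` and route `K_k` inside `X` by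
edge-disjoint connections (`Linked`). The set `X` is the join of its parts, the components of the
non-adjacency graph. Chromatic number and excess (number of vertices minus chromatic number) are
both additive over joins, so the problem can be treated part by part.

Three classical tools give the reduction. Gallai's theorem (`CriticalOn.exists_no_singles`) shows
that a part `C` has at least `2χ(C) - 1` vertices, hence `5χ(C) ≤ 3|C|` unless it is a single
vertex. Kempe chains (`CriticalOn.linked_of_tight`) link `K_χ` inside a critical set that has a
vertex of degree `χ - 1`. A part with such a vertex and a non-adjacent pair at it can be split off,
and `CriticalOn.linked_of_slack` reduces to the case where every vertex has codegree zero or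
codegree less than the excess of its part. Vizing's theorem (`exists_properEdge`) then shows that a
set joined to `Y`, with all nonzero codegrees below `|Y|`, can use `Y` as a hub: a proper colouring
of the non-adjacent pairs by vertices of `Y` gives edge-disjoint paths of length two
(`Routes.of_hub`).

If `X` is the join of `A` and `A'`, with `|A'|` at least the excess of `A` and conversely, each side
reserves a hub for the other and exactly `χ(X)` vertices remain as branch vertices
(`linked_of_hubs`). Choosing `A` with least excess among the unions of parts having at least half of
the total excess, this works unless `A` is one part whose excess exceeds the size of the rest
(`CriticalOn.linked_or_dominant`). For `5n + 4 ≤ 7k` a dominant part contradicts Gallai's bound,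
which proves (i).

For (ii) let `C` be the dominant part and `R` the rest. Now `R` is too small to be a hub for `C`
directly. A set `N` of non-branch vertices of `C` is chosen, and each branch vertex sends tokens
along edges to `N`, at least one for each of its non-neighbours among the branch vertices. Some
tokens move along one more edge inside `N` to even out the loads. A non-adjacent pair of branch
vertices becomes a pair of tokens, and these pairs form a multigraph on `N` of maximum degree about
`b/2` and bounded multiplicity, where `b` is the number of branch vertices in `C`. Vizing's theorem
for multigraphs colours it by the vertices of `R`, which are numerous enough (`Routes.of_spread`,
`exists_routes_threshold`). The fractional choice of `N`, tokens and moves is rounded with small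
errors by a derandomised Chernoff bound (`exists_rounding`). -/

namespace SimpleGraph
open scoped Classical
open Finset
variable {V : Type u} {G : SimpleGraph V} {X Y : Finset V}

/-! ### Chromatic number of vertex sets, joins and critical sets -/

/-- `f` is a proper colouring of the subgraph induced on `X`. -/
def ProperOn {α : Type*} (G : SimpleGraph V) (X : Finset V) (f : V → α) : Prop :=
  ∀ x ∈ X, ∀ y ∈ X, G.Adj x y → f x ≠ f y

theorem ProperOn.mono {α : Type*} {G : SimpleGraph V} {X Y : Finset V} {f : V → α}
    (h : G.ProperOn Y f) (hXY : X ⊆ Y) : G.ProperOn X f :=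
  fun x hx y hy => h x (hXY hx) y (hXY hy)

/-- The chromatic number of the subgraph induced on `X`. -/
noncomputable def chi (G : SimpleGraph V) (X : Finset V) : ℕ :=
  sInf {n | ∃ f : V → V, G.ProperOn X f ∧ #(X.image f) = n}

/-- A proper colouring can be recoloured so that every colour is a vertex of the set. -/
theorem ProperOn.normalize {α : Type*} {f : V → α} (h : G.ProperOn X f) :
    ∃ g : V → V, G.ProperOn X g ∧ #(X.image g) = #(X.image f) ∧
      (∀ x ∈ X, g x ∈ X ∧ f (g x) = f x) ∧ ∀ x ∈ X, ∀ y ∈ X, (g x = g y ↔ f x = f y) := by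
  -- A representative vertex is chosen in each colour class. The default `d` is irrelevant for
  -- colours that occur on `X`.
  let r : α → V → V := fun c d => if h : ∃ y ∈ X, f y = c then h.choose else d
  have hr : ∀ x ∈ X, ∀ d, r (f x) d ∈ X ∧ f (r (f x) d) = f x := by
    intro x hx d
    have h1 : ∃ y ∈ X, f y = f x := ⟨x, hx, rfl⟩
    simp only [r, dif_pos h1]
    exact h1.choose_spec
  have hrd : ∀ x ∈ X, ∀ d e, r (f x) d = r (f x) e := by
    intro x hx d e
    have h1 : ∃ y ∈ X, f y = f x := ⟨x, hx, rfl⟩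
    simp only [r, dif_pos h1]
  have hiff : ∀ x ∈ X, ∀ y ∈ X, (r (f x) x = r (f y) y ↔ f x = f y) := by
    intro x hx y hy
    constructor
    · intro hxy
      rw [← (hr x hx x).2, hxy, (hr y hy y).2]
    · intro hxy
      rw [hrd x hx x y, hxy]
  refine ⟨fun x => r (f x) x, ?_, ?_, fun x hx => hr x hx x, hiff⟩
  · intro x hx y hy hadj heq
    exact h x hx y hy hadj ((hiff x hx y hy).1 heq)
  · have : X.image f = (X.image fun x => r (f x) x).image f := by
      rw [image_image]
      exact image_congr fun x hx => ((hr x hx x).2).symm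
    rw [this]
    refine (card_image_of_injOn ?_).symm
    intro a ha b hb hab
    simp only [coe_image, Set.mem_image, mem_coe] at ha hb
    obtain ⟨x, hx, rfl⟩ := ha
    obtain ⟨y, hy, rfl⟩ := hb
    refine (hiff x hx y hy).2 ?_
    simpa [(hr x hx x).2, (hr y hy y).2] using hab

theorem exists_chi (G : SimpleGraph V) (X : Finset V) :
    ∃ f : V → V, G.ProperOn X f ∧ #(X.image f) = G.chi X ∧ ∀ x ∈ X, f x ∈ X := by
  have hne : {n | ∃ f : V → V, G.ProperOn X f ∧ #(X.image f) = n}.Nonempty :=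
    ⟨_, id, fun x _ y _ hxy h => hxy.ne h, rfl⟩
  obtain ⟨f, hf, hc⟩ := Nat.sInf_mem hne
  obtain ⟨g, hg, hgc, hgX, _⟩ := hf.normalize
  exact ⟨g, hg, hgc.trans hc, fun x hx => (hgX x hx).1⟩

theorem ProperOn.chi_le {α : Type*} {f : V → α} (h : G.ProperOn X f) :
    G.chi X ≤ #(X.image f) := by
  obtain ⟨g, hg, hgc, _⟩ := h.normalize
  exact Nat.sInf_le ⟨g, hg, hgc⟩

theorem chi_mono (h : X ⊆ Y) : G.chi X ≤ G.chi Y := by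
  obtain ⟨f, hf, hc, _⟩ := G.exists_chi Y
  exact (hf.mono h).chi_le.trans (hc ▸ card_le_card (image_subset_image h))

theorem chi_le_card : G.chi X ≤ #X := by
  have : G.ProperOn X (id : V → V) := fun x _ y _ hxy h => hxy.ne h
  simpa using this.chi_le

@[simp] theorem chi_empty : G.chi ∅ = 0 := Nat.le_zero.1 (by simpa using G.chi_le_card (X := ∅))

theorem chi_pos (h : X.Nonempty) : 0 < G.chi X := by
  obtain ⟨f, _, hc, _⟩ := G.exists_chi X
  rw [← hc]
  exact card_pos.2 (h.image f)

theorem chi_singleton (v : V) : G.chi {v} = 1 :=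
  le_antisymm (by simpa using G.chi_le_card (X := {v})) (chi_pos (singleton_nonempty v))

/-- Colourings of disjoint sets with colours inside the sets glue. -/
theorem ProperOn.glue {f g : V → V} (hf : G.ProperOn X f) (hg : G.ProperOn Y g)
    (hfX : ∀ x ∈ X, f x ∈ X) (hgY : ∀ y ∈ Y, g y ∈ Y) (hd : Disjoint X Y) :
    G.ProperOn (X ∪ Y) (fun x => if x ∈ X then f x else g x) := by
  intro x hx y hy hxy
  rw [mem_union] at hx hy
  have hd' := Finset.disjoint_left.1 hd
  by_cases h1 : x ∈ X <;> by_cases h2 : y ∈ X <;> simp only [h1, h2, if_true, if_false]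
  · exact hf x h1 y h2 hxy
  · have := hy.resolve_left h2
    intro h
    exact hd' (hfX x h1) (h ▸ hgY y this)
  · have := hx.resolve_left h1
    intro h
    exact hd' (hfX y h2) (h ▸ hgY x this)
  · exact hg x (hx.resolve_left h1) y (hy.resolve_left h2) hxy

theorem chi_union_le_of_disjoint (hd : Disjoint X Y) : G.chi (X ∪ Y) ≤ G.chi X + G.chi Y := by
  obtain ⟨f, hf, hfc, hfX⟩ := G.exists_chi X
  obtain ⟨g, hg, hgc, hgY⟩ := G.exists_chi Y
  refine (hf.glue hg hfX hgY hd).chi_le.trans ?_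
  rw [image_union, ← hfc, ← hgc]
  refine (card_union_le _ _).trans (add_le_add (le_of_eq ?_) (le_of_eq ?_))
  · congr 1
    exact image_congr fun x hx => by simp [mem_coe.1 hx]
  · congr 1
    refine image_congr fun x hx => ?_
    simp [Finset.disjoint_right.1 hd (mem_coe.1 hx)]

theorem chi_union_le : G.chi (X ∪ Y) ≤ G.chi X + G.chi Y := by
  rw [← union_sdiff_self_eq_union]
  exact (chi_union_le_of_disjoint disjoint_sdiff).trans
    (Nat.add_le_add_left (chi_mono sdiff_subset) _)

theorem chi_le_erase_add_one (v : V) : G.chi X ≤ G.chi (X.erase v) + 1 := by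
  calc G.chi X ≤ G.chi (X.erase v ∪ {v}) := chi_mono (by intro x; by_cases h : x = v <;> simp [h])
    _ ≤ G.chi (X.erase v) + G.chi {v} := chi_union_le
    _ = _ := by rw [chi_singleton]

/-- Every vertex of `X` is joined to every vertex of `Y`. -/
def Joined (G : SimpleGraph V) (X Y : Finset V) : Prop := ∀ x ∈ X, ∀ y ∈ Y, G.Adj x y

theorem Joined.symm (h : G.Joined X Y) : G.Joined Y X := fun x hx y hy => (h y hy x hx).symm

theorem Joined.mono {X' Y' : Finset V} (h : G.Joined X Y) (hX : X' ⊆ X) (hY : Y' ⊆ Y) :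
    G.Joined X' Y' := fun x hx y hy => h x (hX hx) y (hY hy)

theorem Joined.disjoint (h : G.Joined X Y) : Disjoint X Y :=
  Finset.disjoint_left.2 fun x hx hy => (h x hx x hy).ne rfl

theorem ProperOn.card_image_union {α : Type*} {f : V → α} (hf : G.ProperOn (X ∪ Y) f)
    (h : G.Joined X Y) : #((X ∪ Y).image f) = #(X.image f) + #(Y.image f) := by
  rw [image_union, card_union_of_disjoint]
  rw [Finset.disjoint_left]
  intro c hx hy
  obtain ⟨x, hxX, rfl⟩ := mem_image.1 hx
  obtain ⟨y, hyY, hxy⟩ := mem_image.1 hy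
  exact hf x (mem_union_left _ hxX) y (mem_union_right _ hyY) (h x hxX y hyY) hxy.symm

theorem Joined.chi_union (h : G.Joined X Y) : G.chi (X ∪ Y) = G.chi X + G.chi Y := by
  refine le_antisymm chi_union_le ?_
  obtain ⟨f, hf, hc, _⟩ := G.exists_chi (X ∪ Y)
  rw [← hc, hf.card_image_union h]
  exact add_le_add (hf.mono subset_union_left).chi_le (hf.mono subset_union_right).chi_le

/-- Removing any vertex of `X` lowers the chromatic number. -/
def CriticalOn (G : SimpleGraph V) (X : Finset V) : Prop := ∀ v ∈ X, G.chi (X.erase v) < G.chi X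

theorem CriticalOn.chi_erase (h : G.CriticalOn X) {v : V} (hv : v ∈ X) :
    G.chi (X.erase v) + 1 = G.chi X :=
  le_antisymm (h v hv) (chi_le_erase_add_one v)

theorem exists_criticalOn (G : SimpleGraph V) (X : Finset V) :
    ∃ Y ⊆ X, G.CriticalOn Y ∧ G.chi Y = G.chi X := by
  induction X using Finset.strongInduction with
  | H X ih =>
    by_cases h : G.CriticalOn X
    · exact ⟨X, Subset.rfl, h, rfl⟩
    · unfold CriticalOn at h
      push Not at h
      obtain ⟨v, hv, hle⟩ := h
      obtain ⟨Y, hYX, hY, hc⟩ := ih _ (erase_ssubset hv)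
      exact ⟨Y, hYX.trans (erase_subset _ _), hY,
        hc.trans (le_antisymm (chi_mono (erase_subset _ _)) hle)⟩

/-- Additivity of the chromatic number over the join: a drop for the whole set must come from the
side that lost the vertex. -/
theorem CriticalOn.left (h : G.CriticalOn (X ∪ Y)) (hj : G.Joined X Y) : G.CriticalOn X := by
  intro v hv
  have h1 := h v (mem_union_left _ hv)
  have hvY : v ∉ Y := Finset.disjoint_left.1 hj.disjoint hv
  rw [erase_union_distrib, erase_eq_of_notMem hvY, hj.chi_union,
    (hj.mono (erase_subset _ _) Subset.rfl).chi_union] at h1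
  omega

theorem CriticalOn.right (h : G.CriticalOn (X ∪ Y)) (hj : G.Joined X Y) : G.CriticalOn Y :=
  CriticalOn.left (by rwa [union_comm]) hj.symm

/-- `X` is not a join of two nonempty parts. -/
def CoconnectedOn (G : SimpleGraph V) (X : Finset V) : Prop :=
  ∀ Y ⊆ X, Y.Nonempty → G.Joined Y (X \ Y) → Y = X

theorem chi_univ_le_iff [Fintype V] {n : ℕ} : G.chi univ ≤ n ↔ G.Colorable n := by
  constructor
  · intro h
    obtain ⟨f, hf, hc, _⟩ := G.exists_chi univ
    have C : G.Coloring (univ.image f) := Coloring.mk (fun v => ⟨f v, mem_image_of_mem _ (mem_univ v)⟩)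
      (fun {v w} hvw h => hf v (mem_univ v) w (mem_univ w) hvw (congrArg Subtype.val h))
    have := C.colorable
    rw [Fintype.card_coe, hc] at this
    exact this.mono h
  · rintro ⟨C⟩
    have : G.ProperOn univ C := fun x _ y _ hxy => C.valid hxy
    exact this.chi_le.trans ((card_le_univ _).trans (by simp))

theorem chi_univ_eq [Fintype V] {k : ℕ} (h : G.chromaticNumber = k) : G.chi univ = k := by
  refine le_antisymm (chi_univ_le_iff.2 ?_) ?_
  · exact chromaticNumber_le_iff_colorable.1 h.le
  · have h1 : G.Colorable (G.chi univ) := chi_univ_le_iff.1 le_rfl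
    have h2 := chromaticNumber_le_iff_colorable.2 h1
    rw [h] at h2
    exact_mod_cast h2

/-! ### Singleton colour classes and gluing of colourings -/

/-- The vertices of `S` that share their `f`-colour with no other vertex of `S`. -/
noncomputable def singles {α : Type*} (f : V → α) (S : Finset V) : Finset V :=
  S.filter fun x => ∀ y ∈ S, f y = f x → y = x

theorem mem_singles {α : Type*} {f : V → α} {S : Finset V} {x : V} :
    x ∈ singles f S ↔ x ∈ S ∧ ∀ y ∈ S, f y = f x → y = x := by simp [singles]

theorem two_mul_card_image_le {α : Type*} {f : V → α} {S : Finset V} (h : singles f S = ∅) :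
    2 * #(S.image f) ≤ #S := by
  refine Finset.mul_card_image_le_card _ _ fun c hc => ?_
  obtain ⟨x, hx, rfl⟩ := mem_image.1 hc
  have : x ∉ singles f S := by simp [h]
  rw [mem_singles] at this
  push Not at this
  obtain ⟨y, hy, hyx, hne⟩ := this hx
  exact one_lt_card.2 ⟨x, by simp [hx], y, by simp [hy, hyx], hne.symm⟩

/-- A class of two vertices contributes two to the first term and nothing to the second, a class of
one vertex contributes one to each. -/
theorem card_add_card_singles_le {α : Type*} {f : V → α} {S : Finset V}
    (h : ∀ x ∈ S, #(S.filter fun y => f y = f x) ≤ 2) :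
    #S + #(singles f S) ≤ 2 * #(S.image f) := by
  have h1 : #S = ∑ c ∈ S.image f, #(S.filter fun y => f y = c) := card_eq_sum_card_image f S
  have h2 : #(singles f S) = ∑ c ∈ S.image f, #((singles f S).filter fun y => f y = c) :=
    card_eq_sum_card_fiberwise fun x hx => mem_image_of_mem _ (mem_singles.1 hx).1
  rw [h1, h2, ← sum_add_distrib, mul_comm, ← smul_eq_mul, ← sum_const]
  refine sum_le_sum fun c hc => ?_
  obtain ⟨x, hx, rfl⟩ := mem_image.1 hc
  by_cases hs : ((singles f S).filter fun y => f y = f x) = ∅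
  · rw [hs]
    simpa using h x hx
  · obtain ⟨y, hy⟩ := nonempty_iff_ne_empty.2 hs
    rw [mem_filter, mem_singles] at hy
    have h3 : (S.filter fun z => f z = f x) ⊆ {y} := by
      intro z hz
      rw [mem_filter] at hz
      rw [mem_singleton]
      exact hy.1.2 z hz.1 (hz.2.trans hy.2.symm)
    have h4 : ((singles f S).filter fun z => f z = f x) ⊆ {y} :=
      (filter_subset_filter _ (filter_subset _ _)).trans h3
    have := card_le_card h3
    have := card_le_card h4
    simp only [card_singleton] at *
    omega

/-- Colourings of the pieces of a partition glue. -/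
theorem exists_glue {ι : Type*} [DecidableEq ι] (X : Finset V) (idx : V → ι) (I : Finset ι)
    (hI : ∀ x ∈ X, idx x ∈ I) (n s : ι → ℕ)
    (h : ∀ i ∈ I, ∃ h : V → V, G.ProperOn (X.filter (idx · = i)) h ∧
      (∀ x ∈ X, idx x = i → h x ∈ X ∧ idx (h x) = i) ∧
      #((X.filter (idx · = i)).image h) ≤ n i ∧ #(singles h (X.filter (idx · = i))) ≤ s i) :
    ∃ F : V → V, G.ProperOn X F ∧ #(X.image F) ≤ ∑ i ∈ I, n i ∧
      #(singles F X) ≤ ∑ i ∈ I, s i := by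
  have : Nonempty (V → V) := ⟨id⟩
  choose! H hp hm hn hs using h
  let F : V → V := fun x => H (idx x) x
  have hF : ∀ x ∈ X, idx (F x) = idx x := fun x hx => (hm _ (hI x hx) x hx rfl).2
  refine ⟨F, ?_, ?_, ?_⟩
  · intro x hx y hy hxy he
    have hi : idx x = idx y := by rw [← hF x hx, ← hF y hy, he]
    refine hp _ (hI x hx) x (by simp [hx]) y (by simp [hy, hi]) hxy ?_
    simpa [F, hi] using he
  · refine le_trans ?_ (sum_le_sum hn)
    refine le_trans (card_le_card ?_) card_biUnion_le
    intro c hc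
    obtain ⟨x, hx, rfl⟩ := mem_image.1 hc
    exact mem_biUnion.2 ⟨idx x, hI x hx, mem_image.2 ⟨x, by simp [hx], rfl⟩⟩
  · refine le_trans ?_ (sum_le_sum hs)
    refine le_trans (card_le_card ?_) card_biUnion_le
    intro x hx
    obtain ⟨hxX, hx⟩ := mem_singles.1 hx
    refine mem_biUnion.2 ⟨idx x, hI x hxX, mem_singles.2 ⟨by simp [hxX], fun y hy he => ?_⟩⟩
    rw [mem_filter] at hy
    refine hx y hy.1 ?_
    simpa [F, hy.2] using he

/-- A colouring of `C \ {x}` without singleton classes extends to `C` together with at most one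
vertex that is not adjacent to `x`, which joins the class of `x`. -/
theorem exists_attach {C P : Finset V} {x : V} (hx : x ∈ C) {h : V → V}
    (hp : G.ProperOn (C.erase x) h) (hm : ∀ y ∈ C.erase x, h y ∈ C.erase x)
    (hs : singles h (C.erase x) = ∅) (hCP : C ⊆ P)
    (hE : ∀ e ∈ P \ C, ∀ e' ∈ P \ C, e = e') (hadj : ∀ e ∈ P \ C, ¬ G.Adj e x) :
    ∃ g : V → V, G.ProperOn P g ∧ (∀ y ∈ P, g y ∈ C) ∧
      #(P.image g) ≤ #((C.erase x).image h) + 1 ∧ #(singles g P) ≤ if P = C then 1 else 0 := by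
  let g : V → V := fun y => if y ∈ C.erase x then h y else x
  have hg1 : ∀ y ∈ C.erase x, g y = h y := fun y hy => if_pos hy
  have hg2 : ∀ y ∉ C.erase x, g y = x := fun y hy => if_neg hy
  have hsub : singles g P ⊆ {x} ∪ (P \ C) := by
    intro y hy
    obtain ⟨hyP, hy⟩ := mem_singles.1 hy
    by_contra hcon
    simp only [mem_union, mem_singleton, mem_sdiff, not_or, not_and, not_not] at hcon
    have hyC : y ∈ C.erase x := mem_erase.2 ⟨hcon.1, hcon.2 hyP⟩
    have : y ∉ singles h (C.erase x) := by simp [hs]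
    rw [mem_singles] at this
    push Not at this
    obtain ⟨z, hz, hzy, hne⟩ := this hyC
    refine hne (hy z (hCP (erase_subset _ _ hz)) ?_)
    rw [hg1 y hyC, hg1 z hz, hzy]
  refine ⟨g, ?_, ?_, ?_, ?_⟩
  · intro y hy z hz hyz he
    by_cases h1 : y ∈ C.erase x <;> by_cases h2 : z ∈ C.erase x
    · rw [hg1 y h1, hg1 z h2] at he
      exact hp y h1 z h2 hyz he
    · rw [hg1 y h1, hg2 z h2] at he
      have := hm y h1
      simp [he] at this
    · rw [hg2 y h1, hg1 z h2] at he
      have := hm z h2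
      simp [← he] at this
    · have key : ∀ w ∈ P, w ∉ C.erase x → w = x ∨ w ∈ P \ C := by
        intro w hw hw'
        simp only [mem_erase, mem_sdiff] at *
        tauto
      rcases key y hy h1 with rfl | h3 <;> rcases key z hz h2 with rfl | h4
      · exact hyz.ne rfl
      · exact hadj z h4 hyz.symm
      · exact hadj y h3 hyz
      · exact hyz.ne (hE y h3 z h4)
  · intro y _
    by_cases h1 : y ∈ C.erase x
    · rw [hg1 y h1]
      exact erase_subset _ _ (hm y h1)
    · rwa [hg2 y h1]
  · refine le_trans (card_le_card (t := insert x ((C.erase x).image h)) ?_) (card_insert_le _ _)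
    intro c hc
    obtain ⟨y, _, rfl⟩ := mem_image.1 hc
    by_cases h1 : y ∈ C.erase x
    · rw [hg1 y h1]
      exact mem_insert_of_mem (mem_image_of_mem _ h1)
    · rw [hg2 y h1]
      exact mem_insert_self _ _
  · split_ifs with hPC
    · refine (card_le_card hsub).trans ?_
      simp [hPC]
    · obtain ⟨e, he⟩ : (P \ C).Nonempty := by
        rw [sdiff_nonempty]
        exact fun h => hPC (Subset.antisymm h hCP)
      have hex : e ≠ x := fun h => (mem_sdiff.1 he).2 (h ▸ hx)
      rw [Nat.le_zero, card_eq_zero, eq_empty_iff_forall_notMem]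
      intro y hy
      have hgx : g x = x := hg2 x (by simp)
      have hge : g e = x := hg2 e fun h => (mem_sdiff.1 he).2 (erase_subset _ _ h)
      have h1 := hsub hy
      obtain ⟨hyP, hy⟩ := mem_singles.1 hy
      rw [mem_union, mem_singleton] at h1
      rcases h1 with rfl | h1
      · exact hex (hy e (mem_sdiff.1 he).1 (hge.trans hgx.symm))
      · rw [hE y h1 e he] at hy
        exact hex.symm (hy x (hCP hx) (hgx.trans hge.symm))

/-! ### The join decomposition -/

/-- The non-adjacency graph on a finite set. -/
def coGraph (G : SimpleGraph V) (X : Finset V) : SimpleGraph V where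
  Adj x y := x ≠ y ∧ x ∈ X ∧ y ∈ X ∧ ¬ G.Adj x y
  symm := ⟨fun _ _ h => ⟨h.1.symm, h.2.2.1, h.2.1, fun h' => h.2.2.2 h'.symm⟩⟩
  loopless := ⟨fun _ h => h.1 rfl⟩

/-- The part of `X` in the finest join decomposition that contains `x`. -/
noncomputable def part (G : SimpleGraph V) (X : Finset V) (x : V) : Finset V :=
  X.filter fun y => (G.coGraph X).Reachable x y

theorem mem_part {x y : V} : y ∈ G.part X x ↔ y ∈ X ∧ (G.coGraph X).Reachable x y := by
  simp [part]

theorem part_subset (x : V) : G.part X x ⊆ X := filter_subset _ _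

theorem self_mem_part {x : V} (hx : x ∈ X) : x ∈ G.part X x := mem_part.2 ⟨hx, .rfl⟩

theorem part_eq_of_mem {x y : V} (h : y ∈ G.part X x) : G.part X y = G.part X x := by
  ext z
  have := (mem_part.1 h).2
  exact ⟨fun hz => mem_part.2 ⟨(mem_part.1 hz).1, this.trans (mem_part.1 hz).2⟩,
    fun hz => mem_part.2 ⟨(mem_part.1 hz).1, this.symm.trans (mem_part.1 hz).2⟩⟩

theorem part_eq_of_not_adj {x y : V} (hx : x ∈ X) (hy : y ∈ X) (h : ¬ G.Adj x y) :
    G.part X y = G.part X x := by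
  by_cases hxy : x = y
  · rw [hxy]
  · exact part_eq_of_mem (mem_part.2 ⟨hy, Adj.reachable ⟨hxy, hx, hy, h⟩⟩)

theorem joined_part (x : V) : G.Joined (G.part X x) (X \ G.part X x) := by
  intro y hy z hz
  by_contra h
  rw [mem_sdiff] at hz
  rw [← part_eq_of_mem hy, ← part_eq_of_not_adj (part_subset x hy) hz.1 h] at hz
  exact hz.2 (self_mem_part hz.1)

theorem coconnectedOn_part (x : V) : G.CoconnectedOn (G.part X x) := by
  intro Y hY ⟨y, hy⟩ hj
  refine Subset.antisymm hY fun z hz => ?_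
  have h1 : (G.coGraph X).Reachable y z :=
    (mem_part.1 (hY hy)).2.symm.trans (mem_part.1 hz).2
  rw [reachable_iff_reflTransGen] at h1
  induction h1 with
  | refl => exact hy
  | @tail b c hb hbc ih =>
    have hbp : b ∈ G.part X x := by
      refine mem_part.2 ⟨hbc.2.1, (mem_part.1 (hY hy)).2.trans ?_⟩
      rwa [reachable_iff_reflTransGen]
    by_contra hc
    exact hbc.2.2.2 (hj b (ih hbp) c (mem_sdiff.2 ⟨hz, hc⟩))

theorem CriticalOn.part (h : G.CriticalOn X) (x : V) : G.CriticalOn (G.part X x) := by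
  refine CriticalOn.left (Y := X \ G.part X x) ?_ (joined_part x)
  rwa [union_sdiff_of_subset (part_subset x)]

/-! ### Gallai's theorem on critical graphs with connected complement -/

/-- Given a matching `m` of `A` into `T`, there is a set `S ⊆ A` all of whose neighbours are matched
to it, such that each non-neighbour of `S` is missed by some matching of `A` into `T`. -/
theorem exists_tight {α β : Type*} (A : Finset α) (T : Finset β) (r : α → β → Prop) (m : α → β)
    (hm : ∀ a ∈ A, m a ∈ T ∧ r a (m a)) (hinj : Set.InjOn m A) :
    ∃ S ⊆ A, (∀ a ∈ S, ∀ b ∈ T, r a b → ∃ a' ∈ S, m a' = b) ∧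
      ∀ b ∈ T, (∀ a ∈ S, ¬ r a b) →
        ∃ g : α → β, (∀ a ∈ A, g a ∈ T ∧ r a (g a) ∧ g a ≠ b) ∧ Set.InjOn g A := by
  let N : Finset α → Finset β := fun S => T.filter fun b => ∃ a ∈ S, r a b
  have hN : ∀ S b, b ∈ N S ↔ b ∈ T ∧ ∃ a ∈ S, r a b := fun S b => mem_filter
  have hmN : ∀ S ⊆ A, S.image m ⊆ N S := by
    intro S hS b hb
    obtain ⟨a, ha, rfl⟩ := mem_image.1 hb
    exact (hN _ _).2 ⟨(hm a (hS ha)).1, a, ha, (hm a (hS ha)).2⟩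
  have hcard : ∀ S ⊆ A, #(S.image m) = #S := fun S hS =>
    card_image_of_injOn (hinj.mono (coe_subset.2 hS))
  have hle : ∀ S ⊆ A, #S ≤ #(N S) := fun S hS => (hcard S hS) ▸ card_le_card (hmN S hS)
  -- A largest tight set, that is, one with as many neighbours as elements. Tight sets are closed
  -- under union because the neighbourhood size is submodular.
  obtain ⟨S, hS, hmax⟩ := exists_max_image (A.powerset.filter fun S => #(N S) = #S) card
    ⟨∅, by simp [N]⟩
  simp only [mem_filter, mem_powerset] at hS hmax
  obtain ⟨hSA, hSt⟩ := hS
  have hNS : S.image m = N S :=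
    eq_of_subset_of_card_le (hmN S hSA) (by rw [hSt, hcard S hSA])
  refine ⟨S, hSA, ?_, ?_⟩
  · intro a ha b hb hab
    have : b ∈ S.image m := hNS ▸ (hN _ _).2 ⟨hb, a, ha, hab⟩
    simpa using this
  · intro b hb hnb
    have hbN : b ∉ N S := fun h => by
      obtain ⟨a, ha, hab⟩ := ((hN _ _).1 h).2
      exact hnb a ha hab
    -- Hall's condition survives the deletion of `b`: a violating set would be tight and have `b` as
    -- a neighbour, so its union with `S` would be tight, and maximality would make `b` a neighbour
    -- of `S`.
    let t : {a // a ∈ A} → Finset β := fun a => (T.filter fun c => r a c).erase b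
    have hall : ∀ s : Finset {a // a ∈ A}, #s ≤ #(s.biUnion t) := by
      intro s
      by_contra hlt
      push Not at hlt
      let s' : Finset α := s.image Subtype.val
      have hs'A : s' ⊆ A := by
        intro a ha
        obtain ⟨x, _, rfl⟩ := mem_image.1 ha
        exact x.2
      have hs'c : #s' = #s := card_image_of_injective _ Subtype.val_injective
      have hsub : N s' ⊆ insert b (s.biUnion t) := by
        intro c hc
        obtain ⟨hcT, a, ha, hac⟩ := (hN _ _).1 hc
        obtain ⟨x, hx, rfl⟩ := mem_image.1 ha
        by_cases hcb : c = b
        · simp [hcb]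
        · exact mem_insert_of_mem (mem_biUnion.2 ⟨x, hx, by simp [t, hcb, hcT, hac]⟩)
      have h1 : b ∈ N s' := by
        by_contra hb'
        have h2 : N s' ⊆ s.biUnion t := fun c hc =>
          (mem_insert.1 (hsub hc)).resolve_left fun h => hb' (h ▸ hc)
        have := card_le_card h2
        have := hle s' hs'A
        omega
      have h2 : #(N s') ≤ #s' := by
        have := card_le_card hsub
        have := card_insert_le b (s.biUnion t)
        omega
      have h3 : N (S ∪ s') = N S ∪ N s' := by
        ext c
        simp only [hN, mem_union]
        constructor
        · rintro ⟨hcT, a, ha | ha, hac⟩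
          · exact Or.inl ⟨hcT, a, ha, hac⟩
          · exact Or.inr ⟨hcT, a, ha, hac⟩
        · rintro (⟨hcT, a, ha, hac⟩ | ⟨hcT, a, ha, hac⟩)
          · exact ⟨hcT, a, Or.inl ha, hac⟩
          · exact ⟨hcT, a, Or.inr ha, hac⟩
      have h4 : N (S ∩ s') ⊆ N S ∩ N s' := by
        intro c hc
        simp only [hN, mem_inter] at *
        obtain ⟨hcT, a, ha, hac⟩ := hc
        exact ⟨⟨hcT, a, ha.1, hac⟩, ⟨hcT, a, ha.2, hac⟩⟩
      have h5 := card_union_add_card_inter (N S) (N s')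
      have h6 := card_union_add_card_inter S s'
      have h7 := card_le_card h4
      have h8 := hle (S ∩ s') (inter_subset_left.trans hSA)
      have h9 := hle (S ∪ s') (union_subset hSA hs'A)
      rw [h3] at h9
      have h10 := hmax (S ∪ s') ⟨union_subset hSA hs'A, by rw [h3]; omega⟩
      have h11 : S = S ∪ s' := eq_of_subset_of_card_le subset_union_left h10
      apply hbN
      rw [h11, h3]
      exact mem_union_right _ h1
    obtain ⟨g, hg, hgt⟩ := (all_card_le_biUnion_card_iff_exists_injective t).1 hall
    refine ⟨fun a => if h : a ∈ A then g ⟨a, h⟩ else b, ?_, ?_⟩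
    · intro a ha
      have := hgt ⟨a, ha⟩
      simp only [t, mem_erase, mem_filter] at this
      simp only [dif_pos ha]
      exact ⟨this.2.1, this.2.2, this.1⟩
    · intro a ha c hc hac
      have ha' : a ∈ A := ha
      have hc' : c ∈ A := hc
      simp only [dif_pos ha', dif_pos hc'] at hac
      exact congrArg Subtype.val (hg hac)

theorem ProperOn.image_eq_of_chi_eq {f : V → V} (hf : G.ProperOn Y f)
    (hc : #(Y.image f) = G.chi Y) (hXY : X ⊆ Y) (h : G.chi X = G.chi Y) :
    X.image f = Y.image f := by
  refine eq_of_subset_of_card_le (image_subset_image hXY) ?_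
  rw [hc, ← h]
  exact (hf.mono hXY).chi_le

theorem ProperOn.card_image_of_joined {f : V → V} (hf : G.ProperOn Y f)
    (hc : #(Y.image f) = G.chi Y) (hXY : X ⊆ Y) (h : G.Joined X (Y \ X)) :
    #(X.image f) = G.chi X := by
  have h0 : Y = X ∪ Y \ X := (union_sdiff_of_subset hXY).symm
  rw [h0] at hf hc
  rw [hf.card_image_union h, h.chi_union] at hc
  have h1 := (hf.mono subset_union_left).chi_le
  have h2 := (hf.mono subset_union_right).chi_le
  omega

/-- The colour sets of `X` and of its complement in `Y` are disjoint and each is at least as large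
as the respective chromatic number. Subadditivity forces equality in both. -/
theorem ProperOn.card_image_of_saturated {f : V → V} (hf : G.ProperOn Y f)
    (hc : #(Y.image f) = G.chi Y) (hXY : X ⊆ Y)
    (h : ∀ x ∈ X, ∀ y ∈ Y, f x = f y → y ∈ X) : #(X.image f) = G.chi X := by
  have h0 : Y = X ∪ Y \ X := (union_sdiff_of_subset hXY).symm
  have h1 := (hf.mono hXY).chi_le
  have h2 := (hf.mono (sdiff_subset (s := Y) (t := X))).chi_le
  have h3 : G.chi Y ≤ G.chi X + G.chi (Y \ X) := by
    conv_lhs => rw [h0]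
    exact chi_union_le
  have h4 : #(Y.image f) = #(X.image f) + #((Y \ X).image f) := by
    conv_lhs => rw [h0]
    rw [image_union, card_union_of_disjoint]
    rw [Finset.disjoint_left]
    intro c hcx hcy
    obtain ⟨x, hx, rfl⟩ := mem_image.1 hcx
    obtain ⟨y, hy, hxy⟩ := mem_image.1 hcy
    rw [mem_sdiff] at hy
    exact hy.2 (h x hx y hy.1 hxy.symm)
  omega

/-- Recolouring along a matching `g` of `A` into the parts of `U`: each part in `T` exposes one
vertex, to which the matched vertex of `A` is attached, and `y` is attached to the part `B`. -/
theorem exists_recolour {Z U A : Finset V} {y : V} (hZU : Disjoint Z U) (hZA : Disjoint Z A)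
    (hUA : Disjoint U A) (hyZ : y ∉ Z) (hyU : y ∉ U) (hyA : y ∉ A) {h₀ : V → V}
    (hp₀ : G.ProperOn Z h₀) (hm₀ : ∀ x ∈ Z, h₀ x ∈ Z) (hs₀ : singles h₀ Z = ∅)
    {T : Finset (Finset V)} (hT : T ⊆ U.image (G.part U))
    (hexp : ∀ C ∈ T, ∀ w ∈ C, ∃ h : V → V, G.ProperOn (C.erase w) h ∧
      (∀ x ∈ C.erase w, h x ∈ C.erase w) ∧ #((C.erase w).image h) + 1 = G.chi C ∧
      singles h (C.erase w) = ∅)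
    (hnT : ∀ C ∈ U.image (G.part U), C ∉ T → ∃ h : V → V, G.ProperOn C h ∧
      (∀ x ∈ C, h x ∈ C) ∧ #(C.image h) = G.chi C ∧ singles h C = ∅)
    {g : V → Finset V} (hg : ∀ a ∈ A, g a ∈ T ∧ ∃ w ∈ g a, ¬ G.Adj a w)
    (hginj : Set.InjOn g A) {B : Finset V} (hB : B ∈ T) (hgB : ∀ a ∈ A, g a ≠ B)
    (hyB : ∃ w ∈ B, ¬ G.Adj y w) :
    ∃ F : V → V, G.ProperOn (insert y (Z ∪ U ∪ A)) F ∧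
      #((insert y (Z ∪ U ∪ A)).image F) ≤ #(Z.image h₀) + ∑ C ∈ U.image (G.part U), G.chi C ∧
      #(singles F (insert y (Z ∪ U ∪ A))) + #A + 1 ≤ #T := by
  let W := insert y (Z ∪ U ∪ A)
  -- The pieces to be glued are `Z` (index `none`) and, for each part of `U`, the part together with
  -- the vertex attached to it, if any.
  let idx : V → Option (Finset V) := fun x =>
    if x ∈ Z then none else if x ∈ U then some (G.part U x) else
    if x ∈ A then some (g x) else some B
  have hZU' := Finset.disjoint_left.1 hZU
  have hZA' := Finset.disjoint_left.1 hZA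
  have hUA' := Finset.disjoint_left.1 hUA
  have hiZ : ∀ x ∈ Z, idx x = none := fun x hx => by simp [idx, hx]
  have hiU : ∀ x ∈ U, idx x = some (G.part U x) := fun x hx => by
    have : x ∉ Z := fun h => hZU' h hx
    simp [idx, hx, this]
  have hiA : ∀ x ∈ A, idx x = some (g x) := fun x hx => by
    have h1 : x ∉ Z := fun h => hZA' h hx
    have h2 : x ∉ U := fun h => hUA' h hx
    simp [idx, hx, h1, h2]
  have hiy : idx y = some B := by simp [idx, hyZ, hyU, hyA]
  have hpart : ∀ C ∈ U.image (G.part U), C ⊆ U ∧ C.Nonempty ∧ ∀ x ∈ C, G.part U x = C := by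
    intro C hC
    obtain ⟨x, hx, rfl⟩ := mem_image.1 hC
    exact ⟨part_subset x, ⟨x, self_mem_part hx⟩, fun z hz => part_eq_of_mem hz⟩
  let n : Option (Finset V) → ℕ := fun o => o.elim #(Z.image h₀) G.chi
  -- Only a part in `T` to which nothing is attached may keep a singleton class, namely its exposed
  -- vertex.
  let s : Option (Finset V) → ℕ := fun o => o.elim 0 fun C =>
    if C ∈ T ∧ C ≠ B ∧ C ∉ A.image g then 1 else 0
  have hWmem : ∀ x ∈ W, x = y ∨ x ∈ Z ∨ x ∈ U ∨ x ∈ A := by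
    intro x hx
    simp only [W, mem_insert, mem_union] at hx
    tauto
  have hUW : U ⊆ W := fun x hx => by simp [W, hx]
  have hAW : A ⊆ W := fun x hx => by simp [W, hx]
  have hZW : Z ⊆ W := fun x hx => by simp [W, hx]
  have hyW : y ∈ W := by simp [W]
  obtain ⟨F, hF, hFn, hFs⟩ := exists_glue (G := G) W idx (insert none ((U.image (G.part U)).image some))
    (by
      intro x hx
      rcases hWmem x hx with rfl | h | h | h
      · rw [hiy]
        exact mem_insert_of_mem (mem_image_of_mem _ (hT hB))
      · rw [hiZ x h]
        exact mem_insert_self _ _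
      · rw [hiU x h]
        exact mem_insert_of_mem (mem_image_of_mem _ (mem_image_of_mem _ h))
      · rw [hiA x h]
        exact mem_insert_of_mem (mem_image_of_mem _ (hT (hg x h).1))) n s
    (by
      intro i hi
      rw [mem_insert, mem_image] at hi
      rcases hi with rfl | ⟨C, hC, rfl⟩
      · have hP : W.filter (idx · = none) = Z := by
          ext x
          rw [mem_filter]
          constructor
          · rintro ⟨hx, hxi⟩
            rcases hWmem x hx with rfl | h | h | h
            · simp [hiy] at hxi
            · exact h
            · simp [hiU x h] at hxi
            · simp [hiA x h] at hxi
          · exact fun h => ⟨hZW h, hiZ x h⟩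
        refine ⟨h₀, by rwa [hP], ?_, by rw [hP]; exact le_rfl, by rw [hP, hs₀]; simp⟩
        intro x hx hxi
        have hxZ : x ∈ Z := by
          rw [← hP]
          exact mem_filter.2 ⟨hx, hxi⟩
        exact ⟨hZW (hm₀ x hxZ), hiZ _ (hm₀ x hxZ)⟩
      · obtain ⟨hCU, hCne, hCp⟩ := hpart C hC
        have hCi : ∀ x ∈ C, idx x = some C := fun x hx => by rw [hiU x (hCU hx), hCp x hx]
        set P := W.filter (idx · = some C) with hPdef
        have hCP : C ⊆ P := fun x hx => mem_filter.2 ⟨hUW (hCU hx), hCi x hx⟩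
        have hout : ∀ e ∈ P \ C, (e ∈ A ∧ g e = C) ∨ (e = y ∧ C = B) := by
          intro e he
          rw [mem_sdiff, hPdef, mem_filter] at he
          obtain ⟨⟨heW, hei⟩, heC⟩ := he
          rcases hWmem e heW with rfl | h | h | h
          · rw [hiy, Option.some_inj] at hei
            exact Or.inr ⟨rfl, hei.symm⟩
          · simp [hiZ e h] at hei
          · rw [hiU e h, Option.some_inj] at hei
            exact absurd (hei ▸ self_mem_part h) heC
          · rw [hiA e h, Option.some_inj] at hei
            exact Or.inl ⟨h, hei⟩
        by_cases hCT : C ∈ T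
        · have hw : ∃ w ∈ C, ∀ e ∈ P \ C, ¬ G.Adj e w := by
            by_cases hCB : C = B
            · obtain ⟨w, hw, hadj⟩ := hyB
              refine ⟨w, hCB ▸ hw, fun e he => ?_⟩
              rcases hout e he with h | h
              · exact absurd (h.2.trans hCB) (hgB e h.1)
              · rwa [h.1]
            · by_cases hCg : ∃ a ∈ A, g a = C
              · obtain ⟨a, ha, rfl⟩ := hCg
                obtain ⟨w, hw, hadj⟩ := (hg a ha).2
                refine ⟨w, hw, fun e he => ?_⟩
                rcases hout e he with h | h
                · rwa [hginj h.1 ha h.2]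
                · exact absurd h.2 hCB
              · obtain ⟨w, hw⟩ := hCne
                refine ⟨w, hw, fun e he => ?_⟩
                rcases hout e he with h | h
                · exact absurd ⟨e, h⟩ hCg
                · exact absurd h.2 hCB
          obtain ⟨w, hwC, hadj⟩ := hw
          obtain ⟨h, hp, hm, hc, hs⟩ := hexp C hCT w hwC
          obtain ⟨k, hk, hkm, hkc, hks⟩ := exists_attach hwC hp hm hs hCP (by
            intro e he e' he'
            rcases hout e he with h1 | h1 <;> rcases hout e' he' with h2 | h2
            · exact hginj h1.1 h2.1 (h1.2.trans h2.2.symm)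
            · exact absurd (h1.2.trans h2.2) (hgB e h1.1)
            · exact absurd (h2.2.trans h1.2) (hgB e' h2.1)
            · exact h1.1.trans h2.1.symm) hadj
          refine ⟨k, hk, ?_, ?_, hks.trans ?_⟩
          · intro x hx hxi
            have := hkm x (mem_filter.2 ⟨hx, hxi⟩)
            exact ⟨hUW (hCU this), hCi _ this⟩
          · exact hkc.trans (le_of_eq hc)
          · simp only [s, Option.elim]
            split_ifs with h1 h2
            · exact le_rfl
            · exfalso
              apply h2
              refine ⟨hCT, ?_, ?_⟩
              · rintro rfl
                have : y ∈ P := mem_filter.2 ⟨hyW, hiy⟩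
                rw [h1] at this
                exact hyU (hCU this)
              · intro hCg
                obtain ⟨a, ha, hac⟩ := mem_image.1 hCg
                have : a ∈ P := mem_filter.2 ⟨hAW ha, by rw [hiA a ha, hac]⟩
                rw [h1] at this
                exact hUA' (hCU this) ha
            · exact Nat.zero_le _
            · exact le_rfl
        · have hPC : P = C := by
            refine Subset.antisymm (fun e he => ?_) hCP
            by_contra heC
            rcases hout e (mem_sdiff.2 ⟨he, heC⟩) with h | h
            · exact hCT (h.2 ▸ (hg e h.1).1)
            · exact hCT (h.2 ▸ hB)
          obtain ⟨h, hp, hm, hc, hs⟩ := hnT C hC hCT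
          refine ⟨h, by rwa [hPC], ?_, by rw [hPC]; exact hc.le, by rw [hPC, hs]; simp⟩
          intro x hx hxi
          have hxC : x ∈ C := by
            rw [← hPC]
            exact mem_filter.2 ⟨hx, hxi⟩
          exact ⟨hUW (hCU (hm x hxC)), hCi _ (hm x hxC)⟩)
  have hnone : (none : Option (Finset V)) ∉ (U.image (G.part U)).image some := by simp
  refine ⟨F, hF, ?_, ?_⟩
  · rw [sum_insert hnone, sum_image (fun _ _ _ _ h => Option.some.inj h)] at hFn
    exact hFn
  · rw [sum_insert hnone, sum_image (fun _ _ _ _ h => Option.some.inj h)] at hFs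
    have h1 : ∑ C ∈ U.image (G.part U), s (some C)
        ≤ #(T \ insert B (A.image g)) := by
      simp only [s, Option.elim]
      rw [← card_filter]
      refine card_le_card fun C hC => ?_
      simp only [mem_filter, mem_sdiff, mem_insert] at *
      tauto
    have h2 : insert B (A.image g) ⊆ T := by
      intro C hC
      rw [mem_insert, mem_image] at hC
      rcases hC with rfl | ⟨a, ha, rfl⟩
      · exact hB
      · exact (hg a ha).1
    have h3 : #(insert B (A.image g)) = #A + 1 := by
      rw [card_insert_of_notMem, card_image_of_injOn hginj]
      intro h
      obtain ⟨a, ha, hab⟩ := mem_image.1 h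
      exact hgB a ha hab
    have h4 := card_sdiff_add_card_eq_card h2
    have h5 : s none = 0 := rfl
    change #(singles F W) + #A + 1 ≤ #T
    omega

/-- Gallai's theorem on critical graphs with connected complement, in the form of Stehlík: after
removing any vertex there is an optimal colouring without singleton classes. -/
theorem CriticalOn.exists_no_singles (hX : G.CriticalOn X) (hco : G.CoconnectedOn X) {v : V}
    (hv : v ∈ X) : ∃ f : V → V, G.ProperOn (X.erase v) f ∧ (∀ x ∈ X.erase v, f x ∈ X.erase v) ∧
      #((X.erase v).image f) + 1 = G.chi X ∧ singles f (X.erase v) = ∅ := by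
  induction X using Finset.strongInduction generalizing v with
  | H X ih =>
  set X' := X.erase v with hX'
  have hchiX' : G.chi X' + 1 = G.chi X := hX.chi_erase hv
  -- Among the optimal colourings of `X'`, one with the fewest singleton classes is taken. A
  -- remaining singleton `u` will lead to a contradiction.
  have hex : ∃ s, ∃ f : V → V, G.ProperOn X' f ∧ #(X'.image f) = G.chi X' ∧ #(singles f X') = s := by
    obtain ⟨f, hf, hc, _⟩ := G.exists_chi X'
    exact ⟨_, f, hf, hc, rfl⟩
  obtain ⟨f, hf, hfc, hfs⟩ := Nat.find_spec hex
  have hmin : ∀ f' : V → V, G.ProperOn X' f' → #(X'.image f') = G.chi X' →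
      #(singles f X') ≤ #(singles f' X') := fun f' h1 h2 =>
    hfs ▸ Nat.find_min' hex ⟨f', h1, h2, rfl⟩
  by_cases hs0 : singles f X' = ∅
  · obtain ⟨g, hg, hgc, hgX, hgi⟩ := hf.normalize
    refine ⟨g, hg, fun x hx => (hgX x hx).1, by omega, ?_⟩
    rw [eq_empty_iff_forall_notMem] at hs0 ⊢
    intro x hx
    rw [mem_singles] at hx
    exact hs0 x (mem_singles.2 ⟨hx.1, fun y hy h => hx.2 y hy ((hgi y hy x hx.1).2 h)⟩)
  exfalso
  obtain ⟨u, hu⟩ := nonempty_iff_ne_empty.2 hs0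
  obtain ⟨huX', hu⟩ := mem_singles.1 hu
  -- the large and the small colour classes
  set Z := X'.filter fun x => 3 ≤ #(X'.filter fun y => f y = f x) with hZ
  set V₁ := X' \ Z with hV₁
  have hZX' : Z ⊆ X' := filter_subset _ _
  have hV₁X' : V₁ ⊆ X' := sdiff_subset
  have hZ3 : ∀ x ∈ Z, 3 ≤ #(X'.filter fun y => f y = f x) := fun x hx => (mem_filter.1 hx).2
  have hZcl : ∀ x ∈ Z, ∀ y ∈ X', f x = f y → y ∈ Z := by
    intro x hx y hy hxy
    refine mem_filter.2 ⟨hy, ?_⟩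
    rw [← hxy]
    exact hZ3 x hx
  have hV₁cl : ∀ x ∈ V₁, ∀ y ∈ X', f x = f y → y ∈ V₁ := by
    intro x hx y hy hxy
    refine mem_sdiff.2 ⟨hy, fun h => (mem_sdiff.1 hx).2 (hZcl y h x (hV₁X' hx) hxy.symm)⟩
  have hV₁2 : ∀ x ∈ V₁, #(X'.filter fun y => f y = f x) ≤ 2 := by
    intro x hx
    by_contra h
    exact (mem_sdiff.1 hx).2 (mem_filter.2 ⟨hV₁X' hx, by omega⟩)
  have hV₁3 : ∀ x ∈ V₁, ∀ y ∈ V₁, ∀ z ∈ V₁, f y = f x → f z = f x → y ≠ x → z ≠ x → y = z := by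
    intro x hx y hy z hz hyx hzx hne hne'
    by_contra hyz
    have h1 : ({x, y, z} : Finset V) ⊆ X'.filter fun y => f y = f x := by
      intro w hw
      simp only [mem_insert, mem_singleton] at hw
      rcases hw with rfl | rfl | rfl
      · exact mem_filter.2 ⟨hV₁X' hx, rfl⟩
      · exact mem_filter.2 ⟨hV₁X' hy, hyx⟩
      · exact mem_filter.2 ⟨hV₁X' hz, hzx⟩
    have h2 : #({x, y, z} : Finset V) = 3 := card_eq_three.2 ⟨x, y, z, hne.symm, hne'.symm, hyz, rfl⟩
    have := card_le_card h1
    have := hV₁2 x hx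
    omega
  have hchiZ : #(Z.image f) = G.chi Z := hf.card_image_of_saturated hfc hZX' fun x hx y hy h => hZcl x hx y hy h
  have hchi₁ : #(V₁.image f) = G.chi V₁ :=
    hf.card_image_of_saturated hfc hV₁X' fun x hx y hy h => hV₁cl x hx y hy h
  have hsplit : #(Z.image f) + #(V₁.image f) = #(X'.image f) := by
    have : X' = Z ∪ V₁ := (union_sdiff_of_subset hZX').symm
    rw [this, image_union, card_union_of_disjoint]
    rw [Finset.disjoint_left]
    intro c hc hc'
    obtain ⟨x, hx, rfl⟩ := mem_image.1 hc
    obtain ⟨y, hy, hxy⟩ := mem_image.1 hc'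
    exact (mem_sdiff.1 hy).2 (hZcl x hx y (hV₁X' hy) hxy.symm)
  -- All colours of `V₁` already occur on the critical core `U`. As classes in `V₁` have at most two
  -- vertices, a vertex of `V₁` outside `U` shares its class with exactly one vertex of `U`.
  obtain ⟨U, hUV₁, hUcrit, hUchi⟩ := G.exists_criticalOn V₁
  set A := V₁ \ U with hA
  have hfV₁ : G.ProperOn V₁ f := hf.mono hV₁X'
  have hfU : G.ProperOn U f := hfV₁.mono hUV₁
  have himg : U.image f = V₁.image f := hfV₁.image_eq_of_chi_eq hchi₁ hUV₁ hUchi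
  have hUc : #(U.image f) = G.chi U := by rw [himg, hchi₁, hUchi]
  have hAV₁ : A ⊆ V₁ := sdiff_subset
  have hAU : ∀ a ∈ A, a ∉ U := fun a ha => (mem_sdiff.1 ha).2
  -- the partner in `U` of a vertex of `A`
  have hmate : ∀ a ∈ V₁, ∃ x ∈ U, f x = f a := by
    intro a ha
    have : f a ∈ U.image f := himg ▸ mem_image_of_mem f ha
    simpa using this
  choose! mt hmtU hmtf using hmate
  have hmt_single : ∀ a ∈ A, mt a ∈ singles f U := by
    intro a ha
    have h1 := hmtU a (hAV₁ ha)
    refine mem_singles.2 ⟨h1, fun y hy hya => ?_⟩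
    refine hV₁3 a (hAV₁ ha) y (hUV₁ hy) (mt a) (hUV₁ h1) (hya.trans (hmtf a (hAV₁ ha)))
      (hmtf a (hAV₁ ha)) ?_ ?_
    · rintro rfl
      exact hAU _ ha hy
    · intro h
      exact hAU _ ha (h ▸ h1)
  have hmt_inj : ∀ a ∈ A, ∀ b ∈ A, mt a = mt b → a = b := by
    intro a ha b hb hab
    have h1 := hmtU a (hAV₁ ha)
    refine hV₁3 (mt a) (hUV₁ h1) a (hAV₁ ha) b (hAV₁ hb) (hmtf a (hAV₁ ha)).symm ?_ ?_ ?_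
    · rw [hab]
      exact (hmtf b (hAV₁ hb)).symm
    · intro h
      exact hAU a ha (h ▸ h1)
    · intro h
      exact hAU b hb (h ▸ h1)
  have hUX : U ⊆ X' := hUV₁.trans hV₁X'
  have huV₁ : u ∈ V₁ := by
    refine mem_sdiff.2 ⟨huX', fun h => ?_⟩
    have h1 := hZ3 u h
    have h2 : (X'.filter fun y => f y = f u) ⊆ {u} := fun y hy => by
      rw [mem_filter] at hy
      exact mem_singleton.2 (hu y hy.1 hy.2)
    have := card_le_card h2
    rw [card_singleton] at this
    omega
  have huU : u ∈ U := by
    have := hu (mt u) (hUX (hmtU u huV₁)) (hmtf u huV₁)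
    rw [← this]
    exact hmtU u huV₁
  have huUs : u ∈ singles f U := mem_singles.2 ⟨huU, fun y hy => hu y (hUX hy)⟩
  -- parts of `U`
  have hpcol : ∀ x ∈ U, ∀ y ∈ U, f x = f y → G.part U x = G.part U y := by
    intro x hx y hy hxy
    refine (part_eq_of_not_adj hx hy fun h => hfU x hx y hy h hxy).symm
  have hpU : ∀ x, G.part U x ⊆ U := fun x => part_subset x
  have hpchi : ∀ x, #((G.part U x).image f) = G.chi (G.part U x) := fun x =>
    hfU.card_image_of_joined hUc (hpU x) (joined_part x)
  have hpX : ∀ x, G.part U x ⊂ X := by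
    intro x
    refine (ssubset_iff_of_subset ((hpU x).trans (hUX.trans (erase_subset _ _)))).2 ⟨v, hv, fun h => ?_⟩
    have := hUX (hpU x h)
    simp [hX'] at this
  have hexp : ∀ x, ∀ w ∈ G.part U x, ∃ h : V → V, G.ProperOn ((G.part U x).erase w) h ∧
      (∀ y ∈ (G.part U x).erase w, h y ∈ (G.part U x).erase w) ∧
      #(((G.part U x).erase w).image h) + 1 = G.chi (G.part U x) ∧
      singles h ((G.part U x).erase w) = ∅ := fun x w hw =>
    ih _ (hpX x) (hUcrit.part x) (coconnectedOn_part x) hw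
  have hsing_part : ∀ x, ∀ y ∈ G.part U x, (y ∈ singles f U ↔ y ∈ singles f (G.part U x)) := by
    intro x y hy
    simp only [mem_singles, hpU x hy, hy, true_and]
    constructor
    · exact fun h z hz => h z (hpU x hz)
    · intro h z hz hzy
      refine h z ?_ hzy
      have := hpcol z hz y (hpU x hy) hzy
      rw [part_eq_of_mem hy] at this
      exact this ▸ self_mem_part hz
  -- By induction a part `C` minus a vertex has an optimal colouring without singletons, so `2(χ(C)
  -- - 1) ≤ |C| - 1`. Since `f` has classes of at most two vertices, the number of its singletons in
  -- `C` is at most `2χ(C) - |C| ≤ 1`.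
  have hsing1 : ∀ x ∈ U, #(singles f (G.part U x)) ≤ 1 := by
    intro x hx
    obtain ⟨h, _, _, hc, hs⟩ := hexp x x (self_mem_part hx)
    have h1 := two_mul_card_image_le hs
    rw [card_erase_of_mem (self_mem_part hx)] at h1
    have h2 := card_add_card_singles_le (f := f) (S := G.part U x) fun y hy =>
      (card_le_card (filter_subset_filter _ ((hpU x).trans hUX))).trans (hV₁2 y (hUV₁ (hpU x hy)))
    have h3 := hpchi x
    have : 0 < #(G.part U x) := card_pos.2 ⟨x, self_mem_part hx⟩
    omega
  have hpart_inj : Set.InjOn (G.part U) (singles f U) := by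
    intro x hx y hy hxy
    have hxU := (mem_singles.1 hx).1
    have hyU := (mem_singles.1 hy).1
    have h1 : y ∈ G.part U x := hxy ▸ self_mem_part hyU
    exact card_le_one.1 (hsing1 x hxU) x ((hsing_part x x (self_mem_part hxU)).1 hx) y
      ((hsing_part x y h1).1 hy)
  set T := (singles f U).image (G.part U) with hT
  have hTcard : #T = #(singles f U) := card_image_of_injOn hpart_inj
  -- A singleton of `f` on `U` is a singleton on `X'` or the partner of a vertex of `A`.
  have hTle : #T ≤ #A + #(singles f X') := by
    rw [hTcard, add_comm]
    refine le_trans (card_le_card (t := singles f X' ∪ A.image mt) ?_)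
      ((card_union_le _ _).trans (Nat.add_le_add_left card_image_le _))
    intro x hx
    rw [mem_union]
    by_contra hcon
    push Not at hcon
    obtain ⟨hxU, hx⟩ := mem_singles.1 hx
    have h1 := hcon.1
    rw [mem_singles] at h1
    push Not at h1
    obtain ⟨y, hy, hyx, hne⟩ := h1 (hUX hxU)
    have hyV₁ : y ∈ V₁ := hV₁cl x (hUV₁ hxU) y hy hyx.symm
    have hyA : y ∈ A := mem_sdiff.2 ⟨hyV₁, fun h => hne (hx y h hyx)⟩
    apply hcon.2
    refine mem_image.2 ⟨y, hyA, ?_⟩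
    exact hx _ (hmtU y hyV₁) ((hmtf y hyV₁).trans hyx)
  obtain ⟨S, hSA, hS1, hS2⟩ := exists_tight A T (fun a C => ∃ w ∈ C, ¬ G.Adj a w)
    (fun a => G.part U (mt a))
    (fun a ha => ⟨mem_image_of_mem _ (hmt_single a ha), mt a,
      self_mem_part (hmtU a (hAV₁ ha)), fun h =>
        hfV₁ a (hAV₁ ha) (mt a) (hUV₁ (hmtU a (hAV₁ ha))) h (hmtf a (hAV₁ ha)).symm⟩)
    (fun a ha b hb hab => hmt_inj a ha b hb (hpart_inj (hmt_single a ha) (hmt_single b hb) hab))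
  have hvX' : v ∉ X' := by simp [hX']
  have hZUd : Disjoint Z U := Finset.disjoint_left.2 fun x hx h => (mem_sdiff.1 (hUV₁ h)).2 hx
  have hZAd : Disjoint Z A := Finset.disjoint_left.2 fun x hx h => (mem_sdiff.1 (hAV₁ h)).2 hx
  have hUAd : Disjoint U A := disjoint_sdiff
  have hX'eq : Z ∪ U ∪ A = X' := by
    rw [union_assoc, hA, union_sdiff_of_subset hUV₁, hV₁, union_sdiff_of_subset hZX']
  have hTsub : T ⊆ U.image (G.part U) := image_subset_image (filter_subset _ _)
  have hTexp : ∀ C ∈ T, ∀ w ∈ C, ∃ h : V → V, G.ProperOn (C.erase w) h ∧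
      (∀ x ∈ C.erase w, h x ∈ C.erase w) ∧ #((C.erase w).image h) + 1 = G.chi C ∧
      singles h (C.erase w) = ∅ := by
    intro C hC w hw
    obtain ⟨x, _, rfl⟩ := mem_image.1 hC
    exact hexp x w hw
  have hTn : ∀ C ∈ U.image (G.part U), C ∉ T → ∃ h : V → V, G.ProperOn C h ∧
      (∀ x ∈ C, h x ∈ C) ∧ #(C.image h) = G.chi C ∧ singles h C = ∅ := by
    intro C hC hCT
    obtain ⟨x, hx, rfl⟩ := mem_image.1 hC
    obtain ⟨h, hp, hc, hm, hi⟩ := (hfU.mono (hpU x)).normalize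
    refine ⟨h, hp, fun y hy => (hm y hy).1, hc.trans (hpchi x), ?_⟩
    rw [eq_empty_iff_forall_notMem]
    intro y hy
    obtain ⟨hyC, hy⟩ := mem_singles.1 hy
    apply hCT
    rw [← part_eq_of_mem hyC]
    refine mem_image_of_mem _ ((hsing_part x y hyC).2 (mem_singles.2 ⟨hyC, fun z hz hzy => ?_⟩))
    exact hy z hz ((hi z hz y hyC).2 hzy)
  have hsumU : ∑ C ∈ U.image (G.part U), G.chi C = #(U.image f) := by
    have h1 : ∀ C ∈ U.image (G.part U), G.chi C = #(C.image f) := by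
      intro C hC
      obtain ⟨x, _, rfl⟩ := mem_image.1 hC
      exact (hpchi x).symm
    rw [sum_congr rfl h1, ← card_biUnion]
    · congr 1
      ext c
      simp only [mem_biUnion, mem_image, exists_exists_and_eq_and]
      constructor
      · rintro ⟨x, _, y, hy, rfl⟩
        exact ⟨y, hpU x hy, rfl⟩
      · rintro ⟨x, hx, rfl⟩
        exact ⟨x, hx, x, self_mem_part hx, rfl⟩
    · intro C hC D hD hCD
      obtain ⟨x, _, rfl⟩ := mem_image.1 hC
      obtain ⟨y, _, rfl⟩ := mem_image.1 hD
      change Disjoint _ _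
      rw [Finset.disjoint_left]
      intro c hc hc'
      obtain ⟨a, ha, rfl⟩ := mem_image.1 hc
      obtain ⟨b, hb, hab⟩ := mem_image.1 hc'
      refine hCD ?_
      rw [← part_eq_of_mem ha, ← part_eq_of_mem hb]
      exact hpcol a (hpU x ha) b (hpU y hb) hab.symm
  -- unmatched parts are joined to `v` and to the large classes
  have hgood : ∀ B ∈ T, (∀ a ∈ S, ¬ ∃ w ∈ B, ¬ G.Adj a w) → ∀ y ∈ insert v Z, ∀ w ∈ B, G.Adj y w := by
    intro B hB hBS y hy w hw
    by_contra hadj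
    obtain ⟨g, hg, hginj⟩ := hS2 B hB hBS
    rw [mem_insert] at hy
    by_cases hyZ : y ∈ Z
    -- Removing `y` from a class of at least three vertices creates no singleton. The recolouring
    -- keeps the number of colours and leaves at most `#T - #A - 1` singletons, fewer than the
    -- minimum.
    · have hZ' : ∀ x ∈ Z.erase y, ∃ z ∈ Z.erase y, f z = f x ∧ z ≠ x := by
        intro x hx
        have h1 := hZ3 x (erase_subset _ _ hx)
        have h2 : 0 < #(((X'.filter fun y => f y = f x).erase x).erase y) := by
          have := pred_card_le_card_erase (s := X'.filter fun y => f y = f x) (a := x)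
          have := pred_card_le_card_erase (s := (X'.filter fun y => f y = f x).erase x) (a := y)
          omega
        obtain ⟨z, hz⟩ := card_pos.1 h2
        simp only [mem_erase, mem_filter] at hz
        exact ⟨z, mem_erase.2 ⟨hz.1, hZcl x (erase_subset _ _ hx) z hz.2.2.1 hz.2.2.2.symm⟩,
          hz.2.2.2, hz.2.1⟩
      obtain ⟨h₀, hp₀, hc₀, hm₀, hi₀⟩ := ((hf.mono hZX').mono (erase_subset y Z)).normalize
      have hs₀ : singles h₀ (Z.erase y) = ∅ := by
        rw [eq_empty_iff_forall_notMem]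
        intro x hx
        obtain ⟨hxZ, hx⟩ := mem_singles.1 hx
        obtain ⟨z, hz, hzx, hne⟩ := hZ' x hxZ
        exact hne (hx z hz ((hi₀ z hz x hxZ).2 hzx))
      obtain ⟨F, hF, hFc, hFs⟩ := exists_recolour (G := G) (y := y)
        (hZUd.mono_left (erase_subset _ _)) (hZAd.mono_left (erase_subset _ _)) hUAd
        (notMem_erase y Z) (Finset.disjoint_left.1 hZUd hyZ) (Finset.disjoint_left.1 hZAd hyZ)
        hp₀ (fun x hx => (hm₀ x hx).1) hs₀ hTsub hTexp hTn
        (fun a ha => ⟨(hg a ha).1, (hg a ha).2.1⟩) hginj hB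
        (fun a ha => (hg a ha).2.2) ⟨w, hw, hadj⟩
      have hW : insert y (Z.erase y ∪ U ∪ A) = X' := by
        rw [← insert_union, ← insert_union, insert_erase hyZ, hX'eq]
      rw [hW] at hF hFc hFs
      have h1 : #((Z.erase y).image f) ≤ #(Z.image f) :=
        card_le_card (image_subset_image (erase_subset _ _))
      rw [himg] at hsumU
      have h2 := hF.chi_le
      have h3 := hmin F hF (by omega)
      omega
    -- Attaching `v` itself would colour all of `X` with `χ(X) - 1` colours.
    · have hyv : y = v := hy.resolve_right hyZ
      obtain ⟨h₀, hp₀, hc₀, hm₀, hi₀⟩ := (hf.mono hZX').normalize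
      have hs₀ : singles h₀ Z = ∅ := by
        rw [eq_empty_iff_forall_notMem]
        intro x hx
        obtain ⟨hxZ, hx⟩ := mem_singles.1 hx
        have h1 := hZ3 x hxZ
        have h2 : (X'.filter fun y => f y = f x) ⊆ {x} := by
          intro z hz
          rw [mem_filter] at hz
          have hzZ := hZcl x hxZ z hz.1 hz.2.symm
          exact mem_singleton.2 (hx z hzZ ((hi₀ z hzZ x hxZ).2 hz.2))
        have := card_le_card h2
        rw [card_singleton] at this
        omega
      obtain ⟨F, hF, hFc, hFs⟩ := exists_recolour (G := G) (y := v) hZUd hZAd hUAd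
        (fun h => hvX' (hZX' h)) (fun h => hvX' (hUX h)) (fun h => hvX' (hV₁X' (hAV₁ h)))
        hp₀ (fun x hx => (hm₀ x hx).1) hs₀ hTsub hTexp hTn
        (fun a ha => ⟨(hg a ha).1, (hg a ha).2.1⟩) hginj hB
        (fun a ha => (hg a ha).2.2) ⟨w, hw, hyv ▸ hadj⟩
      have hW : insert v (Z ∪ U ∪ A) = X := by rw [hX'eq, hX', insert_erase hv]
      rw [hW] at hF hFc
      rw [himg] at hsumU
      have h2 := hF.chi_le
      omega
  -- the union of the unmatched parts splits off
  obtain ⟨𝒟, h𝒟⟩ : ∃ 𝒟 : Finset (Finset V), ∀ B, B ∈ 𝒟 ↔ B ∈ T ∧ ∀ a ∈ S, ¬ ∃ w ∈ B, ¬ G.Adj a w :=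
    ⟨T.filter _, fun B => mem_filter⟩
  set D := 𝒟.biUnion id with hD
  set A₁ := A \ S with hA₁
  have hDmem : ∀ x, x ∈ D ↔ x ∈ U ∧ G.part U x ∈ 𝒟 := by
    intro x
    simp only [hD, mem_biUnion, id]
    constructor
    · rintro ⟨B, hB, hx⟩
      obtain ⟨y, _, rfl⟩ := mem_image.1 ((h𝒟 _).1 hB).1
      exact ⟨hpU y hx, by rwa [part_eq_of_mem hx]⟩
    · exact fun ⟨h1, h2⟩ => ⟨_, h2, self_mem_part h1⟩
  have hDU : D ⊆ U := fun x hx => ((hDmem x).1 hx).1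
  have hDjU : G.Joined D (U \ D) := by
    intro x hx y hy
    rw [mem_sdiff] at hy
    refine joined_part x x (self_mem_part (hDU hx)) y (mem_sdiff.2 ⟨hy.1, fun h => hy.2 ?_⟩)
    exact (hDmem y).2 ⟨hy.1, by rw [part_eq_of_mem h]; exact ((hDmem x).1 hx).2⟩
  have hDX : D ⊆ X := hDU.trans (hUX.trans (erase_subset _ _))
  have hA₁X : A₁ ⊆ X := sdiff_subset.trans (hAV₁.trans (hV₁X'.trans (erase_subset _ _)))
  have hmtD : ∀ a ∈ A, a ∉ S → mt a ∈ D := by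
    intro a ha haS
    refine (hDmem _).2 ⟨hmtU a (hAV₁ ha), (h𝒟 _).2 ⟨mem_image_of_mem _ (hmt_single a ha), ?_⟩⟩
    intro b hb hbw
    obtain ⟨a', ha', he⟩ := hS1 b hb _ (mem_image_of_mem _ (hmt_single a ha)) hbw
    have := hmt_inj a' (hSA ha') a ha (hpart_inj (hmt_single _ (hSA ha')) (hmt_single _ ha) he)
    exact haS (this ▸ ha')
  have huD : u ∈ D := by
    refine (hDmem u).2 ⟨huU, (h𝒟 _).2 ⟨mem_image_of_mem _ huUs, ?_⟩⟩
    intro b hb hbw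
    obtain ⟨a, ha, he⟩ := hS1 b hb _ (mem_image_of_mem _ huUs) hbw
    have h1 := hpart_inj (hmt_single _ (hSA ha)) huUs he
    have h2 := hu a (hV₁X' (hAV₁ (hSA ha))) (by rw [← h1]; exact (hmtf a (hAV₁ (hSA ha))).symm)
    exact hAU a (hSA ha) (h2 ▸ huU)
  have hjoin : G.Joined D (X \ (D ∪ A₁)) := by
    intro x hx y hy
    rw [mem_sdiff, mem_union, not_or] at hy
    obtain ⟨hyX, hyD, hyA₁⟩ := hy
    obtain ⟨hxU, hx𝒟⟩ := (hDmem x).1 hx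
    have hxT := ((h𝒟 _).1 hx𝒟).1
    have hxS := ((h𝒟 _).1 hx𝒟).2
    by_cases hyU : y ∈ U
    · exact hDjU x hx y (mem_sdiff.2 ⟨hyU, hyD⟩)
    by_cases hyA : y ∈ A
    · have hyS : y ∈ S := by
        by_contra h
        exact hyA₁ (mem_sdiff.2 ⟨hyA, h⟩)
      have := hxS y hyS
      push Not at this
      exact (this x (self_mem_part hxU)).symm
    · refine (hgood _ hxT hxS y ?_ x (self_mem_part hxU)).symm
      rw [mem_insert]
      by_contra hcon
      push Not at hcon
      have : y ∈ Z ∪ U ∪ A := by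
        rw [hX'eq]
        exact mem_erase.2 ⟨hcon.1, hyX⟩
      simp only [mem_union] at this
      tauto
  have hchiD : #(D.image f) = G.chi D := hfU.card_image_of_joined hUc hDU hDjU
  -- The partners of the vertices of `A₁` lie in `D`, so `A₁` brings no new colour.
  have hchiDA : G.chi (D ∪ A₁) ≤ G.chi D := by
    have hsub : D ∪ A₁ ⊆ X' :=
      union_subset (hDU.trans hUX) (sdiff_subset.trans (hAV₁.trans hV₁X'))
    refine (hf.mono hsub).chi_le.trans ?_
    rw [← hchiD]
    refine card_le_card fun c hc => ?_
    obtain ⟨x, hx, rfl⟩ := mem_image.1 hc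
    rcases mem_union.1 hx with h | h
    · exact mem_image_of_mem _ h
    · obtain ⟨hxA, hxS⟩ := mem_sdiff.1 h
      rw [← hmtf x (hAV₁ hxA)]
      exact mem_image_of_mem _ (hmtD x hxA hxS)
  have hfin : G.chi X ≤ G.chi (X \ A₁) := by
    calc G.chi X ≤ G.chi ((D ∪ A₁) ∪ (X \ (D ∪ A₁))) := by
          rw [union_sdiff_of_subset (union_subset hDX hA₁X)]
      _ ≤ G.chi (D ∪ A₁) + G.chi (X \ (D ∪ A₁)) := chi_union_le
      _ ≤ G.chi D + G.chi (X \ (D ∪ A₁)) := Nat.add_le_add_right hchiDA _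
      _ = G.chi (D ∪ (X \ (D ∪ A₁))) := hjoin.chi_union.symm
      _ ≤ G.chi (X \ A₁) := by
          refine chi_mono fun x hx => ?_
          rw [mem_union, mem_sdiff, mem_union] at hx
          rw [mem_sdiff]
          rcases hx with h | h
          · exact ⟨hDX h, fun h' => hAU x (mem_sdiff.1 h').1 (hDU h)⟩
          · exact ⟨h.1, fun h' => h.2 (Or.inr h')⟩
  -- Deleting `A₁` does not lower the chromatic number, so by criticality it is empty. Then `D` is
  -- joined to the rest of `X` and must be all of `X`, although it misses `v`.
  have hA₁e : A₁ = ∅ := by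
    rw [eq_empty_iff_forall_notMem]
    intro a ha
    have h1 := hX a (hA₁X ha)
    have h2 : G.chi (X \ A₁) ≤ G.chi (X.erase a) := by
      refine chi_mono fun x hx => ?_
      rw [mem_sdiff] at hx
      exact mem_erase.2 ⟨fun h => hx.2 (h ▸ ha), hx.1⟩
    omega
  rw [hA₁e, union_empty] at hjoin
  have hDeq := hco D hDX ⟨u, huD⟩ hjoin
  exact hvX' (hUX (hDU (hDeq ▸ hv)))

/-- After the removal of one vertex, `χ - 1` classes of at least two vertices each cover the
remaining vertices. -/
theorem CriticalOn.two_mul_chi_le (hX : G.CriticalOn X) (hco : G.CoconnectedOn X)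
    (hne : X.Nonempty) : 2 * G.chi X ≤ #X + 1 := by
  obtain ⟨v, hv⟩ := hne
  obtain ⟨f, _, _, hc, hs⟩ := hX.exists_no_singles hco hv
  have h1 := two_mul_card_image_le hs
  rw [card_erase_of_mem hv] at h1
  have : 0 < #X := card_pos.2 ⟨v, hv⟩
  omega

/-! ### Routing pairs through disjoint edge sets -/

/-- The unordered pairs of distinct elements of `X`. -/
def pairs (X : Finset V) : Set (Sym2 V) := {e | ¬ e.IsDiag ∧ ∀ v ∈ e, v ∈ X}

/-- The unordered pairs with one element in `X` and one in `Y`. -/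
def across (X Y : Finset V) : Set (Sym2 V) := {e | ∃ x ∈ X, ∃ y ∈ Y, e = s(x, y)}

theorem mk_mem_pairs {x y : V} : s(x, y) ∈ pairs X ↔ x ≠ y ∧ x ∈ X ∧ y ∈ X := by
  simp [pairs, Sym2.mem_iff]

theorem mk_mem_across {x y : V} : s(x, y) ∈ across X Y ↔ x ∈ X ∧ y ∈ Y ∨ y ∈ X ∧ x ∈ Y := by
  constructor
  · rintro ⟨a, ha, b, hb, h⟩
    rcases Sym2.eq_iff.1 h with ⟨rfl, rfl⟩ | ⟨rfl, rfl⟩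
    · exact Or.inl ⟨ha, hb⟩
    · exact Or.inr ⟨ha, hb⟩
  · rintro (⟨h1, h2⟩ | ⟨h1, h2⟩)
    · exact ⟨x, h1, y, h2, rfl⟩
    · exact ⟨y, h1, x, h2, Sym2.eq_swap⟩

theorem pairs_mono (h : X ⊆ Y) : pairs X ⊆ pairs Y := fun _ he => ⟨he.1, fun v hv => h (he.2 v hv)⟩

theorem across_mono {X' Y' : Finset V} (hX : X' ⊆ X) (hY : Y' ⊆ Y) : across X' Y' ⊆ across X Y :=
  fun _ ⟨x, hx, y, hy, h⟩ => ⟨x, hX hx, y, hY hy, h⟩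

theorem disjoint_pairs (h : Disjoint X Y) : Disjoint (pairs X) (pairs Y) := by
  rw [Set.disjoint_left]
  intro e
  induction e with | _ x y
  rw [mk_mem_pairs, mk_mem_pairs]
  exact fun h1 h2 => Finset.disjoint_left.1 h h1.2.1 h2.2.1

theorem disjoint_pairs_across {Z : Finset V} (h : Disjoint X Y) :
    Disjoint (pairs X) (across Y Z) := by
  rw [Set.disjoint_left]
  intro e
  induction e with | _ x y
  rw [mk_mem_pairs, mk_mem_across]
  have := Finset.disjoint_left.1 h
  rintro ⟨_, h1, h2⟩ (h3 | h3)
  · exact this h1 h3.1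
  · exact this h2 h3.1

theorem across_comm : across X Y = across Y X := by
  ext e
  induction e with | _ x y
  rw [mk_mem_across, mk_mem_across]
  tauto

theorem across_subset_pairs (h : Disjoint X Y) : across X Y ⊆ pairs (X ∪ Y) := by
  rintro _ ⟨x, hx, y, hy, rfl⟩
  rw [mk_mem_pairs]
  exact ⟨fun h' => Finset.disjoint_left.1 h hx (h' ▸ hy), mem_union_left _ hx, mem_union_right _ hy⟩

theorem pairs_union : pairs (X ∪ Y) ⊆ pairs X ∪ pairs Y ∪ across X Y := by
  intro e
  induction e with | _ x y
  simp only [Set.mem_union, mk_mem_pairs, mk_mem_across, mem_union]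
  tauto

/-- The pairs in `D` can be linked through pairwise disjoint sets of edges of `G` in `S`. -/
def Routes (G : SimpleGraph V) (S D : Set (Sym2 V)) : Prop :=
  ∃ P : Sym2 V → Set (Sym2 V), (∀ x y, s(x, y) ∈ D → P s(x, y) ⊆ S ∩ G.edgeSet ∧
    (fromEdgeSet (P s(x, y))).Reachable x y) ∧ D.PairwiseDisjoint P

theorem Routes.mono {S S' D D' : Set (Sym2 V)} (h : G.Routes S D) (hS : S ⊆ S') (hD : D' ⊆ D) :
    G.Routes S' D' := by
  obtain ⟨P, h1, h2⟩ := h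
  exact ⟨P, fun x y hxy => ⟨(h1 x y (hD hxy)).1.trans (Set.inter_subset_inter_left _ hS),
    (h1 x y (hD hxy)).2⟩, h2.subset hD⟩

theorem Routes.of_subset_edgeSet {S D : Set (Sym2 V)} (hS : D ⊆ S) (hG : D ⊆ G.edgeSet) :
    G.Routes S D := by
  refine ⟨fun e => {e}, fun x y hxy => ⟨?_, ?_⟩, ?_⟩
  · rintro _ rfl
    exact ⟨hS hxy, hG hxy⟩
  · refine Adj.reachable ?_
    rw [fromEdgeSet_adj]
    exact ⟨rfl, G.ne_of_adj (hG hxy)⟩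
  · intro e _ e' _ hne
    change Disjoint _ _
    simpa using hne

theorem Routes.union {S₁ S₂ D₁ D₂ : Set (Sym2 V)} (h₁ : G.Routes S₁ D₁) (h₂ : G.Routes S₂ D₂)
    (hS : Disjoint S₁ S₂) : G.Routes (S₁ ∪ S₂) (D₁ ∪ D₂) := by
  obtain ⟨P, hP, hP'⟩ := h₁
  obtain ⟨Q, hQ, hQ'⟩ := h₂
  have hPS : ∀ e ∈ D₁, P e ⊆ S₁ := by
    intro e
    induction e with | _ x y
    exact fun h => (hP x y h).1.trans Set.inter_subset_left
  have hQS : ∀ e ∈ D₂, Q e ⊆ S₂ := by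
    intro e
    induction e with | _ x y
    exact fun h => (hQ x y h).1.trans Set.inter_subset_left
  refine ⟨fun e => if e ∈ D₁ then P e else Q e, fun x y hxy => ?_, ?_⟩
  · by_cases h : s(x, y) ∈ D₁
    · simp only [h, if_true]
      exact ⟨(hP x y h).1.trans (Set.inter_subset_inter_left _ Set.subset_union_left), (hP x y h).2⟩
    · simp only [h, if_false]
      have h' := hxy.resolve_left h
      exact ⟨(hQ x y h').1.trans (Set.inter_subset_inter_left _ Set.subset_union_right),
        (hQ x y h').2⟩
  · intro e he e' he' hne
    change Disjoint (if e ∈ D₁ then P e else Q e) (if e' ∈ D₁ then P e' else Q e')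
    by_cases h : e ∈ D₁ <;> by_cases h' : e' ∈ D₁ <;> simp only [h, h', if_true, if_false]
    · exact hP' h h' hne
    · exact hS.mono (hPS e h) (hQS e' (he'.resolve_left h'))
    · exact (hS.mono (hPS e' h') (hQS e (he.resolve_left h))).symm
    · exact hQ' (he.resolve_left h) (he'.resolve_left h') hne

/-- Each edge set that connects two branch vertices contains a path between them, and paths in
disjoint edge sets are edge-disjoint. -/
theorem Routes.containsWeakImmersion {S : Set (Sym2 V)} {B : Finset V} {k : ℕ} (hB : #B = k)
    (h : G.Routes S (pairs B)) : G.ContainsWeakImmersion (completeGraph (Fin k)) := by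
  obtain ⟨P, hP, hP'⟩ := h
  let b : Fin k → V := fun i => (B.equivFinOfCardEq hB).symm i
  have hb : Function.Injective b :=
    Subtype.val_injective.comp (B.equivFinOfCardEq hB).symm.injective
  have hbB : ∀ i, b i ∈ B := fun i => ((B.equivFinOfCardEq hB).symm i).2
  let o : (completeGraph (Fin k)).edgeSet → Fin k × Fin k := fun e => Quot.out e.1
  have ho : ∀ e, s((o e).1, (o e).2) = e.1 := fun e => Quot.out_eq e.1
  have hne : ∀ e, (o e).1 ≠ (o e).2 := by
    intro e
    have h1 := e.2
    rw [← ho e] at h1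
    exact (completeGraph (Fin k)).ne_of_adj h1
  have hmem : ∀ e, s(b (o e).1, b (o e).2) ∈ pairs B := fun e =>
    mk_mem_pairs.2 ⟨fun h => hne e (hb h), hbB _, hbB _⟩
  have hpath : ∀ e, ∃ p : G.Path (b (o e).1) (b (o e).2),
      ∀ d ∈ p.1.edges, d ∈ P s(b (o e).1, b (o e).2) := by
    intro e
    obtain ⟨h1, h2⟩ := hP _ _ (hmem e)
    obtain ⟨w, hw⟩ := h2.exists_isPath
    have hle : fromEdgeSet (P s(b (o e).1, b (o e).2)) ≤ G := by
      intro x y hxy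
      rw [fromEdgeSet_adj] at hxy
      exact (h1 hxy.1).2
    refine ⟨⟨w.mapLe hle, (Walk.isPath_mapLe hle).2 hw⟩, fun d hd => ?_⟩
    have h3 : d ∈ w.edges := by simpa using hd
    have h4 := w.edges_subset_edgeSet h3
    rw [edgeSet_fromEdgeSet] at h4
    exact h4.1
  choose p hp using hpath
  refine ⟨⟨b, fun e => b (o e).1, fun e => b (o e).2, p, hb, fun e => ?_, fun e e' hee => ?_⟩⟩
  · rw [← ho e, Sym2.map_mk]
  · intro d hd hd'
    refine Set.disjoint_left.1 (hP' (hmem e) (hmem e') ?_) (hp e d hd) (hp e' d hd')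
    intro h
    apply hee
    apply Subtype.ext
    rw [← ho e, ← ho e']
    exact Sym2.map.injective hb (by simpa only [Sym2.map_mk] using h)

/-- A complete graph on `k` vertices of `X` can be routed inside `X`. -/
def Linked (G : SimpleGraph V) (X : Finset V) (k : ℕ) : Prop :=
  ∃ B ⊆ X, #B = k ∧ G.Routes (pairs X) (pairs B)

theorem across_subset_edgeSet (hj : G.Joined X Y) : across X Y ⊆ G.edgeSet := by
  rintro _ ⟨x, hx, y, hy, rfl⟩
  exact hj x hx y hy

/-- Branch vertices on different sides of a join are linked by their own edge, which neither side
uses. -/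
theorem Linked.union {k l : ℕ} (hX : G.Linked X k) (hY : G.Linked Y l) (hj : G.Joined X Y) :
    G.Linked (X ∪ Y) (k + l) := by
  obtain ⟨B, h1, h2, h3⟩ := hX
  obtain ⟨C, h4, h5, h6⟩ := hY
  refine ⟨B ∪ C, union_subset_union h1 h4, ?_, ?_⟩
  · rw [card_union_of_disjoint (disjoint_of_subset_left h1 (disjoint_of_subset_right h4 hj.disjoint)), h2, h5]
  have h7 : G.Routes (across X Y) (across B C) :=
    Routes.of_subset_edgeSet (across_mono h1 h4) (across_subset_edgeSet (hj.mono h1 h4))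
  refine ((h3.union h6 (disjoint_pairs hj.disjoint)).union h7 ?_).mono ?_ pairs_union
  · rw [Set.disjoint_union_left]
    exact ⟨across_comm (X := Y) ▸ disjoint_pairs_across hj.disjoint,
      disjoint_pairs_across hj.disjoint.symm⟩
  · refine Set.union_subset (Set.union_subset (pairs_mono subset_union_left)
      (pairs_mono subset_union_right)) (across_subset_pairs hj.disjoint)

/-! ### Kempe chains at a vertex of least possible degree -/

/-- If a colour class pair does not link `a` to `b`, then `a` can be recoloured by the colour of `b`
without changing the colours outside these two classes. -/
theorem ProperOn.kempe_swap {α : Type*} {f : V → α} (hf : G.ProperOn X f) {a b : V}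
    (hab : ¬ (fromEdgeSet {e | e ∈ pairs X ∩ G.edgeSet ∧ e.map f = s(f a, f b)}).Reachable a b) :
    ∃ f' : V → α, G.ProperOn X f' ∧ (∀ x, f' x = f x ∨ f' x = f a ∨ f' x = f b) ∧
      f' a = f b ∧ f' b = f b ∧ ∀ x, f x ≠ f a → f x ≠ f b → f' x = f x := by
  set K := fromEdgeSet {e | e ∈ pairs X ∩ G.edgeSet ∧ e.map f = s(f a, f b)} with hK
  have hadj : ∀ x y, x ∈ X → y ∈ X → G.Adj x y → s(f x, f y) = s(f a, f b) → K.Adj x y := by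
    intro x y hx hy hxy he
    rw [hK, fromEdgeSet_adj]
    exact ⟨⟨⟨mk_mem_pairs.2 ⟨hxy.ne, hx, hy⟩, hxy⟩, he⟩, hxy.ne⟩
  -- The two colours are exchanged on the component of `a` only; by `hab` it does not contain `b`.
  refine ⟨fun x => if K.Reachable a x then if f x = f a then f b else if f x = f b then f a else f x
    else f x, ?_, ?_, ?_, ?_, ?_⟩
  · intro x hx y hy hxy
    have h1 := hf x hx y hy hxy
    have h2 := hadj x y hx hy hxy
    have h3 := hadj y x hy hx hxy.symm
    have h4 : K.Adj x y → (K.Reachable a x ↔ K.Reachable a y) := fun h =>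
      ⟨fun h' => h'.trans h.reachable, fun h' => h'.trans h.symm.reachable⟩
    rw [Sym2.eq_iff] at h2
    by_cases h5 : (f x = f a ∧ f y = f b) ∨ (f x = f b ∧ f y = f a)
    · have h6 := h4 (h2 h5)
      simp only [h6]
      split_ifs <;> grind
    · dsimp only
      split_ifs <;> grind
  · intro x
    dsimp only
    split_ifs <;> simp_all
  · simp
  · simp [hab]
  · intro x h1 h2
    simp [h1, h2]

/-- In every optimal colouring of `X` minus `v`, the `χ - 1` neighbours of `v` carry all colours,
since otherwise `v` could be coloured as well. So two of them are connected by a Kempe chain in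
their two colours: a swap would make one colour vanish from the neighbourhood. Chains for different
colour pairs are edge-disjoint, and `v` with its neighbours forms the branch set. -/
theorem CriticalOn.linked_of_tight (hX : G.CriticalOn X) {v : V} (hv : v ∈ X)
    (hd : #(X.filter (G.Adj v)) + 1 = G.chi X) : G.Linked X (G.chi X) := by
  set N := X.filter (G.Adj v) with hN
  set X' := X.erase v with hX'
  have hNX : N ⊆ X' := fun x hx => by
    rw [hN, mem_filter] at hx
    exact mem_erase.2 ⟨hx.2.ne', hx.1⟩
  have hvN : v ∉ N := fun h => notMem_erase v X (hNX h)
  obtain ⟨f, hf, hfc, -⟩ := G.exists_chi X'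
  have hc : G.chi X' + 1 = G.chi X := hX.chi_erase hv
  -- every colour occurs among the neighbours of `v`
  have key : ∀ g : V → V, G.ProperOn X' g → X'.image g ⊆ X'.image f → X'.image f ⊆ N.image g := by
    intro g hg hgf c hc'
    by_contra hcN
    have h1 : G.ProperOn X (fun x => if x = v then c else g x) := by
      intro x hx y hy hxy
      have h2 : ∀ y ∈ X, G.Adj v y → g y ≠ c := fun y hy hvy h =>
        hcN (mem_image.2 ⟨y, mem_filter.2 ⟨hy, hvy⟩, h⟩)
      by_cases hxv : x = v <;> by_cases hyv : y = v <;> simp only [hxv, hyv, if_true, if_false]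
      · exact absurd (hxv.trans hyv.symm) hxy.ne
      · exact (h2 y hy (hxv ▸ hxy)).symm
      · exact h2 x hx (hyv ▸ hxy.symm)
      · exact hg x (mem_erase.2 ⟨hxv, hx⟩) y (mem_erase.2 ⟨hyv, hy⟩) hxy
    have h3 := h1.chi_le
    have h4 : X.image (fun x => if x = v then c else g x) ⊆ X'.image f := by
      intro d hd
      obtain ⟨x, hx, rfl⟩ := mem_image.1 hd
      by_cases hxv : x = v
      · simpa [hxv] using hc'
      · simp only [hxv, if_false]
        exact hgf (mem_image_of_mem _ (mem_erase.2 ⟨hxv, hx⟩))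
    have h5 := card_le_card h4
    rw [hfc] at h5
    omega
  have himg : N.image f = X'.image f :=
    Subset.antisymm (image_subset_image hNX) (key f hf Subset.rfl)
  have hinj : Set.InjOn f N := by
    rw [← card_image_iff, himg, hfc]
    omega
  refine ⟨insert v N, ?_, ?_, ?_⟩
  · exact insert_subset hv (filter_subset _ _)
  · rw [card_insert_of_notMem hvN, hd]
  -- A pair containing `v` uses its own edge; any other pair may use all edges between its two
  -- colour classes.
  refine ⟨fun e => if v ∈ e then {e} else {d | d ∈ pairs X' ∩ G.edgeSet ∧ d.map f = e.map f}, ?_, ?_⟩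
  · intro x y hxy
    rw [mk_mem_pairs, mem_insert, mem_insert] at hxy
    obtain ⟨hne, hx, hy⟩ := hxy
    by_cases hve : v ∈ s(x, y)
    · simp only [hve, if_true]
      have hadj : G.Adj x y := by
        rw [Sym2.mem_iff] at hve
        rcases hve with rfl | rfl
        · exact (mem_filter.1 (hy.resolve_left hne.symm)).2
        · exact (mem_filter.1 (hx.resolve_left hne)).2.symm
      refine ⟨?_, Adj.reachable ?_⟩
      · rintro _ rfl
        refine ⟨mk_mem_pairs.2 ⟨hne, ?_, ?_⟩, hadj⟩
        · rcases hx with rfl | hx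
          exacts [hv, (mem_filter.1 hx).1]
        · rcases hy with rfl | hy
          exacts [hv, (mem_filter.1 hy).1]
      · rw [fromEdgeSet_adj]
        exact ⟨rfl, hne⟩
    · simp only [hve, if_false]
      rw [Sym2.mem_iff, not_or] at hve
      have hxN : x ∈ N := hx.resolve_left (Ne.symm hve.1)
      have hyN : y ∈ N := hy.resolve_left (Ne.symm hve.2)
      refine ⟨fun d hd => ⟨pairs_mono (erase_subset _ _) hd.1.1, hd.1.2⟩, ?_⟩
      by_contra hr
      obtain ⟨g, hg, hgf, hgx, hgy, hgo⟩ := hf.kempe_swap hr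
      have h1 : X'.image g ⊆ X'.image f := by
        intro c hc
        obtain ⟨z, hz, rfl⟩ := mem_image.1 hc
        rcases hgf z with h | h | h <;> rw [h]
        exacts [mem_image_of_mem _ hz, mem_image_of_mem _ (hNX hxN), mem_image_of_mem _ (hNX hyN)]
      obtain ⟨z, hz, hzx⟩ := mem_image.1 (key g hg h1 (mem_image_of_mem f (hNX hxN)))
      have hfxy : f x ≠ f y := fun h => hne (hinj hxN hyN h)
      by_cases hz1 : f z = f x
      · rw [hinj hz hxN hz1, hgx] at hzx
        exact hfxy hzx.symm
      · by_cases hz2 : f z = f y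
        · rw [hinj hz hyN hz2, hgy] at hzx
          exact hfxy hzx.symm
        · exact hz1 ((hgo z hz1 hz2).symm.trans hzx)
  · intro e he e' he' hne
    change Disjoint (if v ∈ e then {e} else {d | d ∈ pairs X' ∩ G.edgeSet ∧ d.map f = e.map f})
      (if v ∈ e' then {e'} else {d | d ∈ pairs X' ∩ G.edgeSet ∧ d.map f = e'.map f})
    have hnot : ∀ d ∈ pairs X', v ∉ d := fun d hd h => notMem_erase v X (hd.2 v h)
    rw [Set.disjoint_left]
    intro d hd hd'
    by_cases h : v ∈ e <;> by_cases h' : v ∈ e' <;>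
      simp only [h, h', if_true, if_false, Set.mem_singleton_iff, Set.mem_ofPred_eq] at hd hd'
    · exact hne (hd.symm.trans hd')
    · exact hnot d hd'.1.1 (hd ▸ h)
    · exact hnot d hd.1.1 (hd' ▸ h')
    · apply hne
      have hEN : ∀ e ∈ pairs (insert v N), v ∉ e → ∀ x ∈ e, x ∈ N := fun e he hve x hx =>
        (mem_insert.1 (he.2 x hx)).resolve_left fun h => hve (h ▸ hx)
      have h1 := hEN e he h
      have h2 := hEN e' he' h'
      have h3 := hd.2.symm.trans hd'.2
      induction e with | _ x y
      induction e' with | _ a b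
      simp only [Sym2.mem_iff, forall_eq_or_imp, forall_eq] at h1 h2
      rw [Sym2.map_mk, Sym2.map_mk, Sym2.eq_iff] at h3
      rw [Sym2.eq_iff]
      rcases h3 with h3 | h3
      · exact Or.inl ⟨hinj h1.1 h2.1 h3.1, hinj h1.2 h2.2 h3.2⟩
      · exact Or.inr ⟨hinj h1.1 h2.2 h3.1, hinj h1.2 h2.1 h3.2⟩

/-! ### Vizing's theorem for multigraphs -/

/-- In a graph of maximum degree two, a component contains at most two vertices of degree at most
one. -/
theorem eq_of_reachable_of_degree_le {K : SimpleGraph V}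
    (h2 : ∀ v a b c, K.Adj v a → K.Adj v b → K.Adj v c → a = b ∨ a = c ∨ b = c) {x y z : V}
    (hx : ∀ a b, K.Adj x a → K.Adj x b → a = b) (hy : ∀ a b, K.Adj y a → K.Adj y b → a = b)
    (hz : ∀ a b, K.Adj z a → K.Adj z b → a = b) (hxy : x ≠ y) (hxz : x ≠ z)
    (hry : K.Reachable x y) (hrz : K.Reachable x z) : y = z := by
  obtain ⟨p, hp⟩ := hry.exists_isPath
  obtain ⟨q, hq⟩ := hrz.exists_isPath
  -- Both paths leave `x` by its only edge and cannot branch later, so the shorter is an initial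
  -- segment of the longer. The longer cannot continue past the end of the shorter, which has degree
  -- at most one.
  have key : ∀ (y z : V) (p : K.Walk x y) (q : K.Walk x z), p.IsPath → q.IsPath →
      (∀ a b, K.Adj y a → K.Adj y b → a = b) → x ≠ y → p.length ≤ q.length → y = z := by
    intro y z p q hp hq hy hxy hle
    have h : ∀ i, i + 1 ≤ p.length → p.getVert i = q.getVert i ∧ p.getVert (i + 1) = q.getVert (i + 1) := by
      intro i
      induction i with
      | zero =>
        intro hi
        refine ⟨by simp, hx _ _ ?_ ?_⟩
        · simpa using p.adj_getVert_succ (i := 0) (by omega)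
        · simpa using q.adj_getVert_succ (i := 0) (by omega)
      | succ i ih =>
        intro hi
        obtain ⟨h3, h4⟩ := ih (by omega)
        refine ⟨h4, ?_⟩
        have a1 := p.adj_getVert_succ (i := i) (by omega)
        have a2 := p.adj_getVert_succ (i := i + 1) (by omega)
        have a3 := q.adj_getVert_succ (i := i + 1) (by omega)
        rw [← h4] at a3
        rcases h2 _ _ _ _ a1.symm a2 a3 with h | h | h
        · exact absurd (hp.getVert_injOn (by simp; omega) (by simp; omega) h) (by omega)
        · rw [h3] at h
          exact absurd (hq.getVert_injOn (by simp; omega) (by simp; omega) h) (by omega)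
        · exact h
    have hpos : 0 < p.length := by
      rcases Nat.eq_zero_or_pos p.length with h0 | h0
      · exact absurd (Walk.eq_of_length_eq_zero h0) hxy
      · exact h0
    obtain ⟨h3, h4⟩ := h (p.length - 1) (by omega)
    rw [show p.length - 1 + 1 = p.length by omega, p.getVert_length] at h4
    rcases hle.eq_or_lt with he | hl
    · rw [h4, he, q.getVert_length]
    · exfalso
      have a1 := q.adj_getVert_succ (i := p.length - 1) (by omega)
      have a2 := q.adj_getVert_succ (i := p.length) hl
      rw [show p.length - 1 + 1 = p.length by omega, ← h4] at a1
      rw [← h4] at a2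
      have h5 := hy _ _ a1.symm a2
      exact absurd (hq.getVert_injOn (by simp; omega) (by simp; omega) h5) (by omega)
  rcases le_total p.length q.length with h | h
  · exact key y z p q hp hq hy hxy h
  · exact (key z y q p hq hp hz hxz h).symm

section EdgeColouring
variable {E α : Type*} {ends : E → Sym2 V} {F : Finset E} {c : E → α}

/-- `c` gives different colours to distinct members of `F` with a common end. -/
def ProperEdge (ends : E → Sym2 V) (F : Finset E) (c : E → α) : Prop :=
  ∀ e ∈ F, ∀ f ∈ F, ∀ v, v ∈ ends e → v ∈ ends f → c e = c f → e = f

/-- The colour `a` does not occur at `v`. -/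
def MissingAt (ends : E → Sym2 V) (F : Finset E) (c : E → α) (v : V) (a : α) : Prop :=
  ∀ e ∈ F, v ∈ ends e → c e ≠ a

/-- A sequence of edges at `x`, with other ends `y 1, …, y l`, such that each edge has a colour
missing at the end of the preceding one. -/
structure FanPath (ends : E → Sym2 V) (F : Finset E) (c : E → α) (x : V) (y : ℕ → V) (e : ℕ → E)
    (l : ℕ) : Prop where
  inj : ∀ i ≤ l, ∀ j ≤ l, y i = y j → i = j
  mem : ∀ i < l, e (i + 1) ∈ F
  ends_eq : ∀ i < l, ends (e (i + 1)) = s(x, y (i + 1))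
  missing : ∀ i < l, MissingAt ends F c (y i) (c (e (i + 1)))

theorem FanPath.take {x : V} {y : ℕ → V} {e : ℕ → E} {l m : ℕ} (h : FanPath ends F c x y e l)
    (hm : m ≤ l) : FanPath ends F c x y e m :=
  ⟨fun i hi j hj => h.inj i (hi.trans hm) j (hj.trans hm), fun i hi => h.mem i (hi.trans_le hm),
    fun i hi => h.ends_eq i (hi.trans_le hm), fun i hi => h.missing i (hi.trans_le hm)⟩

/-- Shift along the fan: the last edge takes `a`, which frees its old colour at `x`. That colour is
missing at the preceding end, so the shift continues down to `e₀`. -/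
theorem FanPath.exists_colouring {U : Finset α} {x : V} {y : ℕ → V} {e : ℕ → E} {l : ℕ}
    {e₀ : E} (hends : ends e₀ = s(x, y 0))
    (hc : ProperEdge ends F c) (hU : ∀ e ∈ F, c e ∈ U) (hx : ∀ i ≤ l, y i ≠ x)
    (h : FanPath ends F c x y e l) {a : α} (haU : a ∈ U) (hax : MissingAt ends F c x a)
    (hay : MissingAt ends F c (y l) a) :
    ∃ c' : E → α, ProperEdge ends (insert e₀ F) c' ∧ ∀ e ∈ insert e₀ F, c' e ∈ U := by
  induction l generalizing c a with
  | zero =>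
    refine ⟨fun e => if e = e₀ then a else c e, ?_, ?_⟩
    · intro f hf g hg v hvf hvg hfg
      rw [mem_insert] at hf hg
      have key : ∀ g ∈ F, ∀ v, v ∈ ends e₀ → v ∈ ends g → c g ≠ a := by
        intro g hg v hv hvg
        rw [hends, Sym2.mem_iff] at hv
        rcases hv with rfl | rfl
        exacts [hax g hg hvg, hay g hg hvg]
      by_cases h1 : f = e₀ <;> by_cases h2 : g = e₀ <;> simp only [h1, h2, if_true, if_false] at hfg
      · exact h1.trans h2.symm
      · exact absurd hfg.symm (key g (hg.resolve_left h2) v (h1 ▸ hvf) hvg)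
      · exact absurd hfg (key f (hf.resolve_left h1) v (h2 ▸ hvg) hvf)
      · exact hc f (hf.resolve_left h1) g (hg.resolve_left h2) v hvf hvg hfg
    · intro f hf
      by_cases h1 : f = e₀
      · simpa [h1] using haU
      · simpa [h1] using hU f ((mem_insert.1 hf).resolve_left h1)
  | succ l ih =>
    have hlF := h.mem l (by omega)
    have hle := h.ends_eq l (by omega)
    have hlm := h.missing l (by omega)
    set d := e (l + 1) with hd
    have hne : ∀ i < l, e (i + 1) ≠ d := by
      intro i hi hid
      have h1 := h.ends_eq i (by omega)
      rw [hid, hle] at h1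
      have h2 : y (l + 1) = y (i + 1) := Sym2.congr_right.1 h1
      have := h.inj _ le_rfl _ (by omega) h2
      omega
    have hc' : ProperEdge ends F (Function.update c d a) := by
      have key : ∀ g ∈ F, ∀ v, v ∈ ends d → v ∈ ends g → c g ≠ a := by
        intro g hg v hv hvg
        rw [hle, Sym2.mem_iff] at hv
        rcases hv with rfl | rfl
        exacts [hax g hg hvg, hay g hg hvg]
      intro f hf g hg v hvf hvg hfg
      by_cases h1 : f = d <;> by_cases h2 : g = d <;> simp only [h1, h2, Function.update_self,
        Function.update_of_ne, ne_eq, not_false_eq_true] at hfg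
      · exact h1.trans h2.symm
      · exact absurd hfg.symm (key g hg v (h1 ▸ hvf) hvg)
      · exact absurd hfg (key f hf v (h2 ▸ hvg) hvf)
      · exact hc f hf g hg v hvf hvg hfg
    have hca : c d ≠ a := hax d hlF (by simp [hle])
    have hmiss : ∀ v, v ∉ ends d → ∀ b, MissingAt ends F c v b →
        MissingAt ends F (Function.update c d a) v b := by
      intro v hv b hb g hg hvg
      rw [Function.update_of_ne (fun h => hv (by rwa [h] at hvg))]
      exact hb g hg hvg
    have hyd : ∀ i ≤ l, y i ∉ ends d := by
      intro i hi h'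
      rw [hle, Sym2.mem_iff] at h'
      rcases h' with h' | h'
      · exact hx i (by omega) h'
      · have := h.inj i (by omega) _ le_rfl h'
        omega
    refine ih (c := Function.update c d a) hc' ?_ (fun i hi => hx i (by omega)) ?_
      (a := c d) (hU d hlF) ?_ (hmiss _ (hyd l le_rfl) _ hlm)
    · intro f hf
      by_cases h1 : f = d
      · simpa [h1] using haU
      · simpa [h1] using hU f hf
    · refine ⟨(h.take (Nat.le_succ l)).inj, fun i hi => h.mem i (by omega),
        fun i hi => h.ends_eq i (by omega), fun i hi => ?_⟩
      rw [Function.update_of_ne (hne i hi)]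
      exact hmiss _ (hyd i hi.le) _ (h.missing i (by omega))
    · intro g hg hvg
      by_cases h1 : g = d
      · simpa [h1] using hca.symm
      · rw [Function.update_of_ne h1]
        exact fun h2 => h1 (hc g hg d hlF x hvg (by simp [hle]) h2)

/-- The graph formed by the edges of colours `a` and `b`. -/
def twoColourGraph (ends : E → Sym2 V) (F : Finset E) (c : E → α) (a b : α) : SimpleGraph V :=
  fromEdgeSet {z | ∃ e ∈ F, ends e = z ∧ (c e = a ∨ c e = b)}

/-- Exchanging `a` and `b` on the component of `y l` makes `b` missing there while it stays missing
at `x`. The fan survives: its edges at `x` keep their colours, none of which is `b`, and an end that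
misses `a` because of the fan condition lies outside the component. Then the shift applies with `b`.
-/
theorem FanPath.exists_colouring_of_swap {U : Finset α} {x : V} {y : ℕ → V} {e : ℕ → E} {l : ℕ}
    {e₀ : E} (hends : ends e₀ = s(x, y 0))
    (hc : ProperEdge ends F c) (hU : ∀ e ∈ F, c e ∈ U) (hx : ∀ i ≤ l, y i ≠ x)
    (h : FanPath ends F c x y e l) {a b : α} (haU : a ∈ U) (hbU : b ∈ U)
    (hbx : MissingAt ends F c x b) (hay : MissingAt ends F c (y l) a)
    (hnr : ¬ (twoColourGraph ends F c a b).Reachable (y l) x)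
    (hi : ∀ i < l, MissingAt ends F c (y i) a →
      ¬ (twoColourGraph ends F c a b).Reachable (y l) (y i)) :
    ∃ c' : E → α, ProperEdge ends (insert e₀ F) c' ∧ ∀ e ∈ insert e₀ F, c' e ∈ U := by
  set K := twoColourGraph ends F c a b with hK
  let R : V → Prop := fun v => K.Reachable (y l) v
  let c' : E → α := fun e => if ∃ v ∈ ends e, R v then Equiv.swap a b (c e) else c e
  have hR : ∀ e ∈ F, ∀ v, v ∈ ends e → R v → c' e = Equiv.swap a b (c e) := fun e _ v hv hr => by
    simp only [c']
    rw [if_pos ⟨v, hv, hr⟩]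
  have hN : ∀ e ∈ F, ∀ v, v ∈ ends e → ¬ R v → c' e = c e := by
    intro e he v hv hr
    by_cases h1 : ∃ w ∈ ends e, R w
    · obtain ⟨w, hw, hrw⟩ := h1
      rw [hR e he w hw hrw]
      have hwv : w ≠ v := fun h => hr (h ▸ hrw)
      have h2 : ¬ (c e = a ∨ c e = b) := by
        intro h3
        refine hr (hrw.trans (Adj.reachable ?_))
        rw [hK, twoColourGraph, fromEdgeSet_adj]
        exact ⟨⟨e, he, (Sym2.mem_and_mem_iff hwv).1 ⟨hw, hv⟩, h3⟩, hwv⟩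
      rw [not_or] at h2
      exact Equiv.swap_apply_of_ne_of_ne h2.1 h2.2
    · simp only [c']
      rw [if_neg h1]
  have hprop : ProperEdge ends F c' := by
    intro f hf g hg v hvf hvg hfg
    by_cases h1 : R v
    · rw [hR f hf v hvf h1, hR g hg v hvg h1] at hfg
      exact hc f hf g hg v hvf hvg ((Equiv.swap a b).injective hfg)
    · rw [hN f hf v hvf h1, hN g hg v hvg h1] at hfg
      exact hc f hf g hg v hvf hvg hfg
  have hsU : ∀ d ∈ U, Equiv.swap a b d ∈ U := by
    intro d hd
    rw [Equiv.swap_apply_def]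
    split_ifs <;> assumption
  have hxends : ∀ i < l, x ∈ ends (e (i + 1)) := fun i hi => by simp [h.ends_eq i hi]
  refine FanPath.exists_colouring (c := c') (y := y) (e := e) (l := l) (a := b) hends hprop ?_ hx
    ⟨h.inj, h.mem, h.ends_eq, ?_⟩ hbU ?_ ?_
  · intro f hf
    simp only [c']
    split_ifs
    exacts [hsU _ (hU f hf), hU f hf]
  · intro i hil g hg hvg
    rw [hN _ (h.mem i hil) x (hxends i hil) hnr]
    by_cases h1 : R (y i)
    · rw [hR g hg _ hvg h1]
      have h2 : c (e (i + 1)) ≠ b := hbx _ (h.mem i hil) (hxends i hil)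
      have h3 : c (e (i + 1)) ≠ a := fun h' => hi i hil (h' ▸ h.missing i hil) h1
      intro h4
      apply h.missing i hil g hg hvg
      apply (Equiv.swap a b).injective
      rw [h4, Equiv.swap_apply_of_ne_of_ne h3 h2]
    · rw [hN g hg _ hvg h1]
      exact h.missing i hil g hg hvg
  · intro g hg hvg
    rw [hN g hg x hvg hnr]
    exact hbx g hg hvg
  · intro g hg hvg
    rw [hR g hg _ hvg Reachable.rfl]
    intro h4
    apply hay g hg hvg
    apply (Equiv.swap a b).injective
    rw [h4, Equiv.swap_apply_left]

/-- **Vizing's theorem** for multigraphs. -/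
theorem exists_properEdge [Finite V] [Nonempty α] (ends : E → Sym2 V) (F : Finset E)
    (hnd : ∀ e ∈ F, ¬ (ends e).IsDiag) (U : Finset α) {Δ μ : ℕ}
    (hΔ : ∀ v, #(F.filter fun e => v ∈ ends e) ≤ Δ)
    (hμ : ∀ z, #(F.filter fun e => ends e = z) ≤ μ) (hU : Δ + μ ≤ #U) :
    ∃ c : E → α, ProperEdge ends F c ∧ ∀ e ∈ F, c e ∈ U := by
  have := Fintype.ofFinite V
  induction F using Finset.induction_on with
  | empty => exact ⟨fun _ => Classical.arbitrary α, by simp [ProperEdge], by simp⟩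
  | insert e₀ F he₀ ih =>
    have hmono : ∀ (p : E → Prop) [DecidablePred p], #(F.filter p) ≤ #((insert e₀ F).filter p) := fun p _ =>
      card_le_card (filter_subset_filter _ (subset_insert _ _))
    have hins : ∀ (p : E → Prop) [DecidablePred p], p e₀ → #(F.filter p) + 1 = #((insert e₀ F).filter p) := by
      intro p _ hp
      rw [filter_insert, if_pos hp, card_insert_of_notMem]
      simp [he₀]
    obtain ⟨c, hc, hcU⟩ := ih (fun e he => hnd e (mem_insert_of_mem he))
      (fun v => (hmono _).trans (hΔ v)) (fun z => (hmono _).trans (hμ z))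
    by_contra hcon
    obtain ⟨x, y₀, hxy₀⟩ : ∃ x y₀, ends e₀ = s(x, y₀) :=
      ⟨_, _, (Quot.out_eq (ends e₀)).symm⟩
    have hne₀ : x ≠ y₀ := fun h => hnd e₀ (mem_insert_self _ _) (by simp [hxy₀, h])
    let M : V → Finset α := fun v => U.filter fun a => MissingAt ends F c v a
    have hM : ∀ v, #U ≤ #(M v) + #(F.filter fun e => v ∈ ends e) := by
      intro v
      have h1 : U ⊆ M v ∪ (F.filter fun e => v ∈ ends e).image c := by
        intro a ha
        rw [mem_union]
        by_cases h2 : MissingAt ends F c v a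
        · exact Or.inl (mem_filter.2 ⟨ha, h2⟩)
        · right
          unfold MissingAt at h2
          push Not at h2
          obtain ⟨e, he, hv, hea⟩ := h2
          exact mem_image.2 ⟨e, mem_filter.2 ⟨he, hv⟩, hea⟩
      exact (card_le_card h1).trans ((card_union_le _ _).trans (Nat.add_le_add_left card_image_le _))
    have hMμ : ∀ v, μ ≤ #(M v) := fun v => by
      have := hM v
      have := (hmono fun e => v ∈ ends e).trans (hΔ v)
      omega
    have hMx : 0 < #(M x) := by
      have := hM x
      have h1 := hins (fun e => x ∈ ends e) (by simp [hxy₀])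
      have := hΔ x
      omega
    obtain ⟨b, hb⟩ := card_pos.1 hMx
    obtain ⟨hbU, hbx⟩ := mem_filter.1 hb
    let Fan : (ℕ → V) → (ℕ → E) → ℕ → Prop := fun y e l => y 0 = y₀ ∧ FanPath ends F c x y e l
    have hFx : ∀ y e l, Fan y e l → ∀ i ≤ l, y i ≠ x := by
      intro y e l h i hi
      cases i with
      | zero => rw [h.1]; exact hne₀.symm
      | succ i =>
        intro h1
        refine hnd (e (i + 1)) (mem_insert_of_mem (h.2.mem i hi)) ?_
        rw [h.2.ends_eq i hi, h1]
        simp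
    -- a colour missing at `x` is present at all ends of fans
    have claim1 : ∀ y e l, Fan y e l → ∀ a ∈ U, MissingAt ends F c (y l) a →
        ¬ MissingAt ends F c x a := by
      intro y e l h a ha hay hax
      exact hcon (FanPath.exists_colouring (by rw [hxy₀, h.1]) hc hcU (hFx y e l h) h.2 ha hax hay)
    -- no colour is missing at two ends of fans
    have claim2 : ∀ y e l, Fan y e l → ∀ y' e' l', Fan y' e' l' → ∀ a ∈ U,
        MissingAt ends F c (y l) a → MissingAt ends F c (y' l') a → y l = y' l' := by
      intro y e l h y' e' l' h' a haU hay hay'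
      by_contra hne
      set K := twoColourGraph ends F c a b with hK
      have hadj : ∀ v w, K.Adj v w → ∃ f ∈ F, ends f = s(v, w) ∧ (c f = a ∨ c f = b) := by
        intro v w hvw
        rw [hK, twoColourGraph, fromEdgeSet_adj] at hvw
        exact hvw.1
      have hK2 : ∀ v p q r, K.Adj v p → K.Adj v q → K.Adj v r → p = q ∨ p = r ∨ q = r := by
        intro v p q r hp hq hr
        obtain ⟨f, hf, hfe, hfc⟩ := hadj _ _ hp
        obtain ⟨g, hg, hge, hgc⟩ := hadj _ _ hq
        obtain ⟨k, hk, hke, hkc⟩ := hadj _ _ hr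
        have e1 : c f = c g → p = q := fun h => by
          have := hc f hf g hg v (by simp [hfe]) (by simp [hge]) h
          rw [this, hge] at hfe
          exact (Sym2.congr_right.1 hfe).symm
        have e2 : c f = c k → p = r := fun h => by
          have := hc f hf k hk v (by simp [hfe]) (by simp [hke]) h
          rw [this, hke] at hfe
          exact (Sym2.congr_right.1 hfe).symm
        have e3 : c g = c k → q = r := fun h => by
          have := hc g hg k hk v (by simp [hge]) (by simp [hke]) h
          rw [this, hke] at hge
          exact (Sym2.congr_right.1 hge).symm
        rcases hfc with h1 | h1 <;> rcases hgc with h2 | h2 <;> rcases hkc with h3 | h3 <;>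
          rw [h1] at e1 e2 <;> rw [h2] at e1 e3 <;> rw [h3] at e2 e3 <;> tauto
      have hK1 : ∀ v, (MissingAt ends F c v a ∨ MissingAt ends F c v b) →
          ∀ p q, K.Adj v p → K.Adj v q → p = q := by
        intro v hv p q hp hq
        obtain ⟨f, hf, hfe, hfc⟩ := hadj _ _ hp
        obtain ⟨g, hg, hge, hgc⟩ := hadj _ _ hq
        have hvf : v ∈ ends f := by simp [hfe]
        have hvg : v ∈ ends g := by simp [hge]
        have e1 : c f = c g := by
          rcases hv with hv | hv
          · rw [hfc.resolve_left (hv f hf hvf), hgc.resolve_left (hv g hg hvg)]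
          · rw [hfc.resolve_right (hv f hf hvf), hgc.resolve_right (hv g hg hvg)]
        have := hc f hf g hg v hvf hvg e1
        rw [this, hge] at hfe
        exact (Sym2.congr_right.1 hfe).symm
      have hswap : ∀ y e l, Fan y e l → MissingAt ends F c (y l) a → ¬ K.Reachable (y l) x →
          (∀ i < l, MissingAt ends F c (y i) a → ¬ K.Reachable (y l) (y i)) → False := by
        intro y e l h hay hr hi
        exact hcon (FanPath.exists_colouring_of_swap (by rw [hxy₀, h.1]) hc hcU (hFx y e l h) h.2
          haU hbU hbx hay hr hi)
      -- A shortest fan whose end misses `a` meets no earlier vertex missing `a`, so its end lies in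
      -- the component of `x`. For a shortest fan ending at a different such vertex, the only
      -- earlier vertex missing `a` can be `z n`. Its end is not in the component of `x`, which
      -- already has the ends `x` and `z n`, and a swap is possible.
      have hex : ∃ n, ∃ z d, Fan z d n ∧ MissingAt ends F c (z n) a := ⟨l, y, e, h, hay⟩
      obtain ⟨z, d, hz, hza⟩ := Nat.find_spec hex
      set n := Nat.find hex with hn
      have hzx : K.Reachable (z n) x := by
        by_contra hr
        refine hswap z d n hz hza hr fun i hi hia => ?_
        exact absurd ⟨z, d, ⟨hz.1, hz.2.take hi.le⟩, hia⟩ (Nat.find_min hex hi)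
      have hex' : ∃ m, ∃ z' d', Fan z' d' m ∧ MissingAt ends F c (z' m) a ∧ z' m ≠ z n := by
        by_cases h1 : y l = z n
        · exact ⟨l', y', e', h', hay', fun h2 => hne (h1.trans h2.symm)⟩
        · exact ⟨l, y, e, h, hay, h1⟩
      obtain ⟨z', d', hz', hza', hzz'⟩ := Nat.find_spec hex'
      set m := Nat.find hex' with hm
      have hzx' : ¬ K.Reachable (z' m) x := by
        intro hr
        exact hzz' (eq_of_reachable_of_degree_le hK2 (hK1 x (Or.inr hbx)) (hK1 _ (Or.inl hza'))
          (hK1 _ (Or.inl hza)) (hFx z' d' m hz' m le_rfl).symm (hFx z d n hz n le_rfl).symm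
          hr.symm hzx.symm)
      refine hswap z' d' m hz' hza' hzx' fun i hi hia hr => ?_
      by_cases h1 : z' i = z n
      · rw [h1] at hr
        exact hzx' (hr.trans hzx)
      · exact absurd ⟨z', d', ⟨hz'.1, hz'.2.take hi.le⟩, hia, h1⟩ (Nat.find_min hex' hi)
    -- Over all fan ends, the sets of missing colours are disjoint, and each of these colours occurs
    -- on an edge from `x` to a fan end. Counting these edges gives fewer than `μ * #Y` colours,
    -- because `e₀` is not coloured, whereas each end misses at least `μ`.
    let Y : Finset V := univ.filter fun v => ∃ y e l, Fan y e l ∧ y l = v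
    have hY : ∀ v, v ∈ Y ↔ ∃ y e l, Fan y e l ∧ y l = v := fun v => by simp [Y]
    have hy₀ : y₀ ∈ Y := (hY _).2 ⟨fun _ => y₀, fun _ => e₀, 0, ⟨rfl, ⟨fun i hi j hj _ => by omega,
      fun i hi => by omega, fun i hi => by omega, fun i hi => by omega⟩⟩, rfl⟩
    have hclosed : ∀ v ∈ Y, ∀ a ∈ M v, ∃ f ∈ F, c f = a ∧ ∃ w ∈ Y, ends f = s(x, w) := by
      intro v hv a ha
      obtain ⟨y, e, l, hF, rfl⟩ := (hY v).1 hv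
      obtain ⟨haU, hay⟩ := mem_filter.1 ha
      have h1 := claim1 y e l hF a haU hay
      unfold MissingAt at h1
      push Not at h1
      obtain ⟨f, hf, hxf, hfa⟩ := h1
      refine ⟨f, hf, hfa, ?_⟩
      obtain ⟨w, hw⟩ := hxf
      refine ⟨w, (hY w).2 ?_, hw⟩
      by_cases h2 : ∃ i ≤ l, y i = w
      · obtain ⟨i, hi, hiw⟩ := h2
        exact ⟨y, e, i, ⟨hF.1, hF.2.take hi⟩, hiw⟩
      push Not at h2
      have hys : ∀ i ≤ l, Function.update y (l + 1) w i = y i := fun i hi =>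
        Function.update_of_ne (by omega) _ _
      refine ⟨Function.update y (l + 1) w, Function.update e (l + 1) f, l + 1, ⟨?_, ?_, ?_, ?_, ?_⟩,
        by simp⟩
      · rw [hys 0 (by omega)]; exact hF.1
      · intro i hi j hj hij
        rcases hi.eq_or_lt with rfl | hi' <;> rcases hj.eq_or_lt with rfl | hj'
        · rfl
        · rw [hys j (by omega), Function.update_self] at hij
          exact absurd hij.symm (h2 j (by omega))
        · rw [hys i (by omega), Function.update_self] at hij
          exact absurd hij (h2 i (by omega))
        · rw [hys i (by omega), hys j (by omega)] at hij
          exact hF.2.inj i (by omega) j (by omega) hij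
      · intro i hi
        rcases (Nat.lt_succ_iff.1 hi).eq_or_lt with rfl | hi'
        · simpa using hf
        · rw [Function.update_of_ne (by omega)]
          exact hF.2.mem i hi'
      · intro i hi
        rcases (Nat.lt_succ_iff.1 hi).eq_or_lt with rfl | hi'
        · simpa using hw
        · rw [Function.update_of_ne (by omega), hys _ (by omega)]
          exact hF.2.ends_eq i hi'
      · intro i hi
        rw [hys i (by omega)]
        rcases (Nat.lt_succ_iff.1 hi).eq_or_lt with rfl | hi'
        · simpa [hfa] using hay
        · rw [Function.update_of_ne (by omega)]
          exact hF.2.missing i hi'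
    have h1 : ∑ v ∈ Y, #(M v) = #(Y.biUnion M) := by
      rw [card_biUnion]
      intro v hv w hw hvw
      obtain ⟨y, e, l, hF, rfl⟩ := (hY v).1 hv
      obtain ⟨y', e', l', hF', rfl⟩ := (hY w).1 hw
      change Disjoint _ _
      rw [Finset.disjoint_left]
      intro a ha ha'
      exact hvw (claim2 y e l hF y' e' l' hF' a (mem_filter.1 ha).1 (mem_filter.1 ha).2
        (mem_filter.1 ha').2)
    have h2 : Y.biUnion M ⊆ (Y.biUnion fun w => F.filter fun e => ends e = s(x, w)).image c := by
      intro a ha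
      obtain ⟨v, hv, hav⟩ := mem_biUnion.1 ha
      obtain ⟨f, hf, hfa, w, hw, hfw⟩ := hclosed v hv a hav
      exact mem_image.2 ⟨f, mem_biUnion.2 ⟨w, hw, mem_filter.2 ⟨hf, hfw⟩⟩, hfa⟩
    have h3 : ∑ v ∈ Y, #(M v) ≤ ∑ w ∈ Y, #(F.filter fun e => ends e = s(x, w)) := by
      rw [h1]
      exact (card_le_card h2).trans (card_image_le.trans card_biUnion_le)
    have h4 : ∑ w ∈ Y, #(F.filter fun e => ends e = s(x, w)) < ∑ w ∈ Y, μ := by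
      refine sum_lt_sum (fun w _ => (hmono _).trans (hμ _)) ⟨y₀, hy₀, ?_⟩
      have h5 := hins (fun e => ends e = s(x, y₀)) hxy₀
      have h6 := hμ s(x, y₀)
      omega
    have h5 : ∑ w ∈ Y, μ ≤ ∑ v ∈ Y, #(M v) := sum_le_sum fun v _ => hMμ v
    omega

end EdgeColouring

/-! ### Excess, codegree and removal of tight parts -/

/-- The number of vertices of `X` minus its chromatic number. -/
noncomputable def excess (G : SimpleGraph V) (X : Finset V) : ℕ := #X - G.chi X

theorem chi_add_excess : G.chi X + G.excess X = #X := Nat.add_sub_cancel' chi_le_card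

theorem Joined.excess_union (h : G.Joined X Y) : G.excess (X ∪ Y) = G.excess X + G.excess Y := by
  have h1 := G.chi_add_excess (X := X)
  have h2 := G.chi_add_excess (X := Y)
  have h3 := G.chi_add_excess (X := X ∪ Y)
  rw [card_union_of_disjoint h.disjoint, h.chi_union] at h3
  omega

/-- The number of vertices of `X` other than `v` that are not adjacent to `v`. -/
noncomputable def codeg (G : SimpleGraph V) (X : Finset V) (v : V) : ℕ :=
  #(X.filter fun w => w ≠ v ∧ ¬ G.Adj v w)

theorem codeg_mono (h : X ⊆ Y) (v : V) : G.codeg X v ≤ G.codeg Y v :=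
  card_le_card (filter_subset_filter _ h)

theorem codeg_add_degree {v : V} (hv : v ∈ X) : G.codeg X v + #(X.filter (G.Adj v)) + 1 = #X := by
  have h1 : (X.filter fun w => w ≠ v ∧ ¬ G.Adj v w) ∪ X.filter (G.Adj v) = X.erase v := by
    ext w
    simp only [mem_union, mem_filter, mem_erase]
    have : G.Adj v w → w ≠ v := fun h => h.ne'
    tauto
  have h2 : Disjoint (X.filter fun w => w ≠ v ∧ ¬ G.Adj v w) (X.filter (G.Adj v)) := by
    rw [Finset.disjoint_left]
    intro w h h'
    exact (mem_filter.1 h).2.2 (mem_filter.1 h').2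
  have h3 := card_union_of_disjoint h2
  rw [h1] at h3
  have h4 := card_erase_add_one hv
  unfold codeg
  omega

theorem codeg_part {v : V} (hv : v ∈ X) : G.codeg (G.part X v) v = G.codeg X v := by
  unfold codeg
  congr 1
  ext w
  simp only [mem_filter]
  constructor
  · exact fun h => ⟨part_subset v h.1, h.2⟩
  · refine fun h => ⟨?_, h.2⟩
    rw [← part_eq_of_not_adj hv h.1 h.2.2]
    exact self_mem_part h.1

theorem CriticalOn.chi_le_degree (hX : G.CriticalOn X) {v : V} (hv : v ∈ X) :
    G.chi X ≤ #(X.filter (G.Adj v)) + 1 := by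
  by_contra hlt
  obtain ⟨f, hf, hfc, -⟩ := G.exists_chi (X.erase v)
  have hc := hX.chi_erase hv
  have h1 : ∃ c ∈ (X.erase v).image f, c ∉ (X.filter (G.Adj v)).image f := by
    by_contra h
    push Not at h
    have := card_le_card (show (X.erase v).image f ⊆ _ from h)
    have := card_image_le (s := X.filter (G.Adj v)) (f := f)
    omega
  obtain ⟨c, hc1, hc2⟩ := h1
  have h2 : ∀ y ∈ X, G.Adj v y → f y ≠ c := fun y hy hvy h =>
    hc2 (mem_image.2 ⟨y, mem_filter.2 ⟨hy, hvy⟩, h⟩)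
  have h3 : G.ProperOn X (fun x => if x = v then c else f x) := by
    intro x hx y hy hxy
    by_cases hxv : x = v <;> by_cases hyv : y = v <;> simp only [hxv, hyv, if_true, if_false]
    · exact absurd (hxv.trans hyv.symm) hxy.ne
    · exact (h2 y hy (hxv ▸ hxy)).symm
    · exact h2 x hx (hyv ▸ hxy.symm)
    · exact hf x (mem_erase.2 ⟨hxv, hx⟩) y (mem_erase.2 ⟨hyv, hy⟩) hxy
  have h4 : X.image (fun x => if x = v then c else f x) ⊆ (X.erase v).image f := by
    intro d hd
    obtain ⟨x, hx, rfl⟩ := mem_image.1 hd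
    by_cases hxv : x = v
    · simpa [hxv] using hc1
    · simp only [hxv, if_false]
      exact mem_image_of_mem _ (mem_erase.2 ⟨hxv, hx⟩)
  have h5 := h3.chi_le.trans (card_le_card h4)
  omega

/-- Gallai's bound suffices for chromatic number at least three. Chromatic number one is excluded
since a critical set would be a single vertex. For chromatic number two Gallai's bound gives a third
vertex, but its removal leaves an edge. -/
theorem CriticalOn.five_mul_chi_le (hX : G.CriticalOn X) (hco : G.CoconnectedOn X)
    (h2 : 2 ≤ #X) : 5 * G.chi X ≤ 3 * #X := by
  have hne : X.Nonempty := card_pos.1 (by omega)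
  have h1 := hX.two_mul_chi_le hco hne
  have h0 := G.chi_pos hne
  by_cases h3 : 3 ≤ G.chi X
  · omega
  obtain ⟨x, hx⟩ := hne
  have h4 : G.chi X ≠ 1 := by
    intro h
    have h5 := hX x hx
    have h6 : (X.erase x).Nonempty := card_pos.1 (by rw [card_erase_of_mem hx]; omega)
    have := G.chi_pos h6
    omega
  have h5 := hX.chi_le_degree hx
  obtain ⟨y, hy⟩ : (X.filter (G.Adj x)).Nonempty := card_pos.1 (by omega)
  rw [mem_filter] at hy
  have h6 : ∃ z ∈ X, z ≠ x ∧ z ≠ y := by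
    have h7 : 0 < #((X.erase x).erase y) := by
      rw [card_erase_of_mem (mem_erase.2 ⟨hy.2.ne', hy.1⟩), card_erase_of_mem hx]
      omega
    obtain ⟨z, hz⟩ := card_pos.1 h7
    simp only [mem_erase] at hz
    exact ⟨z, hz.2.2, hz.2.1, hz.1⟩
  obtain ⟨z, hz, hzx, hzy⟩ := h6
  have h7 := hX z hz
  have h8 : G.chi {x} + G.chi {y} ≤ G.chi (X.erase z) := by
    have hj : G.Joined {x} {y} := by simpa [Joined] using hy.2
    rw [← hj.chi_union]
    refine chi_mono ?_
    intro w hw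
    rw [mem_union, mem_singleton, mem_singleton] at hw
    rcases hw with rfl | rfl
    exacts [mem_erase.2 ⟨hzx.symm, hx⟩, mem_erase.2 ⟨hzy.symm, hy.1⟩]
  rw [chi_singleton, chi_singleton] at h8
  omega

/-- Each vertex of `X` that has a non-neighbour has fewer non-neighbours than the excess of its
part. -/
def SlackOn (G : SimpleGraph V) (X : Finset V) : Prop :=
  ∀ v ∈ X, G.codeg X v = 0 ∨ G.codeg X v + 1 ≤ G.excess (G.part X v)

/-- A vertex violating slackness has degree `χ(C) - 1` in its part `C`, so `C` is linked by Kempe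
chains and can be joined to a linkage of the rest. Such a part is not a single vertex, hence `5χ(C)
≤ 3|C|`, and `Q` must survive the removal of parts of this kind. -/
theorem CriticalOn.linked_of_slack (Q : ℕ → ℕ → Prop)
    (hQ : ∀ n k n' k', Q (n' + n) (k' + k) → 5 * k' ≤ 3 * n' → Q n k)
    (h : ∀ X, G.CriticalOn X → Q #X (G.chi X) → G.SlackOn X → G.Linked X (G.chi X))
    (hX : G.CriticalOn X) (hXQ : Q #X (G.chi X)) : G.Linked X (G.chi X) := by
  induction X using Finset.strongInduction with
  | H X ih =>
  by_cases hs : G.SlackOn X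
  · exact h X hX hXQ hs
  unfold SlackOn at hs
  push Not at hs
  obtain ⟨v, hv, hv0, hvs⟩ := hs
  rw [← codeg_part hv] at hv0 hvs
  set C := G.part X v with hC
  have hvC : v ∈ C := self_mem_part hv
  have hCcrit : G.CriticalOn C := hX.part v
  have hCX : C ⊆ X := part_subset v
  have h1 := codeg_add_degree (G := G) hvC
  have h2 := hCcrit.chi_le_degree hvC
  have h3 := G.chi_add_excess (X := C)
  have hj := G.joined_part (X := X) v
  rw [← hC] at hj
  have hXC : C ∪ X \ C = X := union_sdiff_of_subset hCX
  have h4 := hj.chi_union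
  have h5 := card_union_of_disjoint hj.disjoint
  rw [hXC] at h4 h5
  have h6 := hCcrit.linked_of_tight hvC (by omega)
  have h7 := h6.union (ih (X \ C) (sdiff_ssubset hCX ⟨v, hvC⟩) (CriticalOn.right (by rwa [hXC]) hj)
    (hQ _ _ _ _ (h5 ▸ h4 ▸ hXQ) (hCcrit.five_mul_chi_le (coconnectedOn_part v) (by omega)))) hj
  rwa [hXC, ← h4] at h7

/-! ### Hubs -/

/-- The pairs of a set can be routed directly or through a hub joined to it. -/
theorem Routes.of_hub [Finite V] (hj : G.Joined X Y)
    (hd : ∀ v ∈ X, G.codeg X v = 0 ∨ G.codeg X v + 1 ≤ #Y) :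
    G.Routes (pairs X ∪ across X Y) (pairs X) := by
  have hXY := Finset.disjoint_left.1 hj.disjoint
  let F : Finset (Sym2 V) := X.sym2.filter fun e => ¬ e.IsDiag ∧ e ∉ G.edgeSet
  have hF : ∀ x y, s(x, y) ∈ F ↔ (x ∈ X ∧ y ∈ X) ∧ x ≠ y ∧ ¬ G.Adj x y := by
    intro x y
    simp [F]
  have hcd : ∀ v, #(F.filter fun e => v ∈ e) ≤ if v ∈ X then G.codeg X v else 0 := by
    intro v
    split_ifs with hv
    · have h1 : (F.filter fun e => v ∈ e) ⊆
          (X.filter fun w => w ≠ v ∧ ¬ G.Adj v w).image fun w => s(v, w) := by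
        intro e he
        rw [mem_filter] at he
        obtain ⟨he, w, rfl⟩ := he
        rw [hF] at he
        exact mem_image.2 ⟨w, mem_filter.2 ⟨he.1.2, he.2.1.symm, he.2.2⟩, rfl⟩
      exact (card_le_card h1).trans card_image_le
    · rw [Nat.le_zero, card_eq_zero, filter_eq_empty_iff]
      rintro e he ⟨w, rfl⟩
      exact hv ((hF _ _).1 he).1.1
  have hcol : ∃ c : Sym2 V → V, ProperEdge id F c ∧ ∀ e ∈ F, c e ∈ Y := by
    rcases F.eq_empty_or_nonempty with h0 | ⟨e, he⟩
    · rcases isEmpty_or_nonempty V with hV | hV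
      · exact ⟨fun e => (Quot.out e).1, by simp [ProperEdge, h0], by simp [h0]⟩
      · exact ⟨fun _ => Classical.arbitrary V, by simp [ProperEdge, h0], by simp [h0]⟩
    · induction e with | _ a b
      have : Nonempty V := ⟨a⟩
      have hY : 0 < #Y := by
        rw [hF] at he
        have h1 : 0 < G.codeg X a := card_pos.2 ⟨b, mem_filter.2 ⟨he.1.2, he.2.1.symm, he.2.2⟩⟩
        rcases hd a he.1.1 with h | h <;> omega
      -- The non-adjacent pairs form a simple graph of maximum degree at most `#Y - 1`, so Vizing's
      -- `Δ + 1` colours are available.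
      refine exists_properEdge id F ?_ Y (Δ := #Y - 1) (μ := 1) ?_ ?_ (by omega)
      · exact fun e he => (mem_filter.1 he).2.1
      · intro v
        refine (hcd v).trans ?_
        split_ifs with hv
        · rcases hd v hv with h | h <;> omega
        · omega
      · intro z
        rw [card_le_one]
        intro a ha b hb
        exact (mem_filter.1 ha).2.trans (mem_filter.1 hb).2.symm
  obtain ⟨c, hc, hcY⟩ := hcol
  -- A non-adjacent pair goes through the hub vertex that is its colour. Properness of the colouring
  -- says that no edge to the hub is used twice.
  refine ⟨fun e => if e ∈ G.edgeSet then {e} else {d | ∃ v ∈ e, d = s(v, c e)}, ?_, ?_⟩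
  · intro x y hxy
    by_cases hadj : s(x, y) ∈ G.edgeSet
    · beta_reduce
      rw [if_pos hadj]
      refine ⟨?_, Adj.reachable ?_⟩
      · rintro _ rfl
        exact ⟨Or.inl hxy, hadj⟩
      · rw [fromEdgeSet_adj]
        exact ⟨rfl, (mk_mem_pairs.1 hxy).1⟩
    · beta_reduce
      rw [if_neg hadj]
      rw [mk_mem_pairs] at hxy
      obtain ⟨hne, hx, hy⟩ := hxy
      have hu := hcY s(x, y) ((hF x y).2 ⟨⟨hx, hy⟩, hne, hadj⟩)
      constructor
      · rintro d ⟨v, hv, rfl⟩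
        have hvX : v ∈ X := by
          rw [Sym2.mem_iff] at hv
          rcases hv with rfl | rfl
          exacts [hx, hy]
        exact ⟨Or.inr (mk_mem_across.2 (Or.inl ⟨hvX, hu⟩)), hj v hvX _ hu⟩
      · have h1 : ∀ v ∈ s(x, y), v ∈ X →
            (fromEdgeSet {d | ∃ v ∈ s(x, y), d = s(v, c s(x, y))}).Adj v (c s(x, y)) := by
          intro v hv hvX
          rw [fromEdgeSet_adj]
          exact ⟨⟨v, hv, rfl⟩, fun h => hXY hvX (h ▸ hu)⟩
        exact (h1 x (by simp) hx).reachable.trans (h1 y (by simp) hy).symm.reachable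
  · intro e he e' he' hne
    change Disjoint (if e ∈ G.edgeSet then {e} else {d | ∃ v ∈ e, d = s(v, c e)})
      (if e' ∈ G.edgeSet then {e'} else {d | ∃ v ∈ e', d = s(v, c e')})
    have hFe : ∀ e ∈ pairs X, e ∉ G.edgeSet → e ∈ F := by
      intro e he he'
      exact mem_filter.2 ⟨by rw [mem_sym2_iff]; exact he.2, he.1, he'⟩
    rw [Set.disjoint_left]
    intro d hd hd'
    by_cases h : e ∈ G.edgeSet <;> by_cases h' : e' ∈ G.edgeSet <;>
      simp only [h, h', if_true, if_false, Set.mem_singleton_iff, Set.mem_ofPred_eq] at hd hd'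
    · exact hne (hd.symm.trans hd')
    · obtain ⟨v, hv, hd'⟩ := hd'
      refine hXY (he.2 (c e') ?_) (hcY e' (hFe e' he' h'))
      rw [← hd, hd']
      simp
    · obtain ⟨v, hv, hd⟩ := hd
      refine hXY (he'.2 (c e) ?_) (hcY e (hFe e he h))
      rw [← hd', hd]
      simp
    · obtain ⟨v, hv, rfl⟩ := hd
      obtain ⟨w, hw, hd⟩ := hd'
      have h1 := hFe e he h
      have h2 := hFe e' he' h'
      rcases Sym2.eq_iff.1 hd with ⟨h3, h4⟩ | ⟨h3, h4⟩
      · subst h3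
        exact hne (hc e h1 e' h2 v hv hw h4)
      · exact hXY (he.2 v hv) (h3 ▸ hcY e' h2)

theorem disjoint_across {X' Y' : Finset V} (h : Disjoint X X') (h' : Disjoint X Y') :
    Disjoint (across X Y) (across X' Y') := by
  rw [Set.disjoint_left]
  rintro _ ⟨x, hx, y, hy, rfl⟩ h1
  rw [mk_mem_across] at h1
  rcases h1 with h1 | h1
  · exact Finset.disjoint_left.1 h hx h1.1
  · exact Finset.disjoint_left.1 h' hx h1.2

/-- Each of two joined sets provides a hub for the rest of the other. -/
theorem linked_of_hubs [Finite V] (hj : G.Joined X Y) {a b : ℕ}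
    (hX : ∀ v ∈ X, G.codeg X v = 0 ∨ G.codeg X v + 1 ≤ a)
    (hY : ∀ v ∈ Y, G.codeg Y v = 0 ∨ G.codeg Y v + 1 ≤ b) (hbX : b ≤ #X) (haY : a ≤ #Y) :
    G.Linked (X ∪ Y) ((#X - b) + (#Y - a)) := by
  -- `M` is the hub for `Y` and `N` the hub for `X`; neither contains branch vertices.
  obtain ⟨M, hMX, hM⟩ := exists_subset_card_eq hbX
  obtain ⟨N, hNY, hN⟩ := exists_subset_card_eq haY
  have hdX : X \ M ⊆ X := sdiff_subset
  have hdY : Y \ N ⊆ Y := sdiff_subset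
  have hXY := hj.disjoint
  refine ⟨X \ M ∪ Y \ N, union_subset_union hdX hdY, ?_, ?_⟩
  · rw [card_union_of_disjoint (disjoint_of_subset_left hdX (disjoint_of_subset_right hdY hXY)),
      card_sdiff_of_subset hMX, card_sdiff_of_subset hNY, hM, hN]
  have r1 : G.Routes (pairs (X \ M) ∪ across (X \ M) N) (pairs (X \ M)) := by
    refine Routes.of_hub (hj.mono hdX hNY) fun v hv => ?_
    have := codeg_mono (G := G) hdX v
    rcases hX v (hdX hv) with h | h <;> omega
  have r2 : G.Routes (pairs (Y \ N) ∪ across (Y \ N) M) (pairs (Y \ N)) := by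
    refine Routes.of_hub (hj.symm.mono hdY hMX) fun v hv => ?_
    have := codeg_mono (G := G) hdY v
    rcases hY v (hdY hv) with h | h <;> omega
  have r3 : G.Routes (across (X \ M) (Y \ N)) (across (X \ M) (Y \ N)) :=
    Routes.of_subset_edgeSet le_rfl (across_subset_edgeSet (hj.mono hdX hdY))
  have d1 : Disjoint (X \ M) (Y \ N) := disjoint_of_subset_left hdX (disjoint_of_subset_right hdY hXY)
  have d2 : Disjoint (X \ M) M := sdiff_disjoint
  have d3 : Disjoint (Y \ N) N := sdiff_disjoint
  have d4 : Disjoint (X \ M) N := disjoint_of_subset_left hdX (disjoint_of_subset_right hNY hXY)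
  have d5 : Disjoint (Y \ N) M := disjoint_of_subset_left hdY (disjoint_of_subset_right hMX hXY.symm)
  refine ((r1.union r2 ?_).union r3 ?_).mono ?_ pairs_union
  · rw [Set.disjoint_union_left, Set.disjoint_union_right, Set.disjoint_union_right]
    exact ⟨⟨disjoint_pairs d1, disjoint_pairs_across d1⟩,
      (disjoint_pairs_across d1.symm).symm, disjoint_across d1 d2⟩
  · rw [Set.disjoint_union_left, Set.disjoint_union_left, Set.disjoint_union_left]
    refine ⟨⟨across_comm (X := Y \ N) ▸ disjoint_pairs_across d1, ?_⟩,
      disjoint_pairs_across d1.symm, ?_⟩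
    · rw [across_comm (X := X \ M), across_comm (X := X \ M)]
      exact (disjoint_across d3 d1.symm).symm
    · exact (disjoint_across d2 d1).symm.mono_left (by rw [across_comm (X := Y \ N)])
  · refine Set.union_subset (Set.union_subset (Set.union_subset ?_ ?_) (Set.union_subset ?_ ?_)) ?_
    · exact pairs_mono (hdX.trans subset_union_left)
    · exact (across_mono hdX hNY).trans (across_subset_pairs hXY)
    · exact pairs_mono (hdY.trans subset_union_right)
    · rw [across_comm]
      exact (across_mono hMX hdY).trans (across_subset_pairs hXY)
    · exact (across_mono hdX hdY).trans (across_subset_pairs hXY)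

/-! ### Balanced splits, the dominant part and the first bound -/

/-- `A` is a union of parts of `X`. -/
def Splits (G : SimpleGraph V) (X A : Finset V) : Prop := A ⊆ X ∧ G.Joined A (X \ A)

theorem Splits.compl {A : Finset V} (h : G.Splits X A) : G.Splits X (X \ A) :=
  ⟨sdiff_subset, by rw [Finset.sdiff_sdiff_eq_self h.1]; exact h.2.symm⟩

theorem Splits.sdiff {A B : Finset V} (hA : G.Splits X A) (hB : G.Splits X B) :
    G.Splits X (A \ B) := by
  refine ⟨sdiff_subset.trans hA.1, fun x hx y hy => ?_⟩
  rw [mem_sdiff] at hx hy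
  by_cases hyA : y ∈ A
  · have hyB : y ∈ B := by
      by_contra h
      exact hy.2 (mem_sdiff.2 ⟨hyA, h⟩)
    exact (hB.2 y hyB x (mem_sdiff.2 ⟨hA.1 hx.1, hx.2⟩)).symm
  · exact hA.2 x hx.1 y (mem_sdiff.2 ⟨hy.1, hyA⟩)

theorem Splits.part_subset {A : Finset V} (h : G.Splits X A) {x : V} (hx : x ∈ A) :
    G.part X x ⊆ A := by
  have h1 := coconnectedOn_part (G := G) (X := X) x (G.part X x ∩ A) inter_subset_left
    ⟨x, mem_inter.2 ⟨self_mem_part (h.1 hx), hx⟩⟩ fun y hy z hz => by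
      rw [mem_inter] at hy
      rw [mem_sdiff, mem_inter] at hz
      exact h.2 y hy.2 z (mem_sdiff.2 ⟨SimpleGraph.part_subset x hz.1, fun h' => hz.2 ⟨hz.1, h'⟩⟩)
  rw [← h1]
  exact inter_subset_right

theorem splits_part {x : V} : G.Splits X (G.part X x) := ⟨part_subset x, joined_part x⟩

theorem Splits.joined_sdiff {A B : Finset V} (hA : G.Splits X A) (hB : G.Splits X B) (hBA : B ⊆ A) :
    B ∪ A \ B = A ∧ G.Joined B (A \ B) :=
  ⟨union_sdiff_of_subset hBA, fun x hx y hy => hB.2 x hx y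
    (mem_sdiff.2 ⟨hA.1 (mem_sdiff.1 hy).1, (mem_sdiff.1 hy).2⟩)⟩

theorem Splits.excess_sdiff {A B : Finset V} (hA : G.Splits X A) (hB : G.Splits X B) (hBA : B ⊆ A) :
    G.excess A = G.excess B + G.excess (A \ B) := by
  obtain ⟨h1, h2⟩ := hA.joined_sdiff hB hBA
  rw [← h2.excess_union, h1]

theorem Splits.chi_sdiff {A B : Finset V} (hA : G.Splits X A) (hB : G.Splits X B) (hBA : B ⊆ A) :
    G.chi A = G.chi B + G.chi (A \ B) := by
  obtain ⟨h1, h2⟩ := hA.joined_sdiff hB hBA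
  rw [← h2.chi_union, h1]

/-- Sum over the parts in `A` of `5χ ≤ 3(χ + excess)`. -/
theorem Splits.two_mul_chi_le {A : Finset V} (hX : G.CriticalOn X) (hA : G.Splits X A)
    (h : ∀ x ∈ A, 2 ≤ #(G.part X x)) : 2 * G.chi A ≤ 3 * G.excess A := by
  induction A using Finset.strongInduction with
  | H A ih =>
  rcases A.eq_empty_or_nonempty with rfl | ⟨x, hx⟩
  · simp
  have h1 := hA.part_subset hx
  have h2 := ih (A \ G.part X x) (sdiff_ssubset h1 ⟨x, self_mem_part (hA.1 hx)⟩)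
    (hA.sdiff splits_part) fun y hy => h y (mem_sdiff.1 hy).1
  have h3 := hA.chi_sdiff splits_part h1
  have h4 := hA.excess_sdiff splits_part h1
  have h5 := (hX.part x).five_mul_chi_le (coconnectedOn_part x) (h x hx)
  have h6 := G.chi_add_excess (X := G.part X x)
  omega

theorem SlackOn.codeg_le {A : Finset V} (hs : G.SlackOn X) (hA : G.Splits X A) {v : V}
    (hv : v ∈ A) : G.codeg A v = 0 ∨ G.codeg A v + 1 ≤ G.excess A := by
  have h1 := codeg_mono (G := G) hA.1 v
  have h2 := hA.excess_sdiff splits_part (hA.part_subset hv)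
  rcases hs v (hA.1 hv) with h | h <;> omega

/-- Unless one part dominates, the parts of `X` split into two sets that are hubs for each other. -/
theorem CriticalOn.linked_or_dominant [Finite V] (hX : G.CriticalOn X) (hs : G.SlackOn X)
    (hn : 3 * #X ≤ 5 * G.chi X) : G.Linked X (G.chi X) ∨
      ∃ C, G.Splits X C ∧ 2 * G.chi C ≤ #C + 1 ∧ #(X \ C) < G.excess C := by
  have hm := G.chi_add_excess (X := X)
  have hXX : G.Splits X X := ⟨Subset.rfl, fun x _ y hy => by simp at hy⟩
  let 𝒜 := X.powerset.filter fun A => G.Splits X A ∧ G.excess X ≤ 2 * G.excess A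
  have h𝒜 : ∀ A, A ∈ 𝒜 ↔ G.Splits X A ∧ G.excess X ≤ 2 * G.excess A := fun A => by
    rw [mem_filter, mem_powerset]
    exact ⟨fun h => h.2, fun h => ⟨h.1.1, h⟩⟩
  -- The weight is lexicographic: least excess first, then least cardinality, which is below `#X +
  -- 1`.
  obtain ⟨A, hA𝒜, hmin⟩ := exists_min_image 𝒜 (fun A => G.excess A * (#X + 1) + #A)
    ⟨X, (h𝒜 X).2 ⟨hXX, by omega⟩⟩
  obtain ⟨hA, hA2⟩ := (h𝒜 A).1 hA𝒜
  have hexA := hXX.excess_sdiff hA hA.1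
  have hchiA := hXX.chi_sdiff hA hA.1
  have hmA := G.chi_add_excess (X := A)
  have hmA' := G.chi_add_excess (X := X \ A)
  have hAc : A ∪ X \ A = X := union_sdiff_of_subset hA.1
  by_cases hfit : G.excess A ≤ #(X \ A)
  · left
    have h1 := linked_of_hubs (a := G.excess A) (b := G.excess (X \ A)) hA.2
      (fun v hv => hs.codeg_le hA hv) (fun v hv => hs.codeg_le hA.compl hv) (by omega) hfit
    rw [hAc] at h1
    convert h1 using 1
    omega
  right
  have hmin' : ∀ D, G.Splits X D → G.excess X ≤ 2 * G.excess D → G.excess A ≤ G.excess D := by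
    intro D hD hD2
    have h1 := hmin D ((h𝒜 D).2 ⟨hD, hD2⟩)
    have h2 := card_le_card hD.1
    by_contra h
    have : (G.excess D + 1) * (#X + 1) ≤ G.excess A * (#X + 1) := Nat.mul_le_mul_right _ (by omega)
    rw [add_mul] at this
    omega
  -- A one-vertex part has excess zero, so discarding it would reduce the cardinality at equal
  -- excess.
  have hbig : ∀ x ∈ A, 2 ≤ #(G.part X x) := by
    intro x hx
    by_contra h
    have hxp := self_mem_part (G := G) (hA.1 hx)
    have h1 : G.part X x = {x} := by
      have h2 : #(G.part X x) ≤ 1 := by omega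
      exact eq_singleton_iff_unique_mem.2 ⟨hxp, fun y hy => card_le_one.1 h2 y hy x hxp⟩
    have h3 := hA.excess_sdiff splits_part (hA.part_subset hx)
    have h4 : G.excess (G.part X x) = 0 := by simp [h1, excess, chi_singleton]
    have h5 := hmin _ ((h𝒜 _).2 ⟨hA.sdiff (splits_part (x := x)), by omega⟩)
    have h6 : #(A \ G.part X x) < #A :=
      card_lt_card (sdiff_ssubset (hA.part_subset hx) ⟨x, hxp⟩)
    rw [h4, zero_add] at h3
    rw [h3] at h5
    omega
  have hchi := hA.two_mul_chi_le hX hbig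
  have hne : A.Nonempty := by
    rw [nonempty_iff_ne_empty]
    rintro rfl
    simp [excess] at hfit
  obtain ⟨x, hx⟩ := hne
  have hpA := hA.part_subset hx
  have hxp := self_mem_part (G := G) (hA.1 hx)
  -- By minimality `A \ S` has less than half of the total excess. Its complement therefore competes
  -- with `A`, so the excess of `A` is at most that of `X \ A` plus that of `S`. But `hn`, `hchi`
  -- and the failure of `hfit` make the excess of `X \ A` less than two fifths of that of `A`, and
  -- `S` has at most one half.
  have hsplit : ∀ S, G.Splits X S → S ⊆ A → 0 < G.excess S → 2 * G.excess S ≤ G.excess A → False := by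
    intro S hS hSA hS0 hS2
    have h1 := hA.excess_sdiff hS hSA
    have h2 : 2 * G.excess (A \ S) < G.excess X := by
      by_contra h
      have := hmin' _ (hA.sdiff hS) (by omega)
      omega
    have h3 := hXX.excess_sdiff (hA.sdiff hS) (hA.sdiff hS).1
    have h4 := hmin' _ (hA.sdiff hS).compl (by omega)
    omega
  have hpos : ∀ y ∈ A, 0 < G.excess (G.part X y) := by
    intro y hy
    have h5 := (hX.part y).five_mul_chi_le (coconnectedOn_part y) (hbig y hy)
    have h6 := G.chi_add_excess (X := G.part X y)
    have := hbig y hy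
    omega
  have hAp : A = G.part X x := by
    by_contra hne
    have h1 := hA.excess_sdiff splits_part hpA
    obtain ⟨y, hy⟩ : (A \ G.part X x).Nonempty := by
      rw [nonempty_iff_ne_empty]
      intro h
      exact hne (Subset.antisymm (sdiff_eq_empty_iff_subset.1 h) hpA)
    have h2 := (hA.sdiff splits_part).excess_sdiff splits_part
      ((hA.sdiff (splits_part (x := x))).part_subset hy)
    have h3 := hpos x hx
    have h4 := hpos y (mem_sdiff.1 hy).1
    rcases le_total (G.excess (G.part X x)) (G.excess (A \ G.part X x)) with h | h
    · exact hsplit _ splits_part hpA h3 (by omega)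
    · exact hsplit _ (hA.sdiff (splits_part (x := x))) sdiff_subset (by omega) (by omega)
  refine ⟨A, hA, ?_, by omega⟩
  rw [hAp]
  exact (hX.part x).two_mul_chi_le (coconnectedOn_part x) ⟨x, hxp⟩

/-- Graphs with at most `1.4 k - 0.8` vertices. -/
theorem CriticalOn.linked_of_five_mul_card [Finite V] (hX : G.CriticalOn X)
    (h : 5 * #X + 4 ≤ 7 * G.chi X) : G.Linked X (G.chi X) := by
  refine hX.linked_of_slack (fun n k => 5 * n + 4 ≤ 7 * k) (fun n k n' k' h1 h2 => by omega) ?_ h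
  intro X hX hXQ hs
  rcases hX.linked_or_dominant hs (by omega) with h1 | ⟨C, hC, hC1, hC2⟩
  · exact h1
  -- With `e` and `e'` the excesses of `C` and of the rest, Gallai's bound gives `χ(C) ≤ e + 1` and
  -- dominance gives `χ(X) ≤ 2e - e'`. The hypothesis reads `5(e + e') + 4 ≤ 2χ(X)`, which is then
  -- impossible.
  · exfalso
    have h2 := G.chi_add_excess (X := X)
    have h3 := G.chi_add_excess (X := C)
    have h4 : G.excess X = G.excess C + G.excess (X \ C) :=
      Splits.excess_sdiff ⟨Subset.rfl, fun x _ y hy => by simp at hy⟩ hC hC.1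
    have h5 := card_sdiff_of_subset hC.1
    have h6 := card_le_card hC.1
    omega

theorem Linked.containsWeakImmersion {k : ℕ} (h : G.Linked X k) :
    G.ContainsWeakImmersion (completeGraph (Fin k)) := by
  obtain ⟨B, -, hB, h⟩ := h
  exact h.containsWeakImmersion hB

/-! ### Derandomised rounding -/

section Rounding
variable {ι J : Type*}

/-- The exponential moment of a centred Bernoulli variable: after `exp x ≤ 1 + x + x²` the linear
terms cancel. -/
theorem mul_exp_add_mul_exp_le {p a : ℝ} (hp0 : 0 ≤ p) (hp1 : p ≤ 1) (ha : |a| ≤ 1) :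
    p * Real.exp (a * (1 - p)) + (1 - p) * Real.exp (-(a * p)) ≤ Real.exp (a ^ 2) := by
  have key : ∀ x : ℝ, |x| ≤ 1 → Real.exp x ≤ 1 + x + x ^ 2 := fun x hx => by
    have := (abs_le.1 (Real.abs_exp_sub_one_sub_id_le hx)).2
    linarith
  have h1 : |a * (1 - p)| ≤ 1 := by
    rw [abs_mul, abs_of_nonneg (by linarith : 0 ≤ 1 - p)]
    nlinarith [abs_nonneg a]
  have h2 : |-(a * p)| ≤ 1 := by
    rw [abs_neg, abs_mul, abs_of_nonneg hp0]
    nlinarith [abs_nonneg a]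
  calc p * Real.exp (a * (1 - p)) + (1 - p) * Real.exp (-(a * p))
      ≤ p * (1 + a * (1 - p) + (a * (1 - p)) ^ 2) + (1 - p) * (1 + -(a * p) + (-(a * p)) ^ 2) :=
        add_le_add (mul_le_mul_of_nonneg_left (key _ h1) hp0)
          (mul_le_mul_of_nonneg_left (key _ h2) (by linarith))
    _ = 1 + a ^ 2 * (p * (1 - p)) := by ring
    _ ≤ 1 + a ^ 2 := by nlinarith [sq_nonneg a, sq_nonneg (p - 1 / 2), sq_nonneg p]
    _ ≤ Real.exp (a ^ 2) := by linarith [Real.add_one_le_exp (a ^ 2)]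

/-- Conditional expectations: indices are decided one by one, and the `p i`-weighted average of the
potential over the two choices grows at most by the factor from the moment bound, so one choice is
good. The offset `c` carries the decisions already made. -/
theorem exists_rounding_potential [DecidableEq ι] (s : Finset ι) (I : Finset J) (p : ι → ℝ)
    (w : J → ι → ℝ) (hp : ∀ i ∈ s, 0 ≤ p i ∧ p i ≤ 1) (hw : ∀ j ∈ I, ∀ i ∈ s, |w j i| ≤ 1) {l : ℝ}
    (hl0 : 0 ≤ l) (hl1 : l ≤ 1) (c : J → ℝ) :
    ∃ S ⊆ s, (∀ i ∈ s, p i = 1 → i ∈ S) ∧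
      ∑ j ∈ I, Real.exp (l * (c j + ∑ i ∈ S, w j i - ∑ i ∈ s, p i * w j i)) ≤
        ∑ j ∈ I, Real.exp (l * c j + l ^ 2 * ∑ i ∈ s, w j i ^ 2) := by
  induction s using Finset.induction_on generalizing c with
  | empty => exact ⟨∅, Subset.rfl, by simp, by simp⟩
  | insert i s hi ih =>
    obtain ⟨hp0, hp1⟩ := hp i (mem_insert_self i s)
    have hlw : ∀ j ∈ I, |l * w j i| ≤ 1 := fun j hj => by
      rw [abs_mul, abs_of_nonneg hl0]
      have := hw j hj i (mem_insert_self i s)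
      nlinarith [abs_nonneg (w j i)]
    let A : ℝ := ∑ j ∈ I, Real.exp (l * (c j + (1 - p i) * w j i) + l ^ 2 * ∑ i ∈ s, w j i ^ 2)
    let B : ℝ := ∑ j ∈ I, Real.exp (l * (c j - p i * w j i) + l ^ 2 * ∑ i ∈ s, w j i ^ 2)
    let T : ℝ := ∑ j ∈ I, Real.exp (l * c j + l ^ 2 * ∑ i ∈ insert i s, w j i ^ 2)
    have hAB : p i * A + (1 - p i) * B ≤ T := by
      simp only [A, B, T]
      rw [mul_sum, mul_sum, ← sum_add_distrib]
      refine sum_le_sum fun j hj => ?_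
      have h1 := mul_exp_add_mul_exp_le hp0 hp1 (hlw j hj)
      rw [sum_insert hi]
      have e1 : l * (c j + (1 - p i) * w j i) + l ^ 2 * ∑ i ∈ s, w j i ^ 2 =
        (l * c j + l ^ 2 * ∑ i ∈ s, w j i ^ 2) + l * w j i * (1 - p i) := by ring
      have e2 : l * (c j - p i * w j i) + l ^ 2 * ∑ i ∈ s, w j i ^ 2 =
        (l * c j + l ^ 2 * ∑ i ∈ s, w j i ^ 2) + -(l * w j i * p i) := by ring
      have e3 : l * c j + l ^ 2 * (w j i ^ 2 + ∑ i ∈ s, w j i ^ 2) =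
        (l * c j + l ^ 2 * ∑ i ∈ s, w j i ^ 2) + (l * w j i) ^ 2 := by ring
      rw [e1, e2, e3, Real.exp_add _ (l * w j i * (1 - p i)), Real.exp_add _ (-(l * w j i * p i)),
        Real.exp_add _ ((l * w j i) ^ 2)]
      refine le_trans (le_of_eq ?_) (mul_le_mul_of_nonneg_left h1 (Real.exp_pos _).le)
      ring
    have hp' : ∀ i' ∈ s, 0 ≤ p i' ∧ p i' ≤ 1 := fun i' h => hp i' (mem_insert_of_mem h)
    have hw' : ∀ j ∈ I, ∀ i' ∈ s, |w j i'| ≤ 1 := fun j hj i' h => hw j hj i' (mem_insert_of_mem h)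
    -- For `p i = 1` the average is `A` alone, so such an index can always be included.
    have hcases : A ≤ T ∨ (p i ≠ 1 ∧ B ≤ T) := by
      by_contra hcon
      push Not at hcon
      obtain ⟨h1, h2⟩ := hcon
      by_cases h3 : p i = 1
      · rw [h3] at hAB
        linarith
      · have h4 := h2 h3
        have h5 : p i < 1 := lt_of_le_of_ne hp1 h3
        nlinarith
    rcases hcases with h | ⟨hne, h⟩
    · obtain ⟨S, hS, hS1, hS2⟩ := ih hp' hw' fun j => c j + (1 - p i) * w j i
      have hiS : i ∉ S := fun h => hi (hS h)
      refine ⟨insert i S, insert_subset_insert i hS, ?_, ?_⟩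
      · intro i' hi' hpi'
        rcases mem_insert.1 hi' with rfl | h'
        · exact mem_insert_self _ _
        · exact mem_insert_of_mem (hS1 i' h' hpi')
      · refine le_trans (le_of_eq (sum_congr rfl fun j _ => ?_)) (hS2.trans h)
        rw [sum_insert hi, sum_insert hiS]
        congr 1
        ring
    · obtain ⟨S, hS, hS1, hS2⟩ := ih hp' hw' fun j => c j - p i * w j i
      refine ⟨S, hS.trans (subset_insert _ _), ?_, ?_⟩
      · intro i' hi' hpi'
        rcases mem_insert.1 hi' with rfl | h'
        · exact absurd hpi' hne
        · exact hS1 i' h' hpi'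
      · refine le_trans (le_of_eq (sum_congr rfl fun j _ => ?_)) (hS2.trans h)
        rw [sum_insert hi]
        congr 1
        ring

/-- Weights in the unit interval can be rounded with small errors in a family of linear forms. -/
theorem exists_rounding [DecidableEq ι] (s : Finset ι) (I : Finset J) (p : ι → ℝ)
    (w : J → ι → ℝ) (hp : ∀ i ∈ s, 0 ≤ p i ∧ p i ≤ 1) (hw : ∀ j ∈ I, ∀ i ∈ s, |w j i| ≤ 1) {l D t : ℝ}
    (hl0 : 0 < l) (hl1 : l ≤ 1) (hD : ∀ j ∈ I, ∑ i ∈ s, w j i ^ 2 ≤ D)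
    (ht : 2 * #I * Real.exp (l ^ 2 * D) < Real.exp (l * t)) :
    ∃ S ⊆ s, (∀ i ∈ s, p i = 1 → i ∈ S) ∧
      ∀ j ∈ I, |∑ i ∈ S, w j i - ∑ i ∈ s, p i * w j i| ≤ t := by
  -- The Boolean doubles the family by negated forms, for a two-sided bound.
  obtain ⟨S, hS, hS1, hS2⟩ := exists_rounding_potential s (I ×ˢ (univ : Finset Bool)) p
    (fun j i => if j.2 then w j.1 i else - w j.1 i) hp
    (by
      intro j hj i hi
      rw [mem_product] at hj
      split_ifs
      · exact hw _ hj.1 i hi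
      · rw [abs_neg]
        exact hw _ hj.1 i hi) hl0.le hl1 (fun _ => 0)
  have hR : ∑ j ∈ I ×ˢ (univ : Finset Bool), Real.exp (l * 0 + l ^ 2 *
      ∑ i ∈ s, (if j.2 then w j.1 i else - w j.1 i) ^ 2) ≤ 2 * #I * Real.exp (l ^ 2 * D) := by
    calc _ ≤ ∑ j ∈ I ×ˢ (univ : Finset Bool), Real.exp (l ^ 2 * D) := by
          refine sum_le_sum fun j hj => ?_
          rw [mem_product] at hj
          refine Real.exp_le_exp.2 ?_
          rw [mul_zero, zero_add]
          refine mul_le_mul_of_nonneg_left ?_ (sq_nonneg l)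
          refine le_trans (le_of_eq (sum_congr rfl fun i _ => ?_)) (hD j.1 hj.1)
          split_ifs <;> ring
      _ = _ := by
          rw [sum_const, card_product, card_univ, Fintype.card_bool, nsmul_eq_mul]
          push_cast
          ring
  have hlt := (hS2.trans hR).trans_lt ht
  have key : ∀ j ∈ I ×ˢ (univ : Finset Bool), ∑ i ∈ S, (if j.2 then w j.1 i else - w j.1 i) -
      ∑ i ∈ s, p i * (if j.2 then w j.1 i else - w j.1 i) ≤ t := by
    intro j hj
    have h1 := (single_le_sum (f := fun j : J × Bool => Real.exp (l * (0 +
      ∑ i ∈ S, (if j.2 then w j.1 i else - w j.1 i) -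
      ∑ i ∈ s, p i * (if j.2 then w j.1 i else - w j.1 i)))) (fun j _ => (Real.exp_pos _).le) hj)
    have h2 := Real.exp_lt_exp.1 (h1.trans_lt hlt)
    have h3 := lt_of_mul_lt_mul_left h2 hl0.le
    linarith
  refine ⟨S, hS, hS1, fun j hj => abs_le.2 ⟨?_, ?_⟩⟩
  · have := key (j, false) (by simp [hj])
    simp only [Bool.false_eq_true, if_false, mul_neg, sum_neg_distrib] at this
    linarith
  · have := key (j, true) (by simp [hj])
    simpa using this

/-- Weights in the unit interval can be rounded with error at most `c * b` in any family of at most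
`20 * b` linear forms, each of size at most `3 * b`. -/
def RoundsWithin (c : ℝ) (b : ℕ) : Prop :=
  ∀ (ι J : Type u) (s : Finset ι) (I : Finset J) (p : ι → ℝ)
    (w : J → ι → ℝ), (∀ i ∈ s, 0 ≤ p i ∧ p i ≤ 1) → (∀ j ∈ I, ∀ i ∈ s, |w j i| ≤ 1) →
    (∀ j ∈ I, ∑ i ∈ s, w j i ^ 2 ≤ 3 * b) → #I ≤ 20 * b →
    ∃ S ⊆ s, (∀ i ∈ s, p i = 1 → i ∈ S) ∧
      ∀ j ∈ I, |∑ i ∈ S, w j i - ∑ i ∈ s, p i * w j i| ≤ c * b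

/-- With at most `20b` forms the potential is at most `40b * exp(3l²b)`. As `6l ≤ c`, the target is
at least `exp(6l²b)`, and the exponential beats the linear factor for large `b`. -/
theorem exists_rounding_threshold {c : ℝ} (hc : 0 < c) :
    ∃ K : ℕ, ∀ b : ℕ, K ≤ b → RoundsWithin.{u} c b := by
  set l : ℝ := min 1 (c / 6) with hl
  have hl0 : 0 < l := lt_min one_pos (by positivity)
  have hl1 : l ≤ 1 := min_le_left _ _
  have hlc : 6 * l ≤ c := by have := min_le_right 1 (c / 6); linarith
  have hlim : Filter.Tendsto (fun b : ℕ => (b : ℝ) * Real.exp (-(3 * l ^ 2 * b))) Filter.atTop (nhds 0) := by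
    have h1 := Real.tendsto_pow_mul_exp_neg_atTop_nhds_zero 1
    have h2 : Filter.Tendsto (fun b : ℕ => 3 * l ^ 2 * (b : ℝ)) Filter.atTop Filter.atTop :=
      tendsto_natCast_atTop_atTop.const_mul_atTop (by positivity)
    have h3 := (h1.comp h2).const_mul (1 / (3 * l ^ 2))
    rw [mul_zero] at h3
    refine h3.congr fun b => ?_
    simp only [Function.comp, pow_one]
    field_simp
  obtain ⟨K, hK⟩ := Filter.eventually_atTop.1 (hlim.eventually (gt_mem_nhds (show (0 : ℝ) < 1 / 40 by norm_num)))
  refine ⟨max K 1, fun b hb ι J s I p w hp hw hD hI => ?_⟩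
  refine exists_rounding s I p w hp hw hl0 hl1 hD ?_
  have h1 := hK b (le_of_max_le_left hb)
  have hI' : (#I : ℝ) ≤ 20 * b := by exact_mod_cast hI
  have hb0 : (0 : ℝ) ≤ b := Nat.cast_nonneg b
  have h2 : l * (6 * l * b) ≤ l * (c * b) :=
    mul_le_mul_of_nonneg_left (mul_le_mul_of_nonneg_right hlc hb0) hl0.le
  calc 2 * #I * Real.exp (l ^ 2 * (3 * b)) ≤ 40 * b * Real.exp (l ^ 2 * (3 * b)) := by
        refine mul_le_mul_of_nonneg_right (by linarith) (Real.exp_pos _).le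
    _ = 40 * (b * Real.exp (-(3 * l ^ 2 * b))) * Real.exp (l * (6 * l * b)) := by
        rw [show l * (6 * l * b) = 3 * l ^ 2 * b + l ^ 2 * (3 * b) by ring, Real.exp_add]
        rw [Real.exp_neg]
        have := Real.exp_pos (3 * l ^ 2 * b)
        field_simp
    _ < 1 * Real.exp (l * (6 * l * b)) :=
        mul_lt_mul_of_pos_right (by linarith) (Real.exp_pos _)
    _ ≤ Real.exp (l * (c * b)) := by
        rw [one_mul]
        exact Real.exp_le_exp.2 h2

end Rounding

/-! ### Greedy transfers and label assignment -/

/-- Each member `(w, z)` of `Ψ` chooses an element of `U w` with one of `C` labels, so that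
choices for the same `w` are different elements and choices for the same `z` are different. -/
theorem exists_transfers {W : Type*} [DecidableEq W] [Nonempty V] (Ψ : Finset (W × W)) (U : W → Finset V) (C : ℕ)
    (h : ∀ e ∈ Ψ, C * #(Ψ.filter fun d => d.1 = e.1) + #(Ψ.filter fun d => d.2 = e.2) ≤ C * #(U e.1)) :
    ∃ g : W × W → V × ℕ, (∀ e ∈ Ψ, (g e).1 ∈ U e.1 ∧ (g e).2 < C) ∧
      (∀ e ∈ Ψ, ∀ d ∈ Ψ, e.1 = d.1 → (g e).1 = (g d).1 → e = d) ∧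
      ∀ e ∈ Ψ, ∀ d ∈ Ψ, e.2 = d.2 → g e = g d → e = d := by
  induction Ψ using Finset.induction_on with
  | empty => exact ⟨fun _ => (Classical.arbitrary V, 0), by simp, by simp, by simp⟩
  | insert e Ψ he ih =>
    have hmono : ∀ (p : W × W → Prop) [DecidablePred p], #(Ψ.filter p) ≤ #((insert e Ψ).filter p) :=
      fun p _ => card_le_card (filter_subset_filter _ (subset_insert _ _))
    obtain ⟨g, h1, h2, h3⟩ := ih fun d hd => by
      have := h d (mem_insert_of_mem hd)
      have a1 := hmono fun d' => d'.1 = d.1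
      have a2 := hmono fun d' => d'.2 = d.2
      nlinarith
    have hins : ∀ (p : W × W → Prop) [DecidablePred p], p e →
        #(Ψ.filter p) + 1 = #((insert e Ψ).filter p) := by
      intro p _ hp
      rw [filter_insert, if_pos hp, card_insert_of_notMem]
      simp [he]
    have h4 := h e (mem_insert_self _ _)
    rw [← hins (fun d => d.1 = e.1) rfl, ← hins (fun d => d.2 = e.2) rfl] at h4
    -- Elements still unused at `w`. Pairing them with `C` labels leaves more choices than are
    -- already taken at `z`.
    let O := U e.1 \ (Ψ.filter fun d => d.1 = e.1).image fun d => (g d).1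
    have hO : #(U e.1) ≤ #O + #(Ψ.filter fun d => d.1 = e.1) := by
      have a1 := le_card_sdiff ((Ψ.filter fun d => d.1 = e.1).image fun d => (g d).1) (U e.1)
      have a2 := card_image_le (s := Ψ.filter fun d => d.1 = e.1) (f := fun d => (g d).1)
      simp only [O]
      omega
    obtain ⟨a, ha⟩ : ((O ×ˢ range C) \ (Ψ.filter fun d => d.2 = e.2).image g).Nonempty := by
      rw [← card_pos]
      have a1 := le_card_sdiff ((Ψ.filter fun d => d.2 = e.2).image g) (O ×ˢ range C)
      have a2 := card_image_le (s := Ψ.filter fun d => d.2 = e.2) (f := g)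
      rw [card_product, card_range] at a1
      have a3 := Nat.mul_le_mul_left C hO
      rw [mul_add] at a3 h4
      rw [mul_comm] at a1
      omega
    rw [mem_sdiff, mem_product, mem_range, mem_sdiff] at ha
    obtain ⟨⟨⟨haU, haO⟩, haC⟩, haI⟩ := ha
    have hne : ∀ d ∈ Ψ, Function.update g e a d = g d := fun d hd =>
      Function.update_of_ne (fun h => he (by rwa [h] at hd)) _ _
    refine ⟨Function.update g e a, ?_, ?_, ?_⟩
    · intro d hd
      rcases mem_insert.1 hd with h7 | hd
      · simpa [h7] using ⟨haU, haC⟩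
      · rw [hne d hd]
        exact h1 d hd
    · intro d hd d' hd' h5 h6
      rcases mem_insert.1 hd with h7 | hd <;> rcases mem_insert.1 hd' with h8 | hd'
      · rw [h7, h8]
      · rw [hne d' hd', h7, Function.update_self] at h6
        exact absurd (mem_image.2 ⟨d', mem_filter.2 ⟨hd', h5.symm.trans (by rw [h7])⟩, h6.symm⟩) haO
      · rw [hne d hd, h8, Function.update_self] at h6
        exact absurd (mem_image.2 ⟨d, mem_filter.2 ⟨hd, h5.trans (by rw [h8])⟩, h6⟩) haO
      · rw [hne d hd, hne d' hd'] at h6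
        exact h2 d hd d' hd' h5 h6
    · intro d hd d' hd' h5 h6
      rcases mem_insert.1 hd with h7 | hd <;> rcases mem_insert.1 hd' with h8 | hd'
      · rw [h7, h8]
      · rw [hne d' hd', h7, Function.update_self] at h6
        exact absurd (mem_image.2 ⟨d', mem_filter.2 ⟨hd', h5.symm.trans (by rw [h7])⟩, h6.symm⟩) haI
      · rw [hne d hd, h8, Function.update_self] at h6
        exact absurd (mem_image.2 ⟨d, mem_filter.2 ⟨hd, h5.trans (by rw [h8])⟩, h6⟩) haI
      · rw [hne d hd, hne d' hd'] at h6
        exact h3 d hd d' hd' h5 h6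

/-- Double counting: each element of `A` is related to at most one element of `S`. -/
theorem mul_card_filter_le_card {α β : Type*} (A : Finset α) (S : Finset β) (r : α → β → Prop)
    [∀ b, DecidablePred fun a => r a b] (hr : ∀ a ∈ A, ∀ b ∈ S, ∀ b' ∈ S, r a b → r a b' → b = b') (s : ℕ) :
    s * #(S.filter fun b => s ≤ #(A.filter fun a => r a b)) ≤ #A := by
  set S' := S.filter fun b => s ≤ #(A.filter fun a => r a b) with hS'
  calc s * #S' = ∑ b ∈ S', s := by rw [sum_const, smul_eq_mul, mul_comm]
    _ ≤ ∑ b ∈ S', #(A.filter fun a => r a b) := sum_le_sum fun b hb => (mem_filter.1 hb).2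
    _ = ∑ a ∈ A, #(S'.filter fun b => r a b) := by
        simp only [card_filter]
        exact sum_comm
    _ ≤ ∑ a ∈ A, 1 := by
        refine sum_le_sum fun a ha => card_le_one.2 fun b hb b' hb' => ?_
        rw [mem_filter] at hb hb'
        exact hr a ha b (mem_filter.1 hb.1).1 b' (mem_filter.1 hb'.1).1 hb.2 hb'.2
    _ = #A := by simp

/-- Hall's theorem in a nearly complete bipartite graph. -/
theorem exists_injOn_of_few_forbidden {α β : Type*} [Nonempty β] (D : Finset α) (T : Finset β)
    (r : α → β → Prop) {s n : ℕ} (hs : 0 < s) (hDT : #D ≤ #T) (hT : 4 * n ≤ s * #T)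
    (h1 : ∀ a ∈ D, s * #(T.filter fun b => r a b) ≤ 2 * n)
    (h2 : ∀ b ∈ T, s * #(D.filter fun a => r a b) ≤ 2 * n) :
    ∃ f : α → β, (∀ a ∈ D, f a ∈ T ∧ ¬ r a (f a)) ∧ Set.InjOn f D := by
  let t : D → Finset β := fun a => T.filter fun b => ¬ r a b
  have hall : ∀ S : Finset D, #S ≤ #(S.biUnion t) := by
    intro S
    rcases S.eq_empty_or_nonempty with rfl | ⟨a, ha⟩
    · simp
    -- For small `S` one element alone has enough allowed partners. For large `S` nothing in `T` is
    -- forbidden to all of `S`, so every element of `T` is a neighbour.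
    by_cases hS : s * #S ≤ 2 * n
    · have e1 : #(t a) ≤ #(S.biUnion t) := card_le_card (subset_biUnion_of_mem t ha)
      refine le_trans ?_ e1
      have e2 := card_filter_add_card_filter_not (s := T) (fun b => r a b)
      have e3 := h1 a a.2
      have e4 : s * #S ≤ s * #(t a) := by
        have e5 : s * #T = s * #(T.filter fun b => r a b) + s * #(t a) := by
          rw [← mul_add, ← e2]
        omega
      exact Nat.le_of_mul_le_mul_left e4 hs
    · have e1 : T ⊆ S.biUnion t := by
        intro b hb
        by_contra hcon
        have e2 : ∀ a ∈ S, r a b := by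
          intro a ha
          by_contra h
          exact hcon (mem_biUnion.2 ⟨a, ha, mem_filter.2 ⟨hb, h⟩⟩)
        have e3 : S.map (Function.Embedding.subtype _) ⊆ D.filter fun a => r a b := by
          intro a ha
          obtain ⟨a', ha', rfl⟩ := mem_map.1 ha
          exact mem_filter.2 ⟨a'.2, e2 a' ha'⟩
        have e4 := card_le_card e3
        rw [card_map] at e4
        have := Nat.mul_le_mul_left s e4
        have := h2 b hb
        omega
      have e5 : #S ≤ #D := by
        have := card_le_univ S
        rwa [Fintype.card_coe] at this
      exact e5.trans (hDT.trans (card_le_card e1))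
  obtain ⟨f, hf, hft⟩ := (Finset.all_card_le_biUnion_card_iff_exists_injective t).1 hall
  refine ⟨fun a => if h : a ∈ D then f ⟨a, h⟩ else Classical.arbitrary β, ?_, ?_⟩
  · intro a ha
    simp only [ha, dif_pos]
    exact mem_filter.1 (hft ⟨a, ha⟩)
  · intro a ha b hb hab
    have ha' : a ∈ D := ha
    have hb' : b ∈ D := hb
    simp only [ha', hb', dif_pos] at hab
    exact congrArg Subtype.val (hf hab)

/-- The number of adjacent ordered pairs in `P` with labels `a`, `b` at their ends. -/
noncomputable def labelCount {Λ : Type*} (H : SimpleGraph V) [DecidableRel H.Adj] (P : Finset V) (f : V → V → Λ) (a b : Λ) : ℕ :=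
  #((P ×ˢ P).filter fun e => H.Adj e.1 e.2 ∧ f e.1 e.2 = a ∧ f e.2 e.1 = b)

theorem labelCount_comm {Λ : Type*} (H : SimpleGraph V) [DecidableRel H.Adj] (P : Finset V) (f : V → V → Λ) (a b : Λ) :
    H.labelCount P f a b = H.labelCount P f b a := by
  refine card_bij (fun e _ => e.swap) ?_ ?_ ?_
  · intro e he
    simp only [mem_filter, mem_product, Prod.fst_swap, Prod.snd_swap] at he ⊢
    exact ⟨he.1.symm, he.2.1.symm, he.2.2.2, he.2.2.1⟩
  · intro e _ e' _ h
    exact Prod.swap_injective h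
  · intro e he
    simp only [mem_filter, mem_product] at he
    refine ⟨e.swap, ?_, Prod.swap_swap e⟩
    simp only [mem_filter, mem_product, Prod.fst_swap, Prod.snd_swap]
    exact ⟨he.1.symm, he.2.1.symm, he.2.2.2, he.2.2.1⟩

/-- Each vertex can assign its labels injectively to its neighbours in such a way that each pair of
labels meets on few edges. -/
theorem exists_assignment {Λ : Type*} [Nonempty Λ] (H : SimpleGraph V) [DecidableRel H.Adj] (B : Finset V)
    (T : V → Finset Λ) {s : ℕ} (hs : 0 < s) (hT : ∀ x ∈ B, #(B.filter (H.Adj x)) ≤ #(T x))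
    (hT' : ∀ x ∈ B, 4 * #B ≤ s * #(T x)) :
    ∃ f : V → V → Λ, (∀ x ∈ B, ∀ y ∈ B, H.Adj x y → f x y ∈ T x) ∧
      (∀ x ∈ B, ∀ y ∈ B, ∀ y' ∈ B, H.Adj x y → H.Adj x y' → f x y = f x y' → y = y') ∧
      ∀ a b, H.labelCount B f a b ≤ s ^ 2 + 1 := by
  suffices main : ∀ P ⊆ B, ∃ f : V → V → Λ, (∀ x ∈ P, ∀ y ∈ B, H.Adj x y → f x y ∈ T x) ∧
      (∀ x ∈ P, ∀ y ∈ B, ∀ y' ∈ B, H.Adj x y → H.Adj x y' → f x y = f x y' → y = y') ∧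
      (∀ a b, H.labelCount P f a b ≤ s ^ 2 + 1) ∧
      ∀ y ∈ B, ∀ a, #(P.filter fun x => H.Adj x y ∧ f x y = a) ≤ s by
    obtain ⟨f, h1, h2, h3, -⟩ := main B Subset.rfl
    exact ⟨f, h1, h2, h3⟩
  intro P
  induction P using Finset.induction_on with
  | empty =>
    intro _
    exact ⟨fun _ _ => Classical.arbitrary Λ, by simp, by simp, by simp [labelCount], by simp⟩
  | insert x P hx ih =>
  intro hPB
  rw [insert_subset_iff] at hPB
  obtain ⟨hxB, hPB⟩ := hPB
  obtain ⟨f, hfT, hfi, hfm, hfc⟩ := ih hPB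
  have hPn : #P ≤ #B := card_le_card hPB
  set D := B.filter (H.Adj x) with hD
  have hs2 : s * s = s ^ 2 := by ring
  -- the ordered pairs with a fixed second label
  have heavy : ∀ (b : Λ) (S : Finset Λ), s ^ 2 * #(S.filter fun a => s ^ 2 ≤ H.labelCount P f a b) ≤ #B := by
    intro b S
    let A := (P ×ˢ P).filter fun e => H.Adj e.1 e.2 ∧ f e.2 e.1 = b
    have hA : #A ≤ #P := by
      refine card_le_card_of_injOn Prod.snd (fun e he => ?_) ?_
      · exact (mem_product.1 (mem_filter.1 he).1).2
      · intro e he e' he' hee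
        have he1 := mem_filter.1 he
        have he2 := mem_filter.1 he'
        rw [mem_product] at he1 he2
        refine Prod.ext (hfi e.2 he1.1.2 _ (hPB he1.1.1) _ (hPB he2.1.1) he1.2.1.symm ?_ ?_) hee
        · rw [hee]; exact he2.2.1.symm
        · rw [he1.2.2, hee, he2.2.2]
    have h1 := mul_card_filter_le_card A S (fun e a => f e.1 e.2 = a)
      (fun e _ a _ a' _ h h' => h.symm.trans h') (s ^ 2)
    have h2 : ∀ a, #(A.filter fun e => f e.1 e.2 = a) = H.labelCount P f a b := by
      intro a
      unfold labelCount
      rw [filter_filter]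
      congr 1
      ext e
      simp only [mem_filter]
      tauto
    simp only [h2] at h1
    exact h1.trans (hA.trans hPn)
  -- The new vertex `x` must not give `y` a label that `y` has already received `s` times, nor
  -- complete a label pair that already occurs `s ^ 2` times.
  obtain ⟨r, hr⟩ : ∃ r : V → Λ → Prop, ∀ y a, r y a ↔
      s ≤ #(P.filter fun x' => H.Adj x' y ∧ f x' y = a) ∨
      (y ∈ P ∧ s ^ 2 ≤ H.labelCount P f a (f y x)) := ⟨_, fun _ _ => Iff.rfl⟩
  have hall := exists_injOn_of_few_forbidden D (T x) r (n := #B) hs (hT x hxB) (hT' x hxB) (by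
    intro y hy
    have h1 := mul_card_filter_le_card P (T x) (fun x' a => H.Adj x' y ∧ f x' y = a)
      (fun x' _ a _ a' _ h h' => h.2.symm.trans h'.2) s
    have h2 := heavy (f y x) (T x)
    have h3 : #((T x).filter fun a => r y a) ≤
        #((T x).filter fun a => s ≤ #(P.filter fun x' => H.Adj x' y ∧ f x' y = a)) +
        #((T x).filter fun a => s ^ 2 ≤ H.labelCount P f a (f y x)) := by
      refine le_trans (card_le_card fun a ha => ?_) (card_union_le _ _)
      rw [mem_filter] at ha
      rw [mem_union, mem_filter, mem_filter]
      rcases (hr _ _).1 ha.2 with h | h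
      · exact Or.inl ⟨ha.1, h⟩
      · exact Or.inr ⟨ha.1, h.2⟩
    have h4 := Nat.mul_le_mul_left s h3
    rw [mul_add] at h4
    have h5 : s * #((T x).filter fun a => s ^ 2 ≤ H.labelCount P f a (f y x)) ≤
        s ^ 2 * #((T x).filter fun a => s ^ 2 ≤ H.labelCount P f a (f y x)) :=
      Nat.mul_le_mul_right _ (by nlinarith)
    omega) (by
    intro a ha
    have h1 := mul_card_filter_le_card P D (fun x' y => H.Adj x' y ∧ f x' y = a)
      (fun x' hx' y hy y' hy' h h' => hfi x' hx' y (mem_filter.1 hy).1 y' (mem_filter.1 hy').1 h.1 h'.1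
        (h.2.trans h'.2.symm)) s
    -- Each label was given to `x` at most `s` times, so few heavy partner labels of `a` exclude few
    -- vertices `y`.
    let E := D.filter fun y => y ∈ P ∧ s ^ 2 ≤ H.labelCount P f a (f y x)
    let L := E.image fun y => f y x
    have h2 : #E ≤ s * #L := by
      refine card_le_mul_card_image (s := E) (f := fun y => f y x) s fun b hb => ?_
      refine (card_le_card fun y hy => ?_).trans (hfc x hxB b)
      obtain ⟨hyE, hyb⟩ := mem_filter.1 hy
      obtain ⟨hyD, hyP, -⟩ := mem_filter.1 hyE
      exact mem_filter.2 ⟨hyP, (mem_filter.1 hyD).2.symm, hyb⟩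
    have h3 := heavy a L
    have h4 : (L.filter fun b => s ^ 2 ≤ H.labelCount P f b a) = L := by
      rw [filter_eq_self]
      intro b hb
      obtain ⟨y, hy, rfl⟩ := mem_image.1 hb
      rw [labelCount_comm]
      exact (mem_filter.1 hy).2.2
    rw [h4] at h3
    have h5 : #(D.filter fun y => r y a) ≤
        #(D.filter fun y => s ≤ #(P.filter fun x' => H.Adj x' y ∧ f x' y = a)) + #E := by
      refine le_trans (card_le_card fun y hy => ?_) (card_union_le _ _)
      rw [mem_filter] at hy
      rw [mem_union]
      rcases (hr _ _).1 hy.2 with h | h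
      · exact Or.inl (mem_filter.2 ⟨hy.1, h⟩)
      · exact Or.inr (mem_filter.2 ⟨hy.1, h⟩)
    have h6 := Nat.mul_le_mul_left s h5
    have h7 := Nat.mul_le_mul_left s h2
    rw [mul_add] at h6
    rw [← mul_assoc, hs2] at h7
    omega)
  obtain ⟨g, hg, hginj⟩ := hall
  have hD' : ∀ y, y ∈ D ↔ y ∈ B ∧ H.Adj x y := fun y => by rw [hD, mem_filter]
  let f' : V → V → Λ := fun v => if v = x then g else f v
  have hfx : f' x = g := if_pos rfl
  have hfP : ∀ v ∈ P, f' v = f v := fun v hv => if_neg fun h => hx (by rwa [h] at hv)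
  have hold : ∀ a b, H.labelCount P f' a b = H.labelCount P f a b := by
    intro a b
    unfold labelCount
    congr 1
    refine filter_congr fun e he => ?_
    rw [mem_product] at he
    rw [hfP _ he.1, hfP _ he.2]
  refine ⟨f', ?_, ?_, ?_, ?_⟩
  · intro v hv y hy hvy
    rcases mem_insert.1 hv with h | h
    · rw [h] at hvy ⊢
      rw [hfx]
      exact (hg y ((hD' y).2 ⟨hy, hvy⟩)).1
    · rw [hfP v h]
      exact hfT v h y hy hvy
  · intro v hv y hy y' hy' hvy hvy' he
    rcases mem_insert.1 hv with h | h
    · rw [h] at hvy hvy' he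
      rw [hfx] at he
      exact hginj ((hD' y).2 ⟨hy, hvy⟩) ((hD' y').2 ⟨hy', hvy'⟩) he
    · rw [hfP v h] at he
      exact hfi v h y hy y' hy' hvy hvy' he
  · intro a b
    -- By injectivity at `x`, a label pair gains at most one new edge in each orientation, and none
    -- if it was heavy. A count below `s ^ 2` thus ends at `s ^ 2 + 1` or less.
    let N₁ := P.filter fun y => H.Adj x y ∧ g y = a ∧ f y x = b
    let N₂ := P.filter fun y => H.Adj x y ∧ g y = b ∧ f y x = a
    have hcard : ∀ c d : Λ, #(P.filter fun y => H.Adj x y ∧ g y = c ∧ f y x = d) ≤ 1 := by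
      intro c d
      refine card_le_one.2 fun y hy y' hy' => ?_
      rw [mem_filter] at hy hy'
      exact hginj ((hD' y).2 ⟨hPB hy.1, hy.2.1⟩) ((hD' y').2 ⟨hPB hy'.1, hy'.2.1⟩)
        (hy.2.2.1.trans hy'.2.2.1.symm)
    have hlow : ∀ c d : Λ, (P.filter fun y => H.Adj x y ∧ g y = c ∧ f y x = d).Nonempty →
        H.labelCount P f c d < s ^ 2 := by
      rintro c d ⟨y, hy⟩
      rw [mem_filter] at hy
      have h1 := (hg y ((hD' y).2 ⟨hPB hy.1, hy.2.1⟩)).2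
      simp only [hr, not_or, not_and, not_le] at h1
      have h2 := h1.2 hy.1
      rwa [hy.2.2.1, hy.2.2.2] at h2
    have hsub : ((insert x P) ×ˢ (insert x P)).filter
        (fun e => H.Adj e.1 e.2 ∧ f' e.1 e.2 = a ∧ f' e.2 e.1 = b) ⊆
        ((P ×ˢ P).filter fun e => H.Adj e.1 e.2 ∧ f' e.1 e.2 = a ∧ f' e.2 e.1 = b) ∪
        (N₁.image fun y => (x, y)) ∪ N₂.image fun y => (y, x) := by
      rintro ⟨v, w⟩ he
      simp only [mem_filter, mem_product] at he
      obtain ⟨⟨hv, hw⟩, hvw, h1, h2⟩ := he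
      rw [mem_union, mem_union]
      rcases mem_insert.1 hv with h3 | h3 <;> rcases mem_insert.1 hw with h4 | h4
      · exact absurd (h3.trans h4.symm) hvw.ne
      · left; right
        rw [h3] at h1 h2 hvw
        rw [hfx] at h1
        rw [hfP w h4] at h2
        exact mem_image.2 ⟨w, mem_filter.2 ⟨h4, hvw, h1, h2⟩, by rw [h3]⟩
      · right
        rw [h4] at h1 h2 hvw
        rw [hfx] at h2
        rw [hfP v h3] at h1
        exact mem_image.2 ⟨v, mem_filter.2 ⟨h3, hvw.symm, h2, h1⟩, by rw [h4]⟩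
      · left; left
        exact mem_filter.2 ⟨mem_product.2 ⟨h3, h4⟩, hvw, h1, h2⟩
    have hle : H.labelCount (insert x P) f' a b ≤ H.labelCount P f a b + #N₁ + #N₂ := by
      rw [← hold]
      refine (card_le_card hsub).trans ((card_union_le _ _).trans ?_)
      refine add_le_add ((card_union_le _ _).trans (add_le_add le_rfl card_image_le)) card_image_le
    have h1 := hfm a b
    have h2 : #N₁ ≤ 1 := hcard a b
    have h3 : #N₂ ≤ 1 := hcard b a
    rcases N₁.eq_empty_or_nonempty with h4 | h4
    · rcases N₂.eq_empty_or_nonempty with h5 | h5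
      · rw [h4, h5, card_empty] at hle
        omega
      · have h6 := hlow b a h5
        rw [labelCount_comm] at h6
        omega
    · have h6 := hlow a b h4
      omega
  · intro y hy a
    by_cases h : H.Adj x y ∧ g y = a
    · have h1 := (hg y ((hD' y).2 ⟨hy, h.1⟩)).2
      simp only [hr, not_or, not_le] at h1
      have h2 := h1.1
      rw [h.2] at h2
      refine le_trans ?_ (Nat.succ_le_of_lt h2)
      have h3 : ((insert x P).filter fun x' => H.Adj x' y ∧ f' x' y = a) ⊆
          insert x (P.filter fun x' => H.Adj x' y ∧ f x' y = a) := by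
        intro v hv
        rw [mem_filter] at hv
        rcases mem_insert.1 hv.1 with h4 | h4
        · exact mem_insert.2 (Or.inl h4)
        · rw [hfP v h4] at hv
          exact mem_insert_of_mem (mem_filter.2 ⟨h4, hv.2⟩)
      exact (card_le_card h3).trans (card_insert_le _ _)
    · refine le_trans (card_le_card fun v hv => ?_) (hfc y hy a)
      rw [mem_filter] at hv ⊢
      rcases mem_insert.1 hv.1 with h4 | h4
      · rw [h4, hfx] at hv
        exact absurd hv.2 h
      · rw [hfP v h4] at hv
        exact ⟨h4, hv.2⟩

/-! ### Routing through spread tokens and a hub -/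

/-- If each vertex of `B` is linked to sufficiently many vertices of `N` and the load of each vertex
of `N` is small, then a hub joined to `N` allows to link all pairs of vertices of `B`. -/
theorem Routes.of_spread [Finite V] {B N R : Finset V} (hBN : Disjoint B N) (hBR : Disjoint B R)
    (hNR : G.Joined N R) {C s Δ : ℕ} (hs0 : 0 < s) (T : V → Finset (V × ℕ))
    (Q : V → V × ℕ → Set (Sym2 V)) (hpos : ∀ x ∈ B, ∀ a ∈ T x, a.1 ∈ N ∧ a.2 ≤ C)
    (hQ : ∀ x ∈ B, ∀ a ∈ T x, Q x a ⊆ (across B N ∪ pairs N) ∩ G.edgeSet ∧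
      (fromEdgeSet (Q x a)).Reachable x a.1)
    (hQd : ∀ x ∈ B, ∀ a ∈ T x, ∀ y ∈ B, ∀ b ∈ T y, (x = y → a = b → False) → Disjoint (Q x a) (Q y b))
    (hT : ∀ x ∈ B, G.codeg B x ≤ #(T x)) (hT' : ∀ x ∈ B, 4 * #B ≤ s * #(T x))
    (hload : ∀ z, ∑ x ∈ B, #((T x).filter fun a => a.1 = z) ≤ Δ)
    (hR : Δ + (C + 1) ^ 2 * (s ^ 2 + 1) ≤ #R) :
    G.Routes (pairs (B ∪ N) ∪ across N R) (pairs B) := by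
  rcases isEmpty_or_nonempty V with hV | hV
  · refine ⟨fun _ => ∅, fun x => (hV.false x).elim, fun e => ?_⟩
    induction e with | _ x
    exact (hV.false x).elim
  obtain ⟨f, hfT, hfi, hfm⟩ := exists_assignment Gᶜ B T hs0 (fun x hx => by
    refine le_trans (le_of_eq ?_) (hT x hx)
    unfold codeg
    congr 1
    refine filter_congr fun y _ => ?_
    rw [compl_adj, ne_comm]) hT'
  -- Each non-adjacent pair of `B` becomes an edge of a multigraph on `N` between the positions of
  -- its two tokens. Loops need no hub and are left out of `F`.
  let ends : Sym2 V → Sym2 V :=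
    Sym2.lift ⟨fun x y => s((f x y).1, (f y x).1), fun x y => Sym2.eq_swap⟩
  have hends : ∀ x y, ends s(x, y) = s((f x y).1, (f y x).1) := fun x y => rfl
  let Qs : Sym2 V → Set (Sym2 V) :=
    Sym2.lift ⟨fun x y => Q x (f x y) ∪ Q y (f y x), fun x y => Set.union_comm _ _⟩
  have hQs : ∀ x y, Qs s(x, y) = Q x (f x y) ∪ Q y (f y x) := fun x y => rfl
  let F : Finset (Sym2 V) := B.sym2.filter fun e => (¬ e.IsDiag ∧ e ∉ G.edgeSet) ∧ ¬ (ends e).IsDiag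
  have hF : ∀ x y, s(x, y) ∈ F ↔ ((x ∈ B ∧ y ∈ B) ∧ (x ≠ y ∧ ¬ G.Adj x y)) ∧ ¬ (ends s(x, y)).IsDiag := by
    intro x y
    simp only [F, mem_filter, mk_mem_sym2_iff, Sym2.mk_isDiag_iff, mem_edgeSet]
    tauto
  have hendsN : ∀ x ∈ B, ∀ y ∈ B, x ≠ y → ¬ G.Adj x y → ∀ v ∈ ends s(x, y), v ∈ N := by
    intro x hx y hy hne hxy v hv
    rw [hends, Sym2.mem_iff] at hv
    rcases hv with rfl | rfl
    · exact (hpos x hx _ (hfT x hx y hy ⟨hne, hxy⟩)).1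
    · exact (hpos y hy _ (hfT y hy x hx ⟨hne.symm, fun h => hxy h.symm⟩)).1
  obtain ⟨c, hc, hcR⟩ := exists_properEdge ends F (fun e he => (mem_filter.1 he).2.2) R (Δ := Δ)
    (μ := (C + 1) ^ 2 * (s ^ 2 + 1)) (by
      intro v
      let D := (B ×ˢ B).filter fun e => Gᶜ.Adj e.1 e.2 ∧ (f e.1 e.2).1 = v
      have h1 : (F.filter fun e => v ∈ ends e) ⊆ D.image fun e => s(e.1, e.2) := by
        intro e he
        obtain ⟨he, hv⟩ := mem_filter.1 he
        induction e with | _ x y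
        obtain ⟨⟨⟨hx, hy⟩, hne, hxy⟩, -⟩ := (hF x y).1 he
        rw [hends, Sym2.mem_iff] at hv
        rcases hv with rfl | rfl
        · exact mem_image.2 ⟨(x, y), mem_filter.2 ⟨mem_product.2 ⟨hx, hy⟩, ⟨hne, hxy⟩, rfl⟩, rfl⟩
        · exact mem_image.2 ⟨(y, x), mem_filter.2 ⟨mem_product.2 ⟨hy, hx⟩,
            ⟨hne.symm, fun h => hxy h.symm⟩, rfl⟩, Sym2.eq_swap⟩
      refine (card_le_card h1).trans (card_image_le.trans (le_trans ?_ (hload v)))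
      rw [← card_sigma]
      refine card_le_card_of_injOn (fun e => ⟨e.1, f e.1 e.2⟩) ?_ ?_
      · intro e he
        obtain ⟨he, h2, h3⟩ := mem_filter.1 he
        rw [mem_product] at he
        simp only [coe_sigma, Set.mem_sigma_iff, mem_coe, mem_filter]
        exact ⟨he.1, hfT _ he.1 _ he.2 h2, h3⟩
      · intro e he d hd hed
        obtain ⟨he, h2, h3⟩ := mem_filter.1 he
        obtain ⟨hd, h4, h5⟩ := mem_filter.1 hd
        rw [mem_product] at he hd
        simp only [Sigma.mk.injEq, heq_eq_eq] at hed
        obtain ⟨h6, h7⟩ := hed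
        refine Prod.ext h6 (hfi _ he.1 _ he.2 _ hd.2 h2 ?_ ?_)
        · rw [h6]; exact h4
        · rw [h7, h6]) (by
      intro w
      induction w with | _ z z'
      -- Parallel edges between two positions are sorted by their label pairs: `(C + 1) ^ 2` pairs,
      -- each met at most `s ^ 2 + 1` times.
      let I := range (C + 1) ×ˢ range (C + 1)
      let D : ℕ × ℕ → Finset (V × V) := fun i => (B ×ˢ B).filter fun e => Gᶜ.Adj e.1 e.2 ∧
        f e.1 e.2 = (z, i.1) ∧ f e.2 e.1 = (z', i.2)
      have h1 : (F.filter fun e => ends e = s(z, z')) ⊆ (I.biUnion D).image fun e => s(e.1, e.2) := by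
        have key : ∀ x ∈ B, ∀ y ∈ B, Gᶜ.Adj x y → (f x y).1 = z → (f y x).1 = z' →
            (x, y) ∈ I.biUnion D := by
          intro x hx y hy hxy h1 h2
          refine mem_biUnion.2 ⟨((f x y).2, (f y x).2), ?_, ?_⟩
          · have h3 := (hpos x hx _ (hfT x hx y hy hxy)).2
            have h4 := (hpos y hy _ (hfT y hy x hx hxy.symm)).2
            exact mem_product.2 ⟨mem_range.2 (by omega), mem_range.2 (by omega)⟩
          · exact mem_filter.2 ⟨mem_product.2 ⟨hx, hy⟩, hxy, Prod.ext h1 rfl, Prod.ext h2 rfl⟩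
        intro e he
        obtain ⟨he, hv⟩ := mem_filter.1 he
        induction e with | _ x y
        obtain ⟨⟨⟨hx, hy⟩, hne, hxy⟩, -⟩ := (hF x y).1 he
        rw [hends, Sym2.eq_iff] at hv
        rcases hv with hv | hv
        · exact mem_image.2 ⟨(x, y), key x hx y hy ⟨hne, hxy⟩ hv.1 hv.2, rfl⟩
        · exact mem_image.2 ⟨(y, x), key y hy x hx ⟨hne.symm, fun h => hxy h.symm⟩ hv.2 hv.1,
            Sym2.eq_swap⟩
      refine (card_le_card h1).trans (card_image_le.trans (card_biUnion_le.trans ?_))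
      refine (sum_le_sum fun i _ => show #(D i) ≤ s ^ 2 + 1 by
        have := hfm (z, i.1) (z', i.2)
        unfold labelCount at this
        convert this).trans (le_of_eq ?_)
      rw [sum_const, card_product, card_range, smul_eq_mul]
      ring) hR
  let P : Sym2 V → Set (Sym2 V) := fun e => if e ∈ G.edgeSet then {e} else
    Qs e ∪ {d | ¬ (ends e).IsDiag ∧ ∃ z ∈ ends e, d = s(z, c e)}
  have hPpos : ∀ e, e ∈ G.edgeSet → P e = {e} := fun e he => if_pos he
  have hPneg : ∀ e, e ∉ G.edgeSet → P e = Qs e ∪ {d | ¬ (ends e).IsDiag ∧ ∃ z ∈ ends e, d = s(z, c e)} :=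
    fun e he => if_neg he
  have hQsub : ∀ e ∈ pairs B, e ∉ G.edgeSet → Qs e ⊆ (across B N ∪ pairs N) ∩ G.edgeSet := by
    intro e he he'
    induction e with | _ x y
    obtain ⟨hne, hx, hy⟩ := mk_mem_pairs.1 he
    rw [hQs]
    exact Set.union_subset (hQ x hx _ (hfT x hx y hy ⟨hne, he'⟩)).1
      (hQ y hy _ (hfT y hy x hx ⟨hne.symm, fun h => he' h.symm⟩)).1
  have hHsub : ∀ e ∈ pairs B, e ∉ G.edgeSet →
      {d | ¬ (ends e).IsDiag ∧ ∃ z ∈ ends e, d = s(z, c e)} ⊆ across N R := by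
    intro e he he'
    induction e with | _ x y
    obtain ⟨hne, hx, hy⟩ := mk_mem_pairs.1 he
    rintro d ⟨h1, z, hz, rfl⟩
    exact ⟨z, hendsN x hx y hy hne he' z hz, _, hcR _ ((hF x y).2 ⟨⟨⟨hx, hy⟩, hne, he'⟩, h1⟩), rfl⟩
  have hNRd := hNR.disjoint
  have dBQ : Disjoint (pairs B) (across B N ∪ pairs N) := by
    rw [Set.disjoint_union_right]
    exact ⟨across_comm (X := N) ▸ disjoint_pairs_across hBN, disjoint_pairs hBN⟩
  have dBH : Disjoint (pairs B) (across N R) := disjoint_pairs_across hBN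
  have dQH : Disjoint (across B N ∪ pairs N) (across N R) := by
    rw [Set.disjoint_union_left]
    exact ⟨disjoint_across hBN hBR, across_comm (X := R) ▸ disjoint_pairs_across hNRd⟩
  refine ⟨P, ?_, ?_⟩
  · intro x y hxy
    obtain ⟨hne, hx, hy⟩ := mk_mem_pairs.1 hxy
    by_cases hadj : s(x, y) ∈ G.edgeSet
    · rw [hPpos _ hadj]
      refine ⟨?_, Adj.reachable ?_⟩
      · rintro _ rfl
        exact ⟨Or.inl (pairs_mono subset_union_left hxy), hadj⟩
      · rw [fromEdgeSet_adj]
        exact ⟨rfl, hne⟩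
    · rw [hPneg _ hadj]
      have hx1 := hfT x hx y hy ⟨hne, hadj⟩
      have hy1 := hfT y hy x hx ⟨hne.symm, fun h => hadj h.symm⟩
      constructor
      · refine Set.union_subset ?_ ?_
        · refine (hQsub _ hxy hadj).trans (Set.inter_subset_inter_left _ ?_)
          exact (Set.union_subset (across_subset_pairs hBN)
            (pairs_mono subset_union_right)).trans Set.subset_union_left
        · intro d hd
          have h1 := hHsub _ hxy hadj hd
          exact ⟨Or.inr h1, across_subset_edgeSet hNR h1⟩
      · set K := fromEdgeSet (Qs s(x, y) ∪ {d | ¬ (ends s(x, y)).IsDiag ∧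
          ∃ z ∈ ends s(x, y), d = s(z, c s(x, y))}) with hK
        have r1 : K.Reachable x (f x y).1 := (hQ x hx _ hx1).2.mono (fromEdgeSet_mono
          (by rw [hQs]; exact fun d hd => Or.inl (Or.inl hd)))
        have r2 : K.Reachable y (f y x).1 := (hQ y hy _ hy1).2.mono (fromEdgeSet_mono
          (by rw [hQs]; exact fun d hd => Or.inl (Or.inr hd)))
        by_cases hd : (ends s(x, y)).IsDiag
        · have h1 := hd
          rw [hends, Sym2.mk_isDiag_iff] at h1
          rw [← h1] at r2
          exact r1.trans r2.symm
        · have hcR' := hcR _ ((hF x y).2 ⟨⟨⟨hx, hy⟩, hne, hadj⟩, hd⟩)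
          have h1 : ∀ z ∈ ends s(x, y), K.Adj z (c s(x, y)) := by
            intro z hz
            rw [hK, fromEdgeSet_adj]
            refine ⟨Or.inr ⟨hd, z, hz, rfl⟩, fun h => ?_⟩
            exact Finset.disjoint_left.1 hNRd (hendsN x hx y hy hne hadj z hz) (h ▸ hcR')
          exact (r1.trans (h1 _ (by rw [hends]; simp)).reachable).trans
            (r2.trans (h1 _ (by rw [hends]; simp)).reachable).symm
  · intro e he e' he' hne
    change Disjoint (P e) (P e')
    by_cases h : e ∈ G.edgeSet <;> by_cases h' : e' ∈ G.edgeSet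
    · rw [hPpos _ h, hPpos _ h']
      simpa using hne
    · rw [hPpos _ h, hPneg _ h', Set.disjoint_union_right]
      have h1 : {e} ⊆ pairs B := Set.singleton_subset_iff.2 he
      exact ⟨dBQ.mono h1 ((hQsub _ he' h').trans Set.inter_subset_left),
        dBH.mono h1 (hHsub _ he' h')⟩
    · rw [hPneg _ h, hPpos _ h', Set.disjoint_union_left]
      have h1 : {e'} ⊆ pairs B := Set.singleton_subset_iff.2 he'
      exact ⟨(dBQ.mono h1 ((hQsub _ he h).trans Set.inter_subset_left)).symm,
        (dBH.mono h1 (hHsub _ he h)).symm⟩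
    · rw [hPneg _ h, hPneg _ h', Set.disjoint_union_left, Set.disjoint_union_right,
        Set.disjoint_union_right]
      have q1 := (hQsub _ he h).trans Set.inter_subset_left
      have q2 := (hQsub _ he' h').trans Set.inter_subset_left
      refine ⟨⟨?_, dQH.mono q1 (hHsub _ he' h')⟩, (dQH.mono q2 (hHsub _ he h)).symm, ?_⟩
      · clear q1 q2
        induction e with | _ x y
        induction e' with | _ x' y'
        obtain ⟨n1, hx, hy⟩ := mk_mem_pairs.1 he
        obtain ⟨n2, hx', hy'⟩ := mk_mem_pairs.1 he'
        have key : ∀ a b a' b', a ∈ B → b ∈ B → a' ∈ B → b' ∈ B → Gᶜ.Adj a b → Gᶜ.Adj a' b' →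
            s(a, b) ≠ s(a', b') → Disjoint (Q a (f a b)) (Q a' (f a' b')) := by
          intro a b a' b' ha hb ha' hb' hab hab' hne
          refine hQd a ha _ (hfT a ha b hb hab) a' ha' _ (hfT a' ha' b' hb' hab') fun h1 h2 => ?_
          subst h1
          exact hne (by rw [hfi a ha b hb b' hb' hab hab' h2])
        have a1 : Gᶜ.Adj x y := ⟨n1, h⟩
        have a2 : Gᶜ.Adj x' y' := ⟨n2, h'⟩
        rw [hQs, hQs, Set.disjoint_union_left, Set.disjoint_union_right, Set.disjoint_union_right]
        refine ⟨⟨key _ _ _ _ hx hy hx' hy' a1 a2 hne, key _ _ _ _ hx hy hy' hx' a1 a2.symm ?_⟩,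
          key _ _ _ _ hy hx hx' hy' a1.symm a2 ?_, key _ _ _ _ hy hx hy' hx' a1.symm a2.symm ?_⟩
        · rwa [Sym2.eq_swap (a := y')]
        · rwa [Sym2.eq_swap (a := y)]
        · rwa [Sym2.eq_swap (a := y), Sym2.eq_swap (a := y')]
      · rw [Set.disjoint_left]
        rintro d ⟨g1, z, hz, rfl⟩ ⟨g2, z', hz', hd⟩
        have hFe : ∀ e ∈ pairs B, e ∉ G.edgeSet → ¬ (ends e).IsDiag →
            e ∈ F ∧ ∀ v ∈ ends e, v ∈ N := by
          intro e he he' hd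
          induction e with | _ x y
          obtain ⟨hne, hx, hy⟩ := mk_mem_pairs.1 he
          exact ⟨(hF x y).2 ⟨⟨⟨hx, hy⟩, hne, he'⟩, hd⟩, hendsN x hx y hy hne he'⟩
        obtain ⟨f1, f2⟩ := hFe e he h g1
        obtain ⟨f3, f4⟩ := hFe e' he' h' g2
        rcases Sym2.eq_iff.1 hd with ⟨h3, h4⟩ | ⟨h3, h4⟩
        · subst h3
          exact hne (hc e f1 e' f3 z hz hz' h4)
        · exact Finset.disjoint_left.1 hNRd (f2 z hz) (h3 ▸ hcR e' f3)

/-- The elements of `U w` are tokens of vertices of `B` that are placed at `w`; for each member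
`(w, z)` of `Ψ` one token is moved from `w` to `z`. -/
theorem Routes.of_tokens [Finite V] [Nonempty V] {B N R : Finset V} (hBN : Disjoint B N) (hBR : Disjoint B R)
    (hNR : G.Joined N R) {C s Δ : ℕ} (hs0 : 0 < s) (U : V → Finset V) (Ψ : Finset (V × V))
    (hU : ∀ w ∈ N, ∀ x ∈ U w, x ∈ B ∧ G.Adj x w)
    (hΨ : ∀ w z, (w, z) ∈ Ψ → w ∈ N ∧ z ∈ N ∧ G.Adj w z ∧ (z, w) ∉ Ψ)
    (hC : ∀ e ∈ Ψ, C * #(Ψ.filter fun d => d.1 = e.1) + #(Ψ.filter fun d => d.2 = e.2) ≤ C * #(U e.1))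
    (hT : ∀ x ∈ B, G.codeg B x ≤ #(N.filter fun w => x ∈ U w))
    (hT' : ∀ x ∈ B, 4 * #B ≤ s * #(N.filter fun w => x ∈ U w))
    (hload : ∀ z ∈ N, #(U z) + #(Ψ.filter fun d => d.2 = z) ≤ Δ + #(Ψ.filter fun d => d.1 = z))
    (hR : Δ + (C + 1) ^ 2 * (s ^ 2 + 1) ≤ #R) :
    G.Routes (pairs (B ∪ N) ∪ across N R) (pairs B) := by
  obtain ⟨g, hgU, hg1, hg2⟩ := exists_transfers Ψ U C hC
  have hdis := Finset.disjoint_left.1 hBN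
  -- the final position of the token of `x` at `w`
  let lab : V → V → V × ℕ := fun x w =>
    if h : ∃ z, (w, z) ∈ Ψ ∧ (g (w, z)).1 = x then (h.choose, (g (w, h.choose)).2 + 1) else (w, 0)
  have hlab : ∀ x w, (∀ z, (w, z) ∈ Ψ → (g (w, z)).1 = x → lab x w = (z, (g (w, z)).2 + 1)) := by
    intro x w z hz hx
    have h : ∃ z, (w, z) ∈ Ψ ∧ (g (w, z)).1 = x := ⟨z, hz, hx⟩
    have h1 : h.choose = z := by
      have := hg1 _ h.choose_spec.1 _ hz rfl (h.choose_spec.2.trans hx.symm)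
      exact (Prod.ext_iff.1 this).2
    simp only [lab]
    rw [dif_pos h, h1]
  have hlab0 : ∀ x w, (¬ ∃ z, (w, z) ∈ Ψ ∧ (g (w, z)).1 = x) → lab x w = (w, 0) := by
    intro x w h
    simp only [lab]
    rw [dif_neg h]
  let W : V → Finset V := fun x => N.filter fun w => x ∈ U w
  have hW : ∀ x w, w ∈ W x ↔ w ∈ N ∧ x ∈ U w := fun x w => mem_filter
  -- Labels keep two tokens of `x` apart when they arrive at the same vertex, so no token is lost in
  -- `T`.
  have hinj : ∀ x w w', lab x w = lab x w' → w = w' := by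
    intro x w w' he
    by_cases h : ∃ z, (w, z) ∈ Ψ ∧ (g (w, z)).1 = x
    · obtain ⟨z, hz, hzx⟩ := h
      rw [hlab x w z hz hzx] at he
      by_cases h' : ∃ z, (w', z) ∈ Ψ ∧ (g (w', z)).1 = x
      · obtain ⟨z', hz', hzx'⟩ := h'
        rw [hlab x w' z' hz' hzx'] at he
        simp only [Prod.mk.injEq, add_left_inj] at he
        have := hg2 _ hz _ hz' he.1 (Prod.ext (hzx.trans hzx'.symm) he.2)
        exact (Prod.ext_iff.1 this).1
      · rw [hlab0 x w' h'] at he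
        simp at he
    · rw [hlab0 x w h] at he
      by_cases h' : ∃ z, (w', z) ∈ Ψ ∧ (g (w', z)).1 = x
      · obtain ⟨z', hz', hzx'⟩ := h'
        rw [hlab x w' z' hz' hzx'] at he
        simp at he
      · rw [hlab0 x w' h'] at he
        exact (Prod.ext_iff.1 he).1
  let T : V → Finset (V × ℕ) := fun x => (W x).image (lab x)
  have hTc : ∀ x, #(T x) = #(W x) := fun x =>
    card_image_of_injective _ fun w w' h => hinj x w w' h
  let q : V → V → Set (Sym2 V) := fun x w =>
    {d | d = s(x, w) ∨ ∃ z, (w, z) ∈ Ψ ∧ (g (w, z)).1 = x ∧ d = s(w, z)}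
  let Q : V → V × ℕ → Set (Sym2 V) := fun x a => {d | ∃ w ∈ W x, lab x w = a ∧ d ∈ q x w}
  have hQ : ∀ x, ∀ w ∈ W x, Q x (lab x w) = q x w := by
    intro x w hw
    ext d
    constructor
    · rintro ⟨w', _, h1, h2⟩
      rwa [hinj x w' w h1] at h2
    · exact fun h => ⟨w, hw, rfl, h⟩
  refine Routes.of_spread (C := C) (s := s) (Δ := Δ) hBN hBR hNR hs0 T Q ?_ ?_ ?_ ?_ ?_ ?_ hR
  · intro x hx a ha
    obtain ⟨w, hw, rfl⟩ := mem_image.1 ha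
    by_cases h : ∃ z, (w, z) ∈ Ψ ∧ (g (w, z)).1 = x
    · obtain ⟨z, hz, hzx⟩ := h
      rw [hlab x w z hz hzx]
      exact ⟨(hΨ w z hz).2.1, (hgU _ hz).2⟩
    · rw [hlab0 x w h]
      exact ⟨((hW x w).1 hw).1, Nat.zero_le _⟩
  · intro x hx a ha
    obtain ⟨w, hw, rfl⟩ := mem_image.1 ha
    rw [hQ x w hw]
    obtain ⟨hwN, hxU⟩ := (hW x w).1 hw
    have hadj := (hU w hwN x hxU).2
    constructor
    · rintro d (rfl | ⟨z, hz, _, rfl⟩)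
      · exact ⟨Or.inl ⟨x, hx, w, hwN, rfl⟩, hadj⟩
      · obtain ⟨_, h2, h3, _⟩ := hΨ w z hz
        exact ⟨Or.inr (mk_mem_pairs.2 ⟨h3.ne, hwN, h2⟩), h3⟩
    · have h1 : (fromEdgeSet (q x w)).Reachable x w := by
        refine Adj.reachable ?_
        rw [fromEdgeSet_adj]
        exact ⟨Or.inl rfl, hadj.ne⟩
      by_cases h : ∃ z, (w, z) ∈ Ψ ∧ (g (w, z)).1 = x
      · obtain ⟨z, hz, hzx⟩ := h
        rw [hlab x w z hz hzx]
        refine h1.trans (Adj.reachable ?_)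
        rw [fromEdgeSet_adj]
        exact ⟨Or.inr ⟨z, hz, hzx, rfl⟩, (hΨ w z hz).2.2.1.ne⟩
      · rw [hlab0 x w h]
        exact h1
  · intro x hx a ha y hy b hb hne
    obtain ⟨w, hw, rfl⟩ := mem_image.1 ha
    obtain ⟨w', hw', rfl⟩ := mem_image.1 hb
    rw [hQ x w hw, hQ y w' hw', Set.disjoint_left]
    have hwN := ((hW x w).1 hw).1
    have hwN' := ((hW y w').1 hw').1
    have hne' : ¬ (x = y ∧ w = w') := by
      rintro ⟨rfl, rfl⟩
      exact hne rfl rfl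
    rintro d (rfl | ⟨z, hz, hzx, rfl⟩) (hd | ⟨z', hz', hzx', hd⟩)
    · rcases Sym2.eq_iff.1 hd with h | h
      · exact hne' h
      · exact hdis hx (h.1 ▸ hwN')
    · rcases Sym2.eq_iff.1 hd with h | h
      · exact hdis hx (h.1 ▸ hwN')
      · exact hdis hx (h.1 ▸ (hΨ w' z' hz').2.1)
    · rcases Sym2.eq_iff.1 hd with h | h
      · exact hdis hy (h.1 ▸ hwN)
      · exact hdis hy (h.2 ▸ (hΨ w z hz).2.1)
    · rcases Sym2.eq_iff.1 hd with ⟨h1, h2⟩ | ⟨h1, h2⟩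
      · subst h1 h2
        exact hne' ⟨hzx.symm.trans hzx', rfl⟩
      · subst h1 h2
        exact (hΨ _ _ hz).2.2.2 hz'
  · intro x hx
    rw [hTc]
    exact hT x hx
  · intro x hx
    rw [hTc]
    exact hT' x hx
  · intro z
    by_cases hzN : z ∈ N
    · rw [← card_sigma]
      let O := Ψ.filter fun d => d.1 = z
      let I := Ψ.filter fun d => d.2 = z
      have hOU : O.image (fun d => (g d).1) ⊆ U z := by
        intro x hx
        obtain ⟨d, hd, rfl⟩ := mem_image.1 hx
        obtain ⟨hd1, rfl⟩ := mem_filter.1 hd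
        exact (hgU d hd1).1
      have hOc : #(O.image fun d => (g d).1) = #O := by
        refine card_image_of_injOn fun d hd d' hd' h => ?_
        obtain ⟨hd, h1⟩ := mem_filter.1 hd
        obtain ⟨hd', h2⟩ := mem_filter.1 hd'
        exact hg1 d hd d' hd' (h1.trans h2.symm) h
      have hsub : (B.sigma fun x => (T x).filter fun a => a.1 = z) ⊆
          ((U z \ O.image fun d => (g d).1).image fun x => (⟨x, (z, 0)⟩ : Σ _ : V, V × ℕ)) ∪
          I.image fun d => (⟨(g d).1, (z, (g d).2 + 1)⟩ : Σ _ : V, V × ℕ) := by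
        rintro ⟨x, a⟩ hxa
        rw [mem_sigma] at hxa
        obtain ⟨hx, ha⟩ := hxa
        obtain ⟨ha, haz⟩ := mem_filter.1 ha
        obtain ⟨w, hw, hwa⟩ := mem_image.1 ha
        dsimp only at hwa
        subst hwa
        rw [mem_union]
        by_cases h : ∃ z, (w, z) ∈ Ψ ∧ (g (w, z)).1 = x
        · obtain ⟨z', hz, hzx⟩ := h
          right
          dsimp only at haz
          rw [hlab x w z' hz hzx] at haz ⊢
          change z' = z at haz
          subst haz
          exact mem_image.2 ⟨(w, z'), mem_filter.2 ⟨hz, rfl⟩, by rw [hzx]⟩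
        · left
          dsimp only at haz
          rw [hlab0 x w h] at haz ⊢
          change w = z at haz
          subst haz
          refine mem_image.2 ⟨x, mem_sdiff.2 ⟨((hW x w).1 hw).2, fun h' => h ?_⟩, rfl⟩
          obtain ⟨d, hd, hdx⟩ := mem_image.1 h'
          obtain ⟨hd1, rfl⟩ := mem_filter.1 hd
          exact ⟨d.2, hd1, hdx⟩
      refine (card_le_card hsub).trans ((card_union_le _ _).trans ?_)
      have h1 := hload z hzN
      have h2 : #((U z \ O.image fun d => (g d).1).image fun x => (⟨x, (z, 0)⟩ : Σ _ : V, V × ℕ)) ≤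
          #(U z) - #O := by
        refine card_image_le.trans (le_of_eq ?_)
        rw [card_sdiff_of_subset hOU, hOc]
      have h3 : #(I.image fun d => (⟨(g d).1, (z, (g d).2 + 1)⟩ : Σ _ : V, V × ℕ)) ≤ #I := card_image_le
      have h4 := card_le_card hOU
      rw [hOc] at h4
      change #(U z) + #I ≤ Δ + #O at h1
      omega
    · rw [sum_eq_zero]
      · exact Nat.zero_le _
      intro x hx
      rw [card_eq_zero, filter_eq_empty_iff]
      intro a ha haz
      obtain ⟨w, hw, rfl⟩ := mem_image.1 ha
      apply hzN
      rw [← haz]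
      by_cases h : ∃ z, (w, z) ∈ Ψ ∧ (g (w, z)).1 = x
      · obtain ⟨z, hz, hzx⟩ := h
        rw [hlab x w z hz hzx]
        exact (hΨ w z hz).2.1
      · rw [hlab0 x w h]
        exact ((hW x w).1 hw).1

/-! ### Rounding the hub set, the tokens and their moves -/

/-- The constant form is rounded along with the family, so the rounded set has size within `c * b`
of `q`. Adding or deleting that many elements changes each form by at most another `c * b`. -/
theorem RoundsWithin.exists_subset_card_eq {c : ℝ} {b q : ℕ} (hr : RoundsWithin.{u} c b)
    {J : Type u} (hX : #X = q + b) (hq : q ≤ 2 * b) (hb : 0 < b) (I : Finset J) (hI : #I + 1 ≤ 20 * b)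
    (w : J → V → ℝ) (hw : ∀ j ∈ I, ∀ x ∈ X, |w j x| ≤ 1) :
    ∃ N ⊆ X, #N = q ∧ ∀ j ∈ I,
      |∑ x ∈ N, w j x - q / (q + b) * ∑ x ∈ X, w j x| ≤ 2 * c * b := by
  have hb' : (0 : ℝ) < b := by exact_mod_cast hb
  have hqb : (0 : ℝ) < q + b := by positivity
  have hX' : (#X : ℝ) = q + b := by exact_mod_cast hX
  have hq' : (q : ℝ) ≤ 2 * b := by exact_mod_cast hq
  obtain ⟨S, hSX, -, hS⟩ := hr V (Option J) X (insertNone I) (fun _ => q / (q + b))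
    (fun j x => j.elim 1 fun j => w j x) (fun x _ => ⟨by positivity, by
      rw [div_le_one hqb]; linarith⟩)
    (by
      intro j hj x hx
      cases j with
      | none => simp
      | some j => exact hw j (some_mem_insertNone.1 hj) x hx)
    (by
      intro j hj
      have h1 : ∀ x ∈ X, (j.elim 1 fun j => w j x : ℝ) ^ 2 ≤ 1 := by
        intro x hx
        cases j with
        | none => simp
        | some j =>
          have := hw j (some_mem_insertNone.1 hj) x hx
          exact (sq_le_one_iff_abs_le_one _).2 this
      refine (sum_le_sum h1).trans ?_
      rw [sum_const, nsmul_eq_mul, mul_one, hX']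
      linarith)
    (by rwa [card_insertNone])
  have hS0 := hS none (by simp)
  simp only [Option.elim_none, sum_const, nsmul_eq_mul, mul_one, hX'] at hS0
  rw [mul_div_cancel₀ _ hqb.ne'] at hS0
  have hmain : ∃ N ⊆ X, #N = q ∧ ∀ φ : V → ℝ, (∀ x ∈ X, |φ x| ≤ 1) →
      |∑ x ∈ N, φ x - ∑ x ∈ S, φ x| ≤ c * b := by
    have hdiff : ∀ A B : Finset V, A ⊆ B → B ⊆ X → (#B : ℝ) - #A ≤ c * b → ∀ φ : V → ℝ,
        (∀ x ∈ X, |φ x| ≤ 1) → |∑ x ∈ B, φ x - ∑ x ∈ A, φ x| ≤ c * b := by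
      intro A B hAB hBX hc φ hφ
      rw [← sum_sdiff hAB, add_sub_cancel_right]
      refine (abs_sum_le_sum_abs _ _).trans ((sum_le_sum fun x hx => hφ x
        (hBX (mem_sdiff.1 hx).1)).trans ?_)
      rw [sum_const, nsmul_eq_mul, mul_one, card_sdiff_of_subset hAB, Nat.cast_sub (card_le_card hAB)]
      exact hc
    rcases le_total #S q with h | h
    · obtain ⟨N, hSN, hNX, hN⟩ := exists_subsuperset_card_eq hSX h (by omega)
      refine ⟨N, hNX, hN, hdiff S N hSN hNX ?_⟩
      rw [hN]
      have := (abs_le.1 hS0).1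
      linarith
    · obtain ⟨N, hNS, hN⟩ := Finset.exists_subset_card_eq h
      refine ⟨N, hNS.trans hSX, hN, fun φ hφ => ?_⟩
      rw [abs_sub_comm]
      refine hdiff N S hNS hSX ?_ φ hφ
      rw [hN]
      exact (abs_le.1 hS0).2
  obtain ⟨N, hNX, hN, hφ⟩ := hmain
  refine ⟨N, hNX, hN, fun j hj => ?_⟩
  have h1 := hφ (w j) (hw j hj)
  have h2 := hS (some j) (by simpa using hj)
  simp only [Option.elim_some] at h2
  rw [← mul_sum] at h2
  have h3 := abs_le.1 h1
  have h4 := abs_le.1 h2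
  rw [abs_le]
  constructor <;> linarith [h3.1, h3.2, h4.1, h4.2]

/-- Rounding the weights `ρ x` of the pairs from `B` to `N` and the weights `κ * (ρ z - ρ w)` of
the ascending pairs in `N`. -/
theorem RoundsWithin.exists_tokens {c κ : ℝ} {b : ℕ} (hr : RoundsWithin.{u} c b) {B N : Finset V}
    (hBN : Disjoint B N) (hcard : #B + #N ≤ 3 * b) (ρ : V → ℝ) (hκ : 0 ≤ κ)
    (hρ : ∀ x ∈ B, 0 ≤ ρ x ∧ ρ x ≤ 1) (hκρ : ∀ w ∈ N, ∀ z ∈ N, κ * (ρ z - ρ w) ≤ 1) :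
    ∃ (U : V → Finset V) (Ψ : Finset (V × V)),
      (∀ w ∈ N, ∀ x ∈ U w, x ∈ B ∧ G.Adj x w) ∧
      (∀ w z, (w, z) ∈ Ψ → w ∈ N ∧ z ∈ N ∧ G.Adj w z ∧ (z, w) ∉ Ψ) ∧
      (∀ x ∈ B, ρ x = 1 → ∀ w ∈ N, G.Adj x w → x ∈ U w) ∧
      (∀ x ∈ B, |(#(N.filter fun w => x ∈ U w) : ℝ) - ρ x * #(N.filter (G.Adj x))| ≤ c * b) ∧
      (∀ z ∈ N, |(#(U z) : ℝ) - ∑ x ∈ B.filter (G.Adj z), ρ x| ≤ c * b) ∧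
      (∀ w ∈ N, |(#(Ψ.filter fun d => d.1 = w) : ℝ) -
        κ * ∑ z ∈ N.filter (G.Adj w), max (ρ z - ρ w) 0| ≤ c * b) ∧
      ∀ z ∈ N, |(#(Ψ.filter fun d => d.2 = z) : ℝ) -
        κ * ∑ w ∈ N.filter (G.Adj z), max (ρ z - ρ w) 0| ≤ c * b := by
  have hdis := Finset.disjoint_left.1 hBN
  obtain ⟨E, hE⟩ : ∃ E : Finset (V × V), ∀ x w, (x, w) ∈ E ↔ (x ∈ B ∧ w ∈ N) ∧ G.Adj x w :=
    ⟨(B ×ˢ N).filter fun e => G.Adj e.1 e.2, fun x w => by simp⟩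
  obtain ⟨E', hE'⟩ : ∃ E' : Finset (V × V), ∀ x w, (x, w) ∈ E' ↔
      (x ∈ N ∧ w ∈ N) ∧ G.Adj x w ∧ ρ x < ρ w :=
    ⟨(N ×ˢ N).filter fun e => G.Adj e.1 e.2 ∧ ρ e.1 < ρ e.2, fun x w => by simp⟩
  have hEE : Disjoint E E' := by
    rw [Finset.disjoint_left]
    rintro ⟨x, w⟩ h h'
    exact hdis ((hE x w).1 h).1.1 ((hE' x w).1 h').1.1
  -- Both kinds of pairs are rounded at once; a pair is of the second kind exactly if its first
  -- entry lies in `N`.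
  let p : V × V → ℝ := fun e => if e.1 ∈ N then κ * (ρ e.2 - ρ e.1) else ρ e.1
  have hpE : ∀ e ∈ E, p e = ρ e.1 := fun e he => if_neg (hdis ((hE e.1 e.2).1 he).1.1)
  have hpE' : ∀ e ∈ E', p e = κ * (ρ e.2 - ρ e.1) := fun e he => if_pos ((hE' e.1 e.2).1 he).1.1
  let J := V × ULift.{u} Bool × ULift.{u} Bool
  -- the first flag selects the coordinate, the second one the type of the pair
  let φ : J → V × V → ℝ := fun j e =>
    if (if j.2.1.down then e.1 else e.2) = j.1 ∧ (e.1 ∈ N ↔ j.2.2.down = true) then 1 else 0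
  have hφ : ∀ j e, φ j e = 0 ∨ φ j e = 1 := by
    intro j e
    simp only [φ]
    split_ifs <;> simp
  have hsub : E ∪ E' ⊆ (B ∪ N) ×ˢ N := by
    rintro ⟨x, w⟩ h
    rw [mem_union, hE, hE'] at h
    rw [mem_product, mem_union]
    tauto
  obtain ⟨S, hS, hS1, hS2⟩ := hr (V × V) J (E ∪ E')
    ((B ∪ N) ×ˢ (univ : Finset (ULift.{u} Bool × ULift.{u} Bool))) p φ
    (by
      intro e he
      rcases mem_union.1 he with h | h
      · rw [hpE e h]
        exact hρ _ ((hE e.1 e.2).1 h).1.1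
      · rw [hpE' e h]
        obtain ⟨h1, h2, h3⟩ := (hE' e.1 e.2).1 h
        exact ⟨mul_nonneg hκ (by linarith), hκρ _ h1.1 _ h1.2⟩)
    (by
      intro j _ e _
      rcases hφ j e with h | h <;> simp [h])
    (by
      intro j _
      have h1 : ∀ e ∈ E ∪ E', φ j e ^ 2 ≤ if (if j.2.1.down then e.1 else e.2) = j.1 then 1 else 0 := by
        intro e _
        simp only [φ]
        split_ifs <;> simp_all
      refine (sum_le_sum h1).trans ?_
      rw [sum_boole]
      have h2 : #((E ∪ E').filter fun e => (if j.2.1.down then e.1 else e.2) = j.1) ≤ #(B ∪ N) := by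
        by_cases hj : j.2.1.down = true
        · refine card_le_card_of_injOn Prod.snd (fun e he => ?_) fun e he d hd hed => ?_
          · exact mem_union_right _ (mem_product.1 (hsub (mem_filter.1 he).1)).2
          · have h3 := (mem_filter.1 he).2
            have h4 := (mem_filter.1 hd).2
            rw [if_pos hj] at h3 h4
            exact Prod.ext (h3.trans h4.symm) hed
        · refine card_le_card_of_injOn Prod.fst (fun e he => ?_) fun e he d hd hed => ?_
          · exact (mem_product.1 (hsub (mem_filter.1 he).1)).1
          · have h3 := (mem_filter.1 he).2
            have h4 := (mem_filter.1 hd).2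
            rw [if_neg hj] at h3 h4
            exact Prod.ext hed (h3.trans h4.symm)
      have h3 := h2.trans ((card_union_le B N).trans hcard)
      exact_mod_cast h3)
    (by
      have h1 := card_union_le B N
      rw [card_product]
      have h2 : #(univ : Finset (ULift.{u} Bool × ULift.{u} Bool)) = 4 := by simp
      rw [h2]
      omega)
  have hSE : ∀ x w, (x, w) ∈ S → x ∉ N → (x, w) ∈ E := by
    intro x w h hx
    rcases mem_union.1 (hS h) with h' | h'
    exacts [h', absurd ((hE' x w).1 h').1.1 hx]
  have hSE' : ∀ x w, (x, w) ∈ S → x ∈ N → (x, w) ∈ E' := by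
    intro x w h hx
    rcases mem_union.1 (hS h) with h' | h'
    exacts [absurd hx (hdis ((hE x w).1 h').1.1), h']
  -- the sums of the forms over the weighted pairs
  have hsum : ∀ j : J, ∑ e ∈ E ∪ E', p e * φ j e = if j.2.2.down then
      ∑ e ∈ E'.filter fun e => (if j.2.1.down then e.1 else e.2) = j.1, κ * (ρ e.2 - ρ e.1) else
      ∑ e ∈ E.filter fun e => (if j.2.1.down then e.1 else e.2) = j.1, ρ e.1 := by
    intro j
    have hNE : ∀ e ∈ E, e.1 ∉ N := fun e he => hdis ((hE e.1 e.2).1 he).1.1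
    have hNE' : ∀ e ∈ E', e.1 ∈ N := fun e he => ((hE' e.1 e.2).1 he).1.1
    rw [sum_union hEE]
    by_cases hj : j.2.2.down = true
    · rw [if_pos hj, sum_eq_zero, zero_add, sum_filter]
      · refine sum_congr rfl fun e he => ?_
        rw [hpE' e he]
        simp [φ, hNE' e he, hj]
      · intro e he
        simp [φ, hNE e he, hj]
    · rw [if_neg hj, add_comm, sum_eq_zero, zero_add, sum_filter]
      · refine sum_congr rfl fun e he => ?_
        rw [hpE e he]
        simp [φ, hNE e he, hj]
      · intro e he
        simp [φ, hNE' e he, hj]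
  have hcount : ∀ j : J, ∑ e ∈ S, φ j e = #(S.filter fun e => (if j.2.1.down then e.1 else e.2) = j.1 ∧
      (e.1 ∈ N ↔ j.2.2.down = true)) := fun j => by
    simp only [φ]
    rw [sum_boole]
  have hfst : ∀ (A : Finset (V × V)) (x : V) (P : V → Prop), (∀ w, (x, w) ∈ A ↔ w ∈ N ∧ P w) →
      ∀ F : V × V → ℝ, ∑ e ∈ A.filter (fun e => e.1 = x), F e = ∑ w ∈ N.filter P, F (x, w) := by
    intro A x P h F
    refine (sum_bij (fun w _ => (x, w)) ?_ ?_ ?_ ?_).symm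
    · intro w hw
      exact mem_filter.2 ⟨(h w).2 (mem_filter.1 hw), rfl⟩
    · intro w _ w' _ he
      exact (Prod.ext_iff.1 he).2
    · rintro ⟨y, w⟩ he
      obtain ⟨he1, rfl⟩ := mem_filter.1 he
      exact ⟨w, mem_filter.2 ((h w).1 he1), rfl⟩
    · intro w _
      rfl
  have hsnd : ∀ (A : Finset (V × V)) (M : Finset V) (z : V) (P : V → Prop),
      (∀ w, (w, z) ∈ A ↔ w ∈ M ∧ P w) →
      ∀ F : V × V → ℝ, ∑ e ∈ A.filter (fun e => e.2 = z), F e = ∑ w ∈ M.filter P, F (w, z) := by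
    intro A M z P h F
    refine (sum_bij (fun w _ => (w, z)) ?_ ?_ ?_ ?_).symm
    · intro w hw
      exact mem_filter.2 ⟨(h w).2 (mem_filter.1 hw), rfl⟩
    · intro w _ w' _ he
      exact (Prod.ext_iff.1 he).1
    · rintro ⟨w, y⟩ he
      obtain ⟨he1, rfl⟩ := mem_filter.1 he
      exact ⟨w, mem_filter.2 ((h w).1 he1), rfl⟩
    · intro w _
      rfl
  refine ⟨fun w => B.filter fun x => (x, w) ∈ S, S.filter fun e => e.1 ∈ N, ?_, ?_, ?_, ?_, ?_, ?_, ?_⟩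
  · intro w _ x hx
    obtain ⟨hxB, hx⟩ := mem_filter.1 hx
    exact ⟨hxB, ((hE x w).1 (hSE x w hx (hdis hxB))).2⟩
  · intro w z h
    obtain ⟨h1, h2⟩ := mem_filter.1 h
    obtain ⟨h3, h4, h5⟩ := (hE' w z).1 (hSE' w z h1 h2)
    refine ⟨h3.1, h3.2, h4, fun h' => ?_⟩
    obtain ⟨h6, h7⟩ := mem_filter.1 h'
    exact lt_asymm h5 ((hE' z w).1 (hSE' z w h6 h7)).2.2
  · intro x hx h1 w hw hxw
    have h2 := (hE x w).2 ⟨⟨hx, hw⟩, hxw⟩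
    exact mem_filter.2 ⟨hx, hS1 (x, w) (mem_union_left _ h2) (by rw [hpE _ h2, h1])⟩
  · intro x hx
    have h1 := hS2 (x, ⟨true⟩, ⟨false⟩) (mem_product.2 ⟨mem_union_left _ hx, mem_univ _⟩)
    rw [hsum, hcount] at h1
    simp only [if_true, Bool.false_eq_true, if_false, iff_false] at h1
    rw [hfst E x (G.Adj x) (fun w => by rw [hE]; tauto) (fun e => ρ e.1)] at h1
    simp only [sum_const, nsmul_eq_mul] at h1
    rw [mul_comm _ (ρ x)] at h1
    convert h1 using 4
    refine card_bij (fun w _ => (x, w)) ?_ ?_ ?_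
    · intro w hw
      exact mem_filter.2 ⟨(mem_filter.1 (mem_filter.1 hw).2).2, rfl, hdis hx⟩
    · intro w _ w' _ he
      exact (Prod.ext_iff.1 he).2
    · rintro ⟨y, w⟩ he
      obtain ⟨he1, rfl, -⟩ := mem_filter.1 he
      exact ⟨w, mem_filter.2 ⟨((hE y w).1 (hSE y w he1 (hdis hx))).1.2, mem_filter.2 ⟨hx, he1⟩⟩, rfl⟩
  · intro z hz
    have h1 := hS2 (z, ⟨false⟩, ⟨false⟩) (mem_product.2 ⟨mem_union_right _ hz, mem_univ _⟩)
    rw [hsum, hcount] at h1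
    simp only [Bool.false_eq_true, if_false, iff_false] at h1
    rw [hsnd E B z (G.Adj z) (fun w => by rw [hE, G.adj_comm]; tauto) (fun e => ρ e.1)] at h1
    convert h1 using 4
    refine card_bij (fun w _ => (w, z)) ?_ ?_ ?_
    · intro w hw
      exact mem_filter.2 ⟨(mem_filter.1 hw).2, rfl, hdis (mem_filter.1 hw).1⟩
    · intro w _ w' _ he
      exact (Prod.ext_iff.1 he).1
    · rintro ⟨w, y⟩ he
      obtain ⟨he1, rfl, hw⟩ := mem_filter.1 he
      exact ⟨w, mem_filter.2 ⟨((hE w y).1 (hSE w y he1 hw)).1.1, he1⟩, rfl⟩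
  · intro w hw
    have h1 := hS2 (w, ⟨true⟩, ⟨true⟩) (mem_product.2 ⟨mem_union_right _ hw, mem_univ _⟩)
    rw [hsum, hcount] at h1
    simp only [if_true, iff_true] at h1
    rw [hfst E' w (fun z => G.Adj w z ∧ ρ w < ρ z) (fun z => by rw [hE']; tauto)
      (fun e => κ * (ρ e.2 - ρ e.1))] at h1
    rw [filter_filter]
    convert h1 using 3
    · congr 2
      ext e
      simp only [mem_filter]
      tauto
    · rw [← mul_sum, sum_filter, sum_filter]
      congr 1
      refine sum_congr rfl fun z _ => ?_
      by_cases h : ρ w < ρ z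
      · simp only [h, and_true]
        rw [max_eq_left (by linarith)]
      · simp only [h, and_false, if_false]
        rw [max_eq_right (by linarith), ite_self]
  · intro z hz
    have h1 := hS2 (z, ⟨false⟩, ⟨true⟩) (mem_product.2 ⟨mem_union_right _ hz, mem_univ _⟩)
    rw [hsum, hcount] at h1
    simp only [if_true, Bool.false_eq_true, if_false, iff_true] at h1
    rw [hsnd E' N z (fun w => G.Adj z w ∧ ρ w < ρ z) (fun w => by rw [hE', G.adj_comm]; tauto)
      (fun e => κ * (ρ e.2 - ρ e.1))] at h1
    rw [filter_filter]
    convert h1 using 3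
    · congr 2
      ext e
      simp only [mem_filter]
      tauto
    · rw [← mul_sum, sum_filter, sum_filter]
      congr 1
      refine sum_congr rfl fun w _ => ?_
      by_cases h : ρ w < ρ z
      · simp only [h, and_true]
        rw [max_eq_left (by linarith)]
      · simp only [h, and_false, if_false]
        rw [max_eq_right (by linarith), ite_self]

/-- `N` is to look like a random subset of density `q / (q + b)`. The four forms at each vertex are
those needed later for token numbers, loads, and outgoing and incoming moves. -/
theorem RoundsWithin.exists_balanced {c : ℝ} {b q : ℕ} (hr : RoundsWithin.{u} c b)
    (hX : #X = q + b) (hq : q ≤ 2 * b) (hb : 0 < b) (ρ : V → ℝ)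
    (hρ : ∀ x ∈ X, 0 ≤ ρ x ∧ ρ x ≤ 1) :
    ∃ N ⊆ X, #N = q ∧ ∀ v ∈ X,
      |(#(N.filter (G.Adj v)) : ℝ) - q / (q + b) * #(X.filter (G.Adj v))| ≤ 2 * c * b ∧
      |∑ x ∈ N.filter (G.Adj v), ρ x - q / (q + b) * ∑ x ∈ X.filter (G.Adj v), ρ x| ≤ 2 * c * b ∧
      |∑ x ∈ N.filter (G.Adj v), max (ρ x - ρ v) 0 -
        q / (q + b) * ∑ x ∈ X.filter (G.Adj v), max (ρ x - ρ v) 0| ≤ 2 * c * b ∧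
      |∑ x ∈ N.filter (G.Adj v), max (ρ v - ρ x) 0 -
        q / (q + b) * ∑ x ∈ X.filter (G.Adj v), max (ρ v - ρ x) 0| ≤ 2 * c * b := by
  let F : ULift.{u} Bool × ULift.{u} Bool → V → V → ℝ := fun i v x =>
    if i.1.down then if i.2.down then 1 else ρ x
    else if i.2.down then max (ρ x - ρ v) 0 else max (ρ v - ρ x) 0
  obtain ⟨N, hNX, hN, h⟩ := hr.exists_subset_card_eq hX hq hb
    (J := V × ULift.{u} Bool × ULift.{u} Bool) (X ×ˢ univ) (by
      rw [card_product, hX]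
      have h2 : #(univ : Finset (ULift.{u} Bool × ULift.{u} Bool)) = 4 := by simp
      rw [h2]
      omega) (fun j x => if G.Adj j.1 x then F j.2 j.1 x else 0) (by
      rintro ⟨v, ⟨i⟩, ⟨i'⟩⟩ hj x hx
      have hv := (mem_product.1 hj).1
      have h1 := hρ x hx
      have h2 := hρ v hv
      dsimp only
      split_ifs
      · cases i <;> cases i' <;> simp only [F, if_true, if_false, Bool.false_eq_true]
        · rw [abs_of_nonneg (le_max_right _ _)]
          exact max_le (by linarith) zero_le_one
        · rw [abs_of_nonneg (le_max_right _ _)]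
          exact max_le (by linarith) zero_le_one
        · rw [abs_of_nonneg h1.1]
          exact h1.2
        · simp
      · simp)
  refine ⟨N, hNX, hN, fun v hv => ?_⟩
  have key : ∀ i i', _ := fun i i' => h (v, ⟨i⟩, ⟨i'⟩) (mem_product.2 ⟨hv, mem_univ _⟩)
  simp only [← sum_filter, F] at key
  refine ⟨?_, ?_, ?_, ?_⟩
  · have := key true true
    simpa using this
  · have := key true false
    simpa using this
  · have := key false true
    simpa using this
  · have := key false false
    simpa using this

/-! ### The dominant part and the asymptotic bound -/

set_option maxHeartbeats 1000000 in
-- A branch vertex `x` uses a proportion `ρ x` of its edges to `N`. Moving tokens from `w` to an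
-- adjacent `z` at rate `κ * (ρ z - ρ w)`, when positive, replaces each neighbour's proportion by
-- that of `z` itself. The load at `z` becomes about `p' * d z * ρ z`, at most slightly above `b /
-- 2`, which a hub of size `0.53 b` can serve.
theorem exists_routes_threshold : ∃ K : ℕ, ∀ b, K ≤ b → ∀ q r : ℕ, b ≤ q + 1 → q ≤ 2 * b →
    53 * b ≤ 100 * r → ∀ {V : Type u} [Finite V] (G : SimpleGraph V) (X R : Finset V),
    G.Joined X R → #X = q + b → #R = r → (∀ v ∈ X, G.codeg X v + 1 ≤ q) →
    ∃ N ⊆ X, #N = q ∧ G.Routes (pairs X ∪ across N R) (pairs (X \ N)) := by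
  obtain ⟨K₁, hK₁⟩ := exists_rounding_threshold.{u} (c := 1 / 10000) (by norm_num)
  obtain ⟨K₂, hK₂⟩ := exists_rounding_threshold.{u} (c := 1 / 5000) (by norm_num)
  refine ⟨max (max K₁ K₂) (10 ^ 15), fun b hb q r hbq hq2 hr V _ G X R hj hX hR hcd => ?_⟩
  have hb₁ := hK₁ b ((le_max_left _ _).trans ((le_max_left _ _).trans hb))
  have hb₂ := hK₂ b ((le_max_right _ _).trans ((le_max_left _ _).trans hb))
  have hb0 : 10 ^ 15 ≤ b := (le_max_right _ _).trans hb
  clear hb hK₁ hK₂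
  have hbR : (10 : ℝ) ^ 15 ≤ b := by exact_mod_cast hb0
  have hbqR : (b : ℝ) ≤ q + 1 := by exact_mod_cast hbq
  have hq2R : (q : ℝ) ≤ 2 * b := by exact_mod_cast hq2
  have hXR : (#X : ℝ) = q + b := by exact_mod_cast hX
  set B' : ℝ := (b : ℝ) with hB'
  set Q : ℝ := (q : ℝ) with hQ'
  have hB0 : 0 < B' := by linarith
  have hQ0 : 0 < Q := by linarith
  have hQB : 0 < Q + B' := by linarith
  let h : V → ℝ := fun v => G.codeg X v
  let d : V → ℝ := fun v => #(X.filter (G.Adj v))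
  have hh0 : ∀ v, 0 ≤ h v := fun v => Nat.cast_nonneg _
  have hhq : ∀ v ∈ X, h v + 1 ≤ Q := fun v hv => by
    have := hcd v hv
    simp only [h]
    rw [hQ']
    exact_mod_cast this
  have hhd : ∀ v ∈ X, h v + d v + 1 = Q + B' := fun v hv => by
    rw [← hXR]
    simp only [h, d]
    exact_mod_cast codeg_add_degree (G := G) hv
  have hdB : ∀ v ∈ X, B' ≤ d v := fun v hv => by
    have := hhq v hv
    have := hhd v hv
    linarith
  -- About `p * d v` edges lead from `v` to `N`. The first term yields about `p' * h v` tokens, the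
  -- expected codegree among the branch vertices; `1 / 100` is slack for rounding and bounds `ρ`
  -- away from zero. When the minimum is `1`, all edges to `N` are used, and these suffice by the
  -- codegree hypothesis.
  let ρ : V → ℝ := fun v => min 1 (B' * h v / (Q * d v) + 1 / 100)
  have hρ1 : ∀ v, ρ v ≤ 1 := fun v => min_le_left _ _
  have hρ0 : ∀ v, 1 / 100 ≤ ρ v := fun v => by
    refine le_min (by norm_num) ?_
    have : 0 ≤ B' * h v / (Q * d v) :=
      div_nonneg (mul_nonneg hB0.le (hh0 v)) (mul_nonneg hQ0.le (Nat.cast_nonneg _))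
    linarith
  obtain ⟨N, hNX, hN, hbal⟩ := hb₁.exists_balanced (G := G) hX hq2 (by omega) ρ
    fun x _ => ⟨by linarith [hρ0 x], hρ1 x⟩
  rw [← hQ', ← hB'] at hbal
  set p : ℝ := Q / (Q + B') with hp
  set p' : ℝ := B' / (Q + B') with hp'
  have hpp : p + p' = 1 := by
    rw [hp, hp', ← add_div, div_self hQB.ne']
  have hpQ : p' * (Q + B') = B' := div_mul_cancel₀ _ hQB.ne'
  have hp'0 : 1 / 3 ≤ p' := by
    rw [hp', le_div_iff₀ hQB]
    linarith
  have hp'1 : p' ≤ 501 / 1000 := by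
    rw [hp', div_le_iff₀ hQB]
    linarith
  have hp0 : 499 / 1000 ≤ p := by linarith
  set κ : ℝ := B' / Q with hκ
  have hκ0 : 0 ≤ κ := div_nonneg hB0.le hQ0.le
  have hκ1 : κ ≤ 100 / 99 := by
    rw [hκ, div_le_iff₀ hQ0]
    linarith
  have hκp : κ * p = p' := by
    rw [hκ, hp, hp']
    field_simp
  have hdis : Disjoint (X \ N) N := sdiff_disjoint
  have hXN : X \ N ∪ N = X := sdiff_union_of_subset hNX
  have hBc : #(X \ N) = b := by
    rw [card_sdiff_of_subset hNX]
    omega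
  obtain ⟨U, Ψ, hU, hΨ, hU1, hUx, hUz, hout, hin⟩ := hb₂.exists_tokens (G := G) (κ := κ) hdis
    (by omega) ρ hκ0 (fun x _ => ⟨by linarith [hρ0 x], hρ1 x⟩) (by
      intro w _ z _
      -- The floor `1 / 100` of `ρ` compensates for `κ` being possibly a little larger than one.
      have h1 : ρ z - ρ w ≤ 99 / 100 := by linarith [hρ0 w, hρ1 z]
      calc κ * (ρ z - ρ w) ≤ κ * (99 / 100) := mul_le_mul_of_nonneg_left h1 hκ0
        _ ≤ 1 := by linarith)
  rw [← hB'] at hUx hUz hout hin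
  set τ : ℝ := B' / 5000 with hτ
  have hτ1 : 2 * (1 / 10000) * B' = τ := by rw [hτ]; ring
  have hτ2 : 1 / 5000 * B' = τ := by rw [hτ]; ring
  rw [hτ1] at hbal
  rw [hτ2] at hUx hUz hout hin
  -- loads
  have hL : ∀ z ∈ N, (#(U z) : ℝ) + #(Ψ.filter fun d => d.2 = z) -
      #(Ψ.filter fun d => d.1 = z) ≤ 5126 / 10000 * B' ∧
      23 / 10000 * B' ≤ (#(U z) : ℝ) - #(Ψ.filter fun d => d.1 = z) := by
    intro z hz
    have hzX := hNX hz
    obtain ⟨-, b2, b3, b4⟩ := hbal z hzX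
    have e1 := abs_le.1 (hUz z hz)
    have e2 := abs_le.1 (hout z hz)
    have e3 := abs_le.1 (hin z hz)
    have b2 := abs_le.1 b2
    have b3 := abs_le.1 b3
    have b4 := abs_le.1 b4
    set a := ∑ x ∈ X.filter (G.Adj z), ρ x with ha
    set aN := ∑ x ∈ N.filter (G.Adj z), ρ x with haN
    set SP := ∑ x ∈ X.filter (G.Adj z), max (ρ x - ρ z) 0 with hSP
    set SPN := ∑ x ∈ N.filter (G.Adj z), max (ρ x - ρ z) 0
    set SM := ∑ x ∈ X.filter (G.Adj z), max (ρ z - ρ x) 0 with hSM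
    set SMN := ∑ x ∈ N.filter (G.Adj z), max (ρ z - ρ x) 0
    have haB : ∑ x ∈ (X \ N).filter (G.Adj z), ρ x = a - aN := by
      rw [eq_sub_iff_add_eq, haN, ← sum_union (disjoint_filter_filter hdis), ← filter_union, hXN]
    rw [haB] at e1
    -- Tokens placed minus tokens sent away plus tokens received, up to the factor `p'`: each
    -- neighbour `x` contributes `ρ z` instead of `ρ x`.
    have i1 : a - SP + SM = d z * ρ z := by
      rw [ha, hSP, hSM, ← sum_sub_distrib, ← sum_add_distrib]
      rw [sum_congr rfl (g := fun _ => ρ z), sum_const, nsmul_eq_mul]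
      intro x _
      rcases le_total (ρ x) (ρ z) with hle | hle
      · rw [max_eq_right (by linarith), max_eq_left (by linarith)]
        ring
      · rw [max_eq_left (by linarith), max_eq_right (by linarith)]
        ring
    -- Here `a - SP` is the sum of `min (ρ x) (ρ z)`. A positive share of the tokens stays at `z`,
    -- as the greedy choice of transfers requires.
    have i2 : d z * (1 / 100) ≤ a - SP := by
      rw [ha, hSP, ← sum_sub_distrib, ← nsmul_eq_mul, ← sum_const]
      refine sum_le_sum fun x _ => ?_
      rcases le_total (ρ x) (ρ z) with hle | hle
      · rw [max_eq_right (by linarith)]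
        linarith [hρ0 x]
      · rw [max_eq_left (by linarith)]
        linarith [hρ0 z]
    have i3 : d z * ρ z ≤ B' + d z * (1 / 100) := by
      have hd := hdB z hzX
      have hd0 : 0 < d z := by linarith
      have hle : ρ z ≤ B' * h z / (Q * d z) + 1 / 100 := min_le_right _ _
      calc d z * ρ z ≤ d z * (B' * h z / (Q * d z) + 1 / 100) := mul_le_mul_of_nonneg_left hle hd0.le
        _ = B' * (h z / Q) + d z * (1 / 100) := by field_simp
        _ ≤ B' * 1 + d z * (1 / 100) := by
            have : h z / Q ≤ 1 := by
              rw [div_le_one hQ0]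
              linarith [hhq z hzX]
            have := mul_le_mul_of_nonneg_left this hB0.le
            linarith
        _ = _ := by ring
    have i4 : p' * (d z * ρ z) ≤ 511 / 1000 * B' := by
      have j1 : p' * d z ≤ B' := by
        have j2 : d z ≤ Q + B' := by linarith [hhd z hzX, hh0 z]
        have := mul_le_mul_of_nonneg_left j2 (by linarith : 0 ≤ p')
        linarith
      have j2 := mul_le_mul_of_nonneg_left i3 (by linarith : 0 ≤ p')
      have j3 := mul_le_mul_of_nonneg_right hp'1 hB0.le
      linarith
    have i5 : 1 / 300 * B' ≤ p' * (a - SP) := by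
      have j1 : B' * (1 / 100) ≤ a - SP := by linarith [hdB z hzX]
      have j2 := mul_le_mul hp'0 j1 (by positivity) (by linarith)
      linarith
    have k1 : κ * SPN ≤ p' * SP + 100 / 99 * τ := by
      have j1 := mul_le_mul_of_nonneg_left (show SPN ≤ p * SP + τ by linarith [b3.2]) hκ0
      have j2 := mul_le_mul_of_nonneg_right hκ1 (show 0 ≤ τ by positivity)
      rw [mul_add, ← mul_assoc, hκp] at j1
      linarith
    have k2 : p' * SP - 100 / 99 * τ ≤ κ * SPN := by
      have j1 := mul_le_mul_of_nonneg_left (show p * SP - τ ≤ SPN by linarith [b3.1]) hκ0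
      have j2 := mul_le_mul_of_nonneg_right hκ1 (show 0 ≤ τ by positivity)
      rw [mul_sub, ← mul_assoc, hκp] at j1
      linarith
    have k3 : κ * SMN ≤ p' * SM + 100 / 99 * τ := by
      have j1 := mul_le_mul_of_nonneg_left (show SMN ≤ p * SM + τ by linarith [b4.2]) hκ0
      have j2 := mul_le_mul_of_nonneg_right hκ1 (show 0 ≤ τ by positivity)
      rw [mul_add, ← mul_assoc, hκp] at j1
      linarith
    have k4 : p * a = a - p' * a := by rw [show p = 1 - p' by linarith]; ring
    rw [← i1] at i4
    rw [mul_add, mul_sub] at i4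
    rw [mul_sub] at i5
    constructor <;> linarith [e1.1, e1.2, e2.1, e2.2, e3.1, e3.2, b2.1, b2.2]
  -- the numbers of tokens
  have hTok : ∀ x ∈ X \ N, G.codeg (X \ N) x ≤ #(N.filter fun w => x ∈ U w) ∧
      4 * b ≤ 1000 * #(N.filter fun w => x ∈ U w) := by
    intro x hx
    have hxX := (mem_sdiff.1 hx).1
    obtain ⟨b1, -⟩ := hbal x hxX
    have b1 := abs_le.1 b1
    have hd := hdB x hxX
    have hd0 : 0 < d x := by linarith
    change -τ ≤ (#(N.filter (G.Adj x)) : ℝ) - p * d x ∧ (#(N.filter (G.Adj x)) : ℝ) - p * d x ≤ τ at b1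
    have hdN : 498 / 1000 * B' ≤ (#(N.filter (G.Adj x)) : ℝ) := by
      have := mul_le_mul hp0 hd hB0.le (by linarith)
      linarith [b1.1]
    have hsplit : #((X \ N).filter (G.Adj x)) + #(N.filter (G.Adj x)) = #(X.filter (G.Adj x)) := by
      rw [← card_union_of_disjoint (disjoint_filter_filter hdis), ← filter_union, hXN]
    have hcB := codeg_add_degree (G := G) hx
    have hcX := codeg_add_degree (G := G) hxX
    by_cases hρx : ρ x = 1
    · have heq : (N.filter fun w => x ∈ U w) = N.filter (G.Adj x) := by
        ext w
        rw [mem_filter, mem_filter]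
        exact ⟨fun hw => ⟨hw.1, (hU w hw.1 x hw.2).2⟩, fun hw => ⟨hw.1, hU1 x hx hρx w hw.1 hw.2⟩⟩
      rw [heq]
      constructor
      · have := hcd x hxX
        omega
      · have h1 : (4 * b : ℝ) ≤ 1000 * #(N.filter (G.Adj x)) := by
          rw [← hB']
          linarith
        exact_mod_cast h1
    · have hρx' : ρ x = B' * h x / (Q * d x) + 1 / 100 := by
        rcases min_choice 1 (B' * h x / (Q * d x) + 1 / 100) with h1 | h1
        · exact absurd h1 hρx
        · exact h1
      have e1 := abs_le.1 (hUx x hx)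
      have e2 : p' * h x + 499 / 100000 * B' - τ ≤ ρ x * #(N.filter (G.Adj x)) := by
        have j0 : 0 ≤ ρ x := by linarith [hρ0 x]
        have j1 := mul_le_mul_of_nonneg_left (show p * d x - τ ≤ (#(N.filter (G.Adj x)) : ℝ) by linarith [b1.1]) j0
        have j2 := mul_le_mul_of_nonneg_right (hρ1 x) (show 0 ≤ τ by positivity)
        have j3 : ρ x * (p * d x) = p' * h x + p * d x * (1 / 100) := by
          rw [hρx', ← hκp, hκ]
          field_simp
        have j4 : 499 / 1000 * B' ≤ p * d x := mul_le_mul hp0 hd hB0.le (by linarith)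
        rw [mul_sub, j3] at j1
        linarith
      have e3 : (G.codeg (X \ N) x : ℝ) ≤ p' * h x + τ := by
        have j1 : (G.codeg (X \ N) x : ℝ) + #((X \ N).filter (G.Adj x)) + 1 = B' := by
          rw [hBc] at hcB
          have := congrArg (Nat.cast (R := ℝ)) hcB
          push_cast at this
          exact this
        have j2 : (#((X \ N).filter (G.Adj x)) : ℝ) + #(N.filter (G.Adj x)) = d x := by
          simp only [d]
          exact_mod_cast hsplit
        have j3 := hhd x hxX
        have j4 : p' * (h x + d x + 1) = B' := by rw [j3]; exact hpQ
        have j5 : p * d x = d x - p' * d x := by rw [show p = 1 - p' by linarith]; ring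
        rw [mul_add, mul_add] at j4
        linarith [b1.2]
      have e4 := mul_nonneg (by linarith : 0 ≤ p') (hh0 x)
      constructor
      · have h1 : (G.codeg (X \ N) x : ℝ) ≤ #(N.filter fun w => x ∈ U w) := by linarith [e1.1]
        exact_mod_cast h1
      · have h1 : (4 * b : ℝ) ≤ 1000 * #(N.filter fun w => x ∈ U w) := by
          rw [← hB']
          linarith [e1.1]
        exact_mod_cast h1
  obtain ⟨x₀, hx₀⟩ : X.Nonempty := card_pos.1 (by omega)
  have : Nonempty V := ⟨x₀⟩
  -- `C = 1000` works since at least `0.0023 b` tokens remain at each vertex, while at most `q ≤ 2b`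
  -- arrive. `s = 1000` works since each branch vertex has more than `0.004 b` tokens. The loads are
  -- below `0.52 b`, and the remaining `0.01 b` of the hub exceeds `1001² * (10⁶ + 1)` because `b ≥
  -- 10¹⁵`.
  have hroute := Routes.of_tokens (G := G) (B := X \ N) (N := N) (R := R) (C := 1000) (s := 1000)
    (Δ := 52 * b / 100) hdis (disjoint_of_subset_left sdiff_subset hj.disjoint)
    (hj.mono hNX Subset.rfl) (by norm_num) U Ψ hU hΨ (by
      rintro ⟨w, z⟩ he
      obtain ⟨hw, hz, -⟩ := hΨ w z he
      have h1 := (hL w hw).2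
      have h2 : #(Ψ.filter fun d => d.2 = z) ≤ q := by
        rw [← hN]
        refine card_le_card_of_injOn Prod.fst (fun e he => ?_) fun e he e' he' hee => ?_
        · exact (hΨ e.1 e.2 (mem_filter.1 he).1).1
        · exact Prod.ext hee ((mem_filter.1 he).2.trans (mem_filter.1 he').2.symm)
      have h3 : (#(Ψ.filter fun d => d.2 = z) : ℝ) ≤ Q := by rw [hQ']; exact_mod_cast h2
      have h4 : (1000 * #(Ψ.filter fun d => d.1 = w) + #(Ψ.filter fun d => d.2 = z) : ℝ) ≤
          1000 * #(U w) := by linarith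
      exact_mod_cast h4) (fun x hx => (hTok x hx).1) (fun x hx => by
      rw [hBc]
      exact (hTok x hx).2) (by
      intro z hz
      have h1 := (hL z hz).1
      have h2 : (10000 * (#(U z) + #(Ψ.filter fun d => d.2 = z)) : ℝ) ≤
          5126 * b + 10000 * #(Ψ.filter fun d => d.1 = z) := by
        rw [← hB']
        linarith
      have h3 : 10000 * (#(U z) + #(Ψ.filter fun d => d.2 = z)) ≤
          5126 * b + 10000 * #(Ψ.filter fun d => d.1 = z) := by exact_mod_cast h2
      omega) (by
      rw [hR]
      norm_num
      omega)
  rw [hXN] at hroute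
  exact ⟨N, hNX, hN, hroute⟩

/-- The branch set is all of `R` together with `b = χ(C) - excess(R)` vertices of `C`. The vertices
of `R` use a hub `M` inside `C`, those of `C` use tokens on `N` and the hub `R`. As `b` is at most
`excess(C) + 1`, the inequality `2 * k₀ + 153 ≤ 51 * s` is what makes `100 * #R ≥ 53 * b`. -/
theorem exists_linked_of_dominant_threshold : ∃ K : ℕ, ∀ s k₀ : ℕ, 3 * K ≤ s → 2 * k₀ + 153 ≤ 51 * s →
    ∀ {V : Type u} [Finite V] {G : SimpleGraph V} {X C : Finset V}, G.SlackOn X → G.Splits X C →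
    2 * G.chi C ≤ #C + 1 → #(X \ C) < G.excess C → 3 * #X + s ≤ 5 * G.chi X → G.chi X ≤ k₀ →
    G.Linked X (G.chi X) := by
  obtain ⟨K, hK⟩ := exists_routes_threshold.{u}
  refine ⟨K, fun s k₀ hsK hsk V _ G X C hs hC hC1 hC2 hn hk => ?_⟩
  have hXX : G.Splits X X := ⟨Subset.rfl, fun x _ y hy => by simp at hy⟩
  have e1 := hXX.excess_sdiff hC hC.1
  have e2 := hXX.chi_sdiff hC hC.1
  have e3 := G.chi_add_excess (X := X)
  have e4 := G.chi_add_excess (X := C)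
  have e5 := G.chi_add_excess (X := X \ C)
  set R := X \ C with hR
  have hCR : C ∪ R = X := union_sdiff_of_subset hC.1
  have hj : G.Joined C R := hC.2
  -- `M` gets the size of the excess of `R`, just enough for a hub for `R` in view of slackness.
  obtain ⟨M, hMC, hM⟩ := exists_subset_card_eq (s := C) (n := G.excess R) (by omega)
  have hVC : C \ M ⊆ C := sdiff_subset
  have hVc : #(C \ M) = G.excess C + (G.chi C - G.excess R) := by
    rw [card_sdiff_of_subset hMC]
    omega
  obtain ⟨N, hNV, hN, hr⟩ := hK (G.chi C - G.excess R) (by omega) (G.excess C) #R (by omega)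
    (by omega) (by omega) G (C \ M) R (hj.mono hVC Subset.rfl) hVc rfl (by
      intro v hv
      have h1 := codeg_mono (G := G) hVC v
      rcases hs.codeg_le hC (hVC hv) with h | h <;> omega)
  have hB : (C \ M) \ N ⊆ C \ M := sdiff_subset
  have hCRd := Finset.disjoint_left.1 hj.disjoint
  have dNR : Disjoint N R := disjoint_of_subset_left (hNV.trans hVC) hj.disjoint
  have dVR : Disjoint (C \ M) R := disjoint_of_subset_left hVC hj.disjoint
  have dNM : Disjoint N M := disjoint_of_subset_left hNV sdiff_disjoint
  have dBR : Disjoint ((C \ M) \ N) R := disjoint_of_subset_left hB dVR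
  have dBM : Disjoint ((C \ M) \ N) M := disjoint_of_subset_left hB sdiff_disjoint
  have dBN : Disjoint ((C \ M) \ N) N := sdiff_disjoint
  have dVM : Disjoint (C \ M) M := sdiff_disjoint
  have rR : G.Routes (pairs R ∪ across R M) (pairs R) := by
    refine Routes.of_hub (hj.symm.mono Subset.rfl hMC) fun v hv => ?_
    rw [hM]
    exact hs.codeg_le hC.compl hv
  have rB : G.Routes (across ((C \ M) \ N) R) (across ((C \ M) \ N) R) :=
    Routes.of_subset_edgeSet le_rfl (across_subset_edgeSet (hj.mono (hB.trans hVC) Subset.rfl))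
  refine ⟨(C \ M) \ N ∪ R, ?_, ?_, ((hr.union rR ?_).union rB ?_).mono ?_ pairs_union⟩
  · rw [← hCR]
    exact union_subset_union (hB.trans hVC) Subset.rfl
  · rw [card_union_of_disjoint dBR, card_sdiff_of_subset hNV]
    omega
  · rw [Set.disjoint_union_left, Set.disjoint_union_right, Set.disjoint_union_right]
    exact ⟨⟨disjoint_pairs dVR, disjoint_pairs_across dVR⟩,
      (disjoint_pairs_across dNR.symm).symm, disjoint_across dNR dNM⟩
  · rw [Set.disjoint_union_left, Set.disjoint_union_left, Set.disjoint_union_left]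
    refine ⟨⟨across_comm (X := R) ▸ disjoint_pairs_across dVR, (disjoint_across dBN dBR).symm⟩,
      disjoint_pairs_across dBR.symm, (disjoint_across dBR dBM).symm⟩
  · rw [← hCR]
    refine Set.union_subset (Set.union_subset (Set.union_subset ?_ ?_) (Set.union_subset ?_ ?_)) ?_
    · exact pairs_mono (hVC.trans subset_union_left)
    · exact (across_mono (hNV.trans hVC) Subset.rfl).trans (across_subset_pairs hj.disjoint)
    · exact pairs_mono subset_union_right
    · rw [across_comm]
      exact (across_mono hMC Subset.rfl).trans (across_subset_pairs hj.disjoint)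
    · exact (across_mono (hB.trans hVC) Subset.rfl).trans (across_subset_pairs hj.disjoint)

/-- From `100n ≤ 164k` one has `5k - 3n ≥ 0.08k`. This margin, fixed at the initial `k₀`, is not
reduced when parts with `5χ ≤ 3|C|` are split off, and it is large compared with the constants as
soon as `k₀` is. -/
theorem exists_linked_threshold : ∃ K : ℕ, ∀ {V : Type u} [Finite V] {G : SimpleGraph V}
    {X : Finset V}, G.CriticalOn X → K ≤ G.chi X → 100 * #X ≤ 164 * G.chi X →
    G.Linked X (G.chi X) := by
  obtain ⟨K, hK⟩ := exists_linked_of_dominant_threshold.{u}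
  refine ⟨40 * K + 200, fun {V} _ {G X} hX hk hn => ?_⟩
  set k₀ := G.chi X with hk₀
  refine hX.linked_of_slack (fun n k => 3 * n + 8 * k₀ / 100 ≤ 5 * k ∧ k ≤ k₀)
    (fun n k n' k' h1 h2 => by omega) ?_ (by omega)
  intro Y hY hYQ hs
  rcases hY.linked_or_dominant hs (by omega) with h1 | ⟨C, hC, hC1, hC2⟩
  · exact h1
  · exact hK (8 * k₀ / 100) k₀ (by omega) (by omega) hs hC hC1 hC2 hYQ.1 hYQ.2

end SimpleGraph

theorem theorem1 :
    (∀ (V : Type u) [Fintype V] (G : SimpleGraph V) (k : ℕ),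
      G.chromaticNumber = (k : ℕ∞) →
      (Fintype.card V : ℝ) < 1.4 * (k : ℝ) - 0.6 →
      G.ContainsWeakImmersion (SimpleGraph.completeGraph (Fin k))) ∧
    (∀ ε : ℝ, 0 < ε → ∃ K : ℕ, ∀ k : ℕ, K ≤ k →
      ∀ (V : Type u) [Fintype V] (G : SimpleGraph V),
        G.chromaticNumber = (k : ℕ∞) →
        (Fintype.card V : ℝ) < (1.64 - ε) * (k : ℝ) →
        G.ContainsWeakImmersion (SimpleGraph.completeGraph (Fin k))) := by
  constructor
  · intro V _ G k hk hn
    obtain ⟨X, -, hX, hXk⟩ := G.exists_criticalOn Finset.univ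
    rw [SimpleGraph.chi_univ_eq hk] at hXk
    have h1 : (5 * Fintype.card V + 3 : ℝ) < 7 * k := by linarith
    have h2 : 5 * Fintype.card V + 3 < 7 * k := by exact_mod_cast h1
    have h3 := Finset.card_le_univ X
    have h4 := hX.linked_of_five_mul_card (by omega)
    rw [hXk] at h4
    exact h4.containsWeakImmersion
  · intro ε hε
    obtain ⟨K, hK⟩ := SimpleGraph.exists_linked_threshold.{u}
    refine ⟨K, fun k hKk V _ G hk hn => ?_⟩
    obtain ⟨X, -, hX, hXk⟩ := G.exists_criticalOn Finset.univ
    rw [SimpleGraph.chi_univ_eq hk] at hXk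
    have h1 : (100 * Fintype.card V : ℝ) ≤ 164 * k := by
      have : 0 ≤ ε * k := by positivity
      linarith
    have h2 : 100 * Fintype.card V ≤ 164 * k := by exact_mod_cast h1
    have h3 := Finset.card_le_univ X
    have h4 := hK hX (by omega) (by omega)
    rw [hXk] at h4
    exact h4.containsWeakImmersion
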